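/- **Notation.** For $\alpha\in\mathbb R$ write $\Theta(\alpha)=(\cos\alpha,\sin\alpha)$, $\Theta^\perp(\alpha)=(-\sin\alpha,\cos\alpha)$, and let $\hat f(\alpha,p)=\int_{\mathbb R} f(p\,\Theta(\alpha)+s\,\Theta^\perp(\alpha))\,ds$ be the Radon transform of $f:\mathbb R^2\to\mathbb R$. **The function.** Let $f=\sum_{j=1}^n \chi_{D_j}f_j$, where each $D_j\subset\mathbb R^2$ is a bounded open set whose boundary is piecewise $C^\infty$ (a finite union of simple regular $C^\infty$ arcs, smooth up to their end points, distinct arcs meeting at most at end points), and $f_j$ is $C^\infty$ on an open set containing $\overline{D_j}$. Let $\mathcal S=\bigcup_j\partial D_j$. **The point.** Let $x_0\in\mathcal S$ be a point near which $\mathcal S$ is a smooth curve whose curvature at $x_0$ is not zero. Let $\Theta_0=\Theta(\theta_0)$ be the unit normal to $\mathcal S$ at $x_0$ that points towards the center of curvature, and put $\Theta_0^\perp=\Theta^\perp(\theta_0)$. The side of $\mathcal S$ near $x_0$ to which $\Theta_0$ points is called positive, the other one negative. Suppose that the line $\{x:(x-x_0)\cdot\Theta_0=0\}$ is not tangent to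 $\mathcal S$ at any point other than $x_0$ (at a corner of $\mathcal S$, tangency to any one of the arcs that end there counts as tangency). **The kernel.** Let $\varphi:\mathbb R\to\mathbb R$ be compactly supported, of class $C^2$ with $\varphi''$ Lipschitz (that is, $\varphi^{(j)}\in L^\infty(\mathbb R)$ for $0\le j\le3$), with $\int\varphi=1$ and $\sum_{j\in\mathbb Z}j^m\varphi(t-j)=t^m$ for all $t\in\mathbb R$ and $m=0,1,2$. **The reconstruction.** Given $\kappa>0$, $q\in\mathbb R$ and a smooth cut-off $\chi$, put for $\varepsilon>0$ $$\alpha_k=\kappa\varepsilon(q+k),\qquad f_{\Lambda\varepsilon}(x)=-\frac1{2\pi\varepsilon^2}\sum_{k\in\mathbb Z}\sum_{j\in\mathbb Z}\varphi''\!\left(\frac{\Theta(\alpha_k)\cdot x-\varepsilon j}{\varepsilon}\right)\hat f(\alpha_k,\varepsilon j)\,\chi(\alpha_k)\,\kappa\varepsilon .$$ **Claim.** The limits $f_\pm(x_0)$ of $f$ at $x_0$ from the positive and the negative side of $\mathcal S$ exist, and there is $\delta>0$, depending only on $x_0$, $\theta_0$ and the $D_j$, $f_j$, such that the following holds. Let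 $\chi\in C^\infty(\mathbb R)$ with $\operatorname{supp}\chi\subset(\theta_0-\delta,\theta_0+\delta)$ and $\chi(\theta_0)=1$, let $\varphi$ be as above, let $\kappa>0$ and $q\in\mathbb R$, and suppose that $x_0$ is generic, i.e. that $(\Theta_0^\perp\cdot x_0)\kappa$ is irrational. Then for every $\check x\in\mathbb R^2$, with $h=\Theta_0\cdot\check x$, $$\lim_{\varepsilon\to0^+}\varepsilon f_{\Lambda\varepsilon}(x_0+\varepsilon\check x)=\bigl(f_+(x_0)-f_-(x_0)\bigr)\int_{\mathbb R}\frac{\varphi(h-r)}{\pi r}\,dr ,$$ where the integral is a principal value at $r=0$, i.e. the limit as $\eta\to0^+$ of the integral over $|r|>\eta$, which exists. -/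

import Mathlib

open Set Filter Topology
open scoped ContDiff

noncomputable section

namespace LambdaTomography

/-- The Euclidean plane. -/
abbrev Plane : Type := EuclideanSpace ℝ (Fin 2)

/-- The unit vector with polar angle `α`. -/
def dir (α : ℝ) : Plane := !₂[Real.cos α, Real.sin α]

/-- The unit vector `dir α` rotated by a right angle counterclockwise. -/
def dirPerp (α : ℝ) : Plane := !₂[-Real.sin α, Real.cos α]

/-- The Radon transform: the integral of `f` over the line of all `x` with `x ⬝ dir α = p`,
with respect to arc length. -/
def radon (f : Plane → ℝ) (α p : ℝ) : ℝ := ∫ s : ℝ, f (p • dir α + s • dirPerp α)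

/-- The boundary of `D` is piecewise smooth: it is a finite union of simple regular arcs, each
smooth up to its end points, and distinct arcs meet at most at their end points. -/
def HasPiecewiseSmoothBoundary (D : Set Plane) : Prop :=
  ∃ (m : ℕ) (γ : Fin m → ℝ → Plane),
    (∀ i, ContDiff ℝ ∞ (γ i)) ∧
    (∀ i, ∀ t ∈ Icc (0 : ℝ) 1, deriv (γ i) t ≠ 0) ∧
    (∀ i, InjOn (γ i) (Icc (0 : ℝ) 1)) ∧
    (∀ i j, i ≠ j → ∀ s ∈ Icc (0 : ℝ) 1, ∀ t ∈ Icc (0 : ℝ) 1, γ i s = γ j t →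
      (s = 0 ∨ s = 1) ∧ (t = 0 ∨ t = 1)) ∧
    frontier D = ⋃ i, γ i '' Icc (0 : ℝ) 1

/-- One piece `(D, F)` of a piecewise smooth function: `D` is open and bounded with piecewise
smooth boundary, and `F` is smooth in an open set that contains the closure of `D`. -/
structure IsSmoothPiece (D : Set Plane) (F : Plane → ℝ) : Prop where
  isOpen : IsOpen D
  isBounded : Bornology.IsBounded D
  boundary : HasPiecewiseSmoothBoundary D
  smooth : ∃ V : Set Plane, IsOpen V ∧ closure D ⊆ V ∧ ContDiffOn ℝ ∞ F V

/-- The function `∑ i, 1_{D i} F i`. -/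
def piecewiseSum {n : ℕ} (D : Fin n → Set Plane) (F : Fin n → Plane → ℝ) (x : Plane) : ℝ :=
  ∑ i, (D i).indicator (F i) x

/-- The set `S`, the union of the boundaries of the `D i`. -/
def jumpSet {n : ℕ} (D : Fin n → Set Plane) : Set Plane := ⋃ i, frontier (D i)

/-- Near `x₀` the set `S` is a smooth curve through `x₀`, with nonzero curvature at `x₀`, and
`dir θ₀` is the unit normal at `x₀` that points towards the center of curvature. The curve is
written as a graph `x = x₀ + s • dirPerp θ₀ + g s • dir θ₀` over its tangent line at `x₀`; as
`g 0 = 0` and `g' 0 = 0`, its curvature vector at `x₀` is `g'' 0 • dir θ₀`. -/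
structure IsCurvedNear (S : Set Plane) (x₀ : Plane) (θ₀ : ℝ) (g : ℝ → ℝ) : Prop where
  smooth : ContDiff ℝ ∞ g
  map_zero : g 0 = 0
  deriv_zero : deriv g 0 = 0
  curvature_pos : 0 < deriv (deriv g) 0
  eq_graph : ∀ᶠ x in 𝓝 x₀,
    (x ∈ S ↔ inner ℝ (dir θ₀) (x - x₀) = g (inner ℝ (dirPerp θ₀) (x - x₀)))

/-- The side of the graph to which `dir θ₀` points. -/
def positiveSide (x₀ : Plane) (θ₀ : ℝ) (g : ℝ → ℝ) : Set Plane :=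
  {x | g (inner ℝ (dirPerp θ₀) (x - x₀)) < inner ℝ (dir θ₀) (x - x₀)}

/-- The opposite side of the graph. -/
def negativeSide (x₀ : Plane) (θ₀ : ℝ) (g : ℝ → ℝ) : Set Plane :=
  {x | inner ℝ (dir θ₀) (x - x₀) < g (inner ℝ (dirPerp θ₀) (x - x₀))}

/-- The line through `x₀` perpendicular to `dir θ₀` is tangent to `S` at its point `z`.
For a finite union of regular arcs the tangent cone at `z` is the union of the tangent lines at
`z` (one-sided ones at end points) of the arcs through `z`. -/
def LineTangentAt (S : Set Plane) (x₀ : Plane) (θ₀ : ℝ) (z : Plane) : Prop :=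
  z ∈ S ∧ inner ℝ (dir θ₀) (z - x₀) = 0 ∧ dirPerp θ₀ ∈ tangentConeAt ℝ S z

/-- The assumptions on the interpolation kernel. Together with compact support, `contDiff` and
`lipschitz` say that `φ` and its (weak) derivatives up to order three are bounded. -/
structure IsInterpolationKernel (φ : ℝ → ℝ) : Prop where
  exact_two : ∀ m : ℕ, m ≤ 2 → ∀ t : ℝ, HasSum (fun j : ℤ => (j : ℝ) ^ m * φ (t - j)) (t ^ m)
  compactSupport : HasCompactSupport φ
  contDiff : ContDiff ℝ 2 φ
  lipschitz : ∃ K, LipschitzWith K (deriv (deriv φ))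
  normalized : ∫ y : ℝ, φ y = 1

/-- The angles `α_k = κ ε (q + k)`. -/
def angle (κ q ε : ℝ) (k : ℤ) : ℝ := κ * ε * (q + k)

/-- The Lambda tomography reconstruction of `f` at `x` from the data `radon f α_k (ε j)`, with
the angular cut-off `χ`. Both sums have only finitely many nonzero terms when `φ` and `χ` have
compact support and `κ, ε > 0`. -/
def lambdaRecon (f : Plane → ℝ) (φ χ : ℝ → ℝ) (κ q ε : ℝ) (x : Plane) : ℝ :=
  -(1 / (2 * Real.pi * ε ^ 2)) * ∑' k : ℤ, ∑' j : ℤ,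
    deriv (deriv φ) ((inner ℝ (dir (angle κ q ε k)) x - ε * j) / ε) *
      radon f (angle κ q ε k) (ε * j) * χ (angle κ q ε k) * (κ * ε)

/-- `L` is the principal value of `∫ φ (h - r) / (π r) dr`. -/
def IsPVTransform (φ : ℝ → ℝ) (h L : ℝ) : Prop :=
  Tendsto (fun η : ℝ => ∫ r in {r : ℝ | η < |r|}, φ (h - r) / (Real.pi * r)) (𝓝[>] 0) (𝓝 L)

end LambdaTomography

end

namespace LambdaTomography

open MeasureTheory

/-! Write `α_k = θ₀ + β`. In coordinates with origin `x₀` and horizontal axis along the tangent, the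
Radon transform is a slice integral `H t p` over the line of slope `-t`, `t = tan β`, up to the
factor `1 / cos β`. For fixed `k` the sum over `j` applies to the offset variable a discrete second
derivative (`stencil`) that kills affine functions, because the kernel reproduces polynomials of
degree at most one. Thus `ε` times the reconstruction is `-(1 / 2π) κ ∑ χ · stencil`, and each term
measures how far `H t` is from affine on a window of offsets of width of order `ε`. The angles fall
into three ranges.

(1) Angles with `ρ ≤ |β|`, within the cut-off. Nearby lines through `x₀` other than the tangent
cross `S` transversally, so `H t` is differentiable at offset `0`, uniformly in `t`
(`IsNormalPiece.exists_hasSlope`). Each stencil is `o(ε)` and there are `O(1/ε)` of them.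

(2) Angles with `|β| ≤ ρ`. Let `X` be the length cut out of the line by the convex region above the
graph, and `Δ` the jump of `f` at `x₀`. The increments in `p` of `H - Δ X` are `O(ε)`
(`IsNormalPiece.exists_remainder_bound`): where two neighbouring lines lie on different sides of the
graph, the error is the variation of the smooth factors, `O(|u| + ε)`, and the first moment of the
set of such `u` is `O(ε)`. Summed up, this costs `O(ρ)`, and only `Δ X` remains. If `|β| ≥ A √ε`,
then `X` is affine up to `O(ε² / |β|³)` (`IsCurvedOn.exists_affine_approx`), and these angles
contribute `O(1 / A²)`.

(3) Angles with `|β| ≤ A √ε`. Put `β = √ε τ`. To leading order `X` is the chord of the osculating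
parabola (`IsCurvedOn.exists_chord_approx`), which scales as `√ε · chord b τ v`. What is left is a
Riemann sum in `τ` with step `κ √ε`, whose summands also depend periodically on the phase `Θ(α_k) ·
x / ε`. Consecutive phases differ by nearly `κ Θ₀^⊥ · x₀`. As this is irrational, the phases
equidistribute within short ranges of `τ` (`IsPeriodicFamily.equidistribution`), and the sum tends
to the integral over `τ` and over the phase.

Averaging over the phase turns the stencil into `∫ φ''(t) chord b τ (h - t) dt = ∫ φ'(h - b u² - τ
u) du`. Its integral over `|τ| ≤ A` is `∫ (φ(h - b u² + A u) - φ(h - b u² - A u)) / u du`. The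
substitution `u = r / A` replaces `b` by `b / A²`, so the curvature disappears as `A → ∞` and the
limit is `∫ (φ(h + r) - φ(h - r)) / r dr`, that is `-2π` times the principal value. The limit `ε →
0` is taken first, with `A` fixed; `IsSliceModel.eventually_approx` combines the ranges. -/

/-! ### Uniform Weyl equidistribution on the circle. -/

/-- A continuous function on the circle whose Birkhoff averages along the rotation by `θ`
converge uniformly to its mean. -/
def UniformlyAveraged (θ : ℝ) (f : C(UnitAddCircle, ℂ)) : Prop :=
  ∀ η > 0, ∀ᶠ N : ℕ in atTop, ∀ c : UnitAddCircle,
    ‖(∑ i ∈ Finset.range N, f (c + ((θ * i : ℝ) : UnitAddCircle))) - N * ∫ x, f x‖ ≤ η * N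

/-- A nontrivial character is multiplied by a constant `z ≠ 1` of modulus one under the rotation, so
its orbit sums are geometric and bounded by `2 / ‖z - 1‖`, whatever the starting point. -/
lemma uniformlyAveraged_fourier {θ : ℝ} (hθ : Irrational θ) (n : ℤ) :
    UniformlyAveraged θ (fourier n) := by
  intro η hη
  set z : ℂ := fourier n (θ : UnitAddCircle) with hz
  have hpow : ∀ (i : ℕ) (c : UnitAddCircle),
      fourier n (c + ((θ * i : ℝ) : UnitAddCircle)) = fourier n c * z ^ i := by
    intro i c
    rw [hz, fourier_apply, fourier_apply, fourier_apply, ← Circle.coe_pow, ← Circle.coe_mul,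
      smul_add, AddCircle.toCircle_add, ← AddCircle.toCircle_nsmul]
    congr 3
    rw [← smul_comm n i, ← AddCircle.coe_nsmul, nsmul_eq_mul, mul_comm θ]
  rcases eq_or_ne n 0 with rfl | hn
  · filter_upwards with N c
    simp [MeasureTheory.measureReal_def]
    positivity
  have hz1 : z ≠ 1 := by
    intro h
    rw [hz, fourier_coe_apply, Complex.exp_eq_one_iff] at h
    obtain ⟨m, hm⟩ := h
    have h2 : (2 * Real.pi * Complex.I : ℂ) ≠ 0 := by
      simp [Real.pi_ne_zero]
    have h3 : ((n * θ : ℝ) : ℂ) = ((m : ℝ) : ℂ) := by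
      apply mul_left_cancel₀ h2
      push_cast
      rw [mul_comm (2 * Real.pi * Complex.I : ℂ) (m : ℂ), ← hm]
      push_cast
      ring
    have h4 : (n : ℝ) * θ = m := by exact_mod_cast h3
    exact (hθ.intCast_mul hn).ne_int m h4
  -- Invariance of Haar measure under the rotation gives that the mean equals `z` times itself.
  have hint : ∫ x : UnitAddCircle, fourier n x = 0 := by
    have h1 : ∫ x : UnitAddCircle, fourier n (x + ((θ * (1 : ℕ) : ℝ) : UnitAddCircle))
        = ∫ x : UnitAddCircle, fourier n x :=
      MeasureTheory.integral_add_right_eq_self (fun x => fourier n x) _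
    simp only [hpow, pow_one] at h1
    rw [MeasureTheory.integral_mul_const] at h1
    have : (∫ x : UnitAddCircle, fourier n x) * (z - 1) = 0 := by rw [mul_sub, h1]; ring
    exact (mul_eq_zero.1 this).resolve_right (sub_ne_zero.2 hz1)
  have hzn : ‖z‖ = 1 := by rw [hz, fourier_apply]; exact Circle.norm_coe _
  have hpos : 0 < ‖z - 1‖ := norm_pos_iff.2 (sub_ne_zero.2 hz1)
  filter_upwards [eventually_ge_atTop ⌈2 / ‖z - 1‖ / η⌉₊] with N hN c
  rw [hint, mul_zero, sub_zero]
  simp only [hpow]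
  rw [← Finset.mul_sum, geom_sum_eq hz1, norm_mul, norm_div]
  have h1 : ‖(fourier n c : ℂ)‖ = 1 := by rw [fourier_apply]; exact Circle.norm_coe _
  rw [h1, one_mul]
  have h2 : ‖z ^ N - 1‖ ≤ 2 := by
    calc ‖z ^ N - 1‖ ≤ ‖z ^ N‖ + ‖(1 : ℂ)‖ := norm_sub_le _ _
      _ = 2 := by rw [norm_pow, hzn]; norm_num
  calc ‖z ^ N - 1‖ / ‖z - 1‖ ≤ 2 / ‖z - 1‖ := by gcongr
    _ = η * (2 / ‖z - 1‖ / η) := by field_simp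
    _ ≤ η * N := by
      gcongr
      exact Nat.ceil_le.1 hN

lemma integrable_circle (f : C(UnitAddCircle, ℂ)) :
    MeasureTheory.Integrable (fun x => f x) :=
  f.continuous.integrable_of_hasCompactSupport (HasCompactSupport.of_compactSpace _)

/-- The property is linear and stable under uniform limits, and trigonometric polynomials are dense.
-/
lemma uniformlyAveraged {θ : ℝ} (hθ : Irrational θ) (f : C(UnitAddCircle, ℂ)) :
    UniformlyAveraged θ f := by
  have hspan : ∀ g ∈ Submodule.span ℂ (range <| @fourier (1 : ℝ)), UniformlyAveraged θ g := by
    intro g hg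
    induction hg using Submodule.span_induction with
    | mem x hx => obtain ⟨n, rfl⟩ := hx; exact uniformlyAveraged_fourier hθ n
    | zero => intro η hη; filter_upwards with N c; simp; positivity
    | add x y _ _ hx hy =>
      intro η hη
      filter_upwards [hx (η / 2) (by positivity), hy (η / 2) (by positivity)] with N h1 h2 c
      have e : (∑ i ∈ Finset.range N, (x + y) (c + ((θ * i : ℝ) : UnitAddCircle)))
            - N * ∫ u, (x + y) u
          = ((∑ i ∈ Finset.range N, x (c + ((θ * i : ℝ) : UnitAddCircle))) - N * ∫ u, x u)
            + ((∑ i ∈ Finset.range N, y (c + ((θ * i : ℝ) : UnitAddCircle))) - N * ∫ u, y u) := by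
        simp only [ContinuousMap.add_apply, Finset.sum_add_distrib]
        rw [MeasureTheory.integral_add (integrable_circle x) (integrable_circle y)]
        ring
      rw [e]
      refine (norm_add_le _ _).trans ((add_le_add (h1 c) (h2 c)).trans (le_of_eq ?_))
      ring
    | smul a x _ hx =>
      intro η hη
      filter_upwards [hx (η / (‖a‖ + 1)) (by positivity)] with N h1 c
      have e : (∑ i ∈ Finset.range N, (a • x) (c + ((θ * i : ℝ) : UnitAddCircle)))
            - N * ∫ u, (a • x) u
          = a * ((∑ i ∈ Finset.range N, x (c + ((θ * i : ℝ) : UnitAddCircle)))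
            - N * ∫ u, x u) := by
        simp only [ContinuousMap.smul_apply, smul_eq_mul, MeasureTheory.integral_const_mul,
          ← Finset.mul_sum]
        ring
      rw [e, norm_mul]
      calc ‖a‖ * _ ≤ (‖a‖ + 1) * (η / (‖a‖ + 1) * N) := by
            gcongr
            · linarith
            · exact h1 c
        _ = η * N := by field_simp
  intro η hη
  have hf : f ∈ (Submodule.span ℂ (range <| @fourier (1 : ℝ))).topologicalClosure := by
    rw [span_fourier_closure_eq_top]; trivial
  obtain ⟨g, hg, hfg⟩ := Metric.mem_closure_iff.1 hf (η / 3) (by positivity)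
  filter_upwards [hspan g hg (η / 3) (by positivity)] with N hN c
  have hd : ∀ x, ‖f x - g x‖ ≤ η / 3 := fun x => by
    rw [← dist_eq_norm]; exact (ContinuousMap.dist_apply_le_dist x).trans hfg.le
  have e : (∑ i ∈ Finset.range N, f (c + ((θ * i : ℝ) : UnitAddCircle))) - N * ∫ u, f u
      = (∑ i ∈ Finset.range N, (f (c + ((θ * i : ℝ) : UnitAddCircle))
          - g (c + ((θ * i : ℝ) : UnitAddCircle))))
        + ((∑ i ∈ Finset.range N, g (c + ((θ * i : ℝ) : UnitAddCircle))) - N * ∫ u, g u)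
        - N * ∫ u, (f u - g u) := by
    rw [MeasureTheory.integral_sub (integrable_circle f) (integrable_circle g),
      Finset.sum_sub_distrib]
    ring
  have h1 : ‖∑ i ∈ Finset.range N, (f (c + ((θ * i : ℝ) : UnitAddCircle))
          - g (c + ((θ * i : ℝ) : UnitAddCircle)))‖ ≤ N * (η / 3) := by
    refine (norm_sum_le_of_le _ (fun i _ => hd _)).trans (le_of_eq ?_)
    rw [Finset.sum_const, Finset.card_range, nsmul_eq_mul]
  have h2 : ‖∫ u, (f u - g u)‖ ≤ η / 3 := by
    refine (MeasureTheory.norm_integral_le_of_norm_le_const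
      (Filter.Eventually.of_forall hd)).trans (le_of_eq ?_)
    rw [MeasureTheory.measureReal_def, UnitAddCircle.measure_univ, ENNReal.toReal_one, mul_one]
  rw [e]
  calc _ ≤ N * (η / 3) + η / 3 * N + N * (η / 3) := by
        refine (norm_sub_le _ _).trans (add_le_add ((norm_add_le _ _).trans
          (add_le_add h1 (hN c))) ?_)
        rw [norm_mul, Complex.norm_natCast]
        gcongr
    _ = η * N := by ring

/-- Birkhoff averages of a continuous `1`-periodic function along an irrational rotation
converge uniformly to the mean. -/
lemma periodic_average {θ : ℝ} (hθ : Irrational θ) {f : ℝ → ℝ} (hf : Continuous f)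
    (hp : Function.Periodic f 1) {η : ℝ} (hη : 0 < η) :
    ∀ᶠ N : ℕ in atTop, ∀ c : ℝ,
      |(∑ i ∈ Finset.range N, f (c + θ * i)) - N * ∫ x in (0 : ℝ)..1, f x| ≤ η * N := by
  have hp' : Function.Periodic (fun x => (f x : ℂ)) 1 := fun x => by simp [hp x]
  let F : C(UnitAddCircle, ℂ) :=
    ⟨hp'.lift, (Complex.continuous_ofReal.comp hf).quotient_liftOn' _⟩
  have hF : ∀ x : ℝ, F (x : UnitAddCircle) = f x := fun x => rfl
  filter_upwards [uniformlyAveraged hθ F η hη] with N hN c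
  have h := hN (c : UnitAddCircle)
  have hi : ∫ x, F x = ((∫ x in (0 : ℝ)..1, f x : ℝ) : ℂ) := by
    rw [← UnitAddCircle.intervalIntegral_preimage 0 (fun x => F x), zero_add,
      ← intervalIntegral.integral_ofReal]
    rfl
  rw [hi] at h
  simp only [← AddCircle.coe_add, hF] at h
  rw [← Real.norm_eq_abs, ← Complex.norm_real]
  push_cast
  exact h

/-! ### Sums over arithmetic progressions. -/

/-- Sums over the points of an arithmetic progression that lie in an interval. -/
lemma finite_progression {d : ℝ} (hd : 0 < d) (τ₀ B : ℝ) :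
    {k : ℤ | |τ₀ + d * k| ≤ B}.Finite := by
  apply (Set.finite_Icc (⌈(-B - τ₀) / d⌉) (⌊(B - τ₀) / d⌋)).subset
  intro k hk
  obtain ⟨h1, h2⟩ := abs_le.1 (show |τ₀ + d * k| ≤ B from hk)
  constructor
  · rw [Int.ceil_le, div_le_iff₀ hd]; linarith
  · rw [Int.le_floor, le_div_iff₀ hd]; linarith

lemma summable_progression {d : ℝ} (hd : 0 < d) {τ₀ B : ℝ} {a : ℤ → ℝ}
    (h0 : ∀ k : ℤ, B < |τ₀ + d * k| → a k = 0) : Summable a :=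
  summable_of_hasFiniteSupport <| (finite_progression hd τ₀ B).subset fun k hk => by
    by_contra h
    exact hk (h0 k (not_le.1 h))

/-- An interval of length `2 * B` contains at most `2 * B / d + 1` points of a progression with step
`d`. -/
lemma abs_tsum_progression_le {d : ℝ} (hd : 0 < d) {τ₀ B c : ℝ} (hB : 0 ≤ B) (hc : 0 ≤ c)
    {a : ℤ → ℝ} (h : ∀ k : ℤ, |τ₀ + d * k| ≤ B → |a k| ≤ c)
    (h0 : ∀ k : ℤ, B < |τ₀ + d * k| → a k = 0) : |∑' k, a k| ≤ c * (2 * B / d + 1) := by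
  have hs : ∀ k ∉ Finset.Icc (⌈(-B - τ₀) / d⌉) (⌊(B - τ₀) / d⌋), a k = 0 := by
    intro k hk
    apply h0
    by_contra hcon
    apply hk
    obtain ⟨h1, h2⟩ := abs_le.1 (not_lt.1 hcon)
    rw [Finset.mem_Icc]
    constructor
    · rw [Int.ceil_le, div_le_iff₀ hd]; linarith
    · rw [Int.le_floor, le_div_iff₀ hd]; linarith
  rw [tsum_eq_sum hs]
  have hall : ∀ k, |a k| ≤ c := fun k => by
    rcases le_or_gt |τ₀ + d * k| B with hk | hk
    · exact h k hk
    · rw [h0 k hk]; simpa using hc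
  refine (Finset.abs_sum_le_sum_abs _ _).trans ((Finset.sum_le_card_nsmul _ _ c
    (fun k _ => hall k)).trans ?_)
  rw [nsmul_eq_mul, mul_comm, Int.card_Icc]
  apply mul_le_mul_of_nonneg_left _ hc
  have h1 := Int.floor_le ((B - τ₀) / d)
  have h2 := Int.le_ceil ((-B - τ₀) / d)
  have h3 : (B - τ₀) / d - (-B - τ₀) / d = 2 * B / d := by ring
  rcases le_or_gt 0 (⌊(B - τ₀) / d⌋ + 1 - ⌈(-B - τ₀) / d⌉) with h4 | h4
  · have : (((⌊(B - τ₀) / d⌋ + 1 - ⌈(-B - τ₀) / d⌉).toNat : ℤ) : ℝ)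
        = ((⌊(B - τ₀) / d⌋ + 1 - ⌈(-B - τ₀) / d⌉ : ℤ) : ℝ) := by
      rw [Int.toNat_of_nonneg h4]
    push_cast at this
    rw [this]
    linarith
  · rw [Int.toNat_of_nonpos h4.le]
    push_cast
    positivity

/-! ### Joint equidistribution of a slow variable and a phase. -/

/-- A continuous function of `(τ, u)` that is `1`-periodic in `u` and vanishes for `|τ| > A`. -/
structure IsPeriodicFamily (W : ℝ → ℝ → ℝ) (A : ℝ) : Prop where
  continuous : Continuous (fun z : ℝ × ℝ => W z.1 z.2)
  periodic : ∀ τ, Function.Periodic (W τ) 1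
  support : ∀ τ u, A < |τ| → W τ u = 0
  nonneg : 0 ≤ A

namespace IsPeriodicFamily

variable {W : ℝ → ℝ → ℝ} {A : ℝ}

lemma exists_bound (hW : IsPeriodicFamily W A) : ∃ M, 0 ≤ M ∧ ∀ τ u, |W τ u| ≤ M := by
  obtain ⟨M, hM⟩ := ((isCompact_Icc (a := -A) (b := A)).prod
    (isCompact_Icc (a := (0 : ℝ)) (b := 1))).exists_bound_of_continuousOn
      hW.continuous.continuousOn
  refine ⟨max M 0, le_max_right _ _, fun τ u => ?_⟩
  rcases le_or_gt |τ| A with h | h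
  · have h1 : W τ u = W τ (Int.fract u) := by
      conv_lhs => rw [← Int.fract_add_floor u]
      simpa using (hW.periodic τ).int_mul ⌊u⌋ (Int.fract u)
    rw [h1]
    exact (hM (τ, Int.fract u) ⟨abs_le.1 h, Int.fract_nonneg u, (Int.fract_lt_one u).le⟩).trans
      (le_max_left _ _)
  · rw [hW.support τ u h]; simp

lemma uniform (hW : IsPeriodicFamily W A) {η : ℝ} (hη : 0 < η) :
    ∃ ρ, 0 < ρ ∧ ρ ≤ 1 ∧ ∀ τ τ' u u', |τ - τ'| ≤ ρ → |u - u'| ≤ ρ → |W τ u - W τ' u'| ≤ η := by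
  have hc := ((isCompact_Icc (a := -(A + 1)) (b := A + 1)).prod
    (isCompact_Icc (a := (-1 : ℝ)) (b := 2))).uniformContinuousOn_of_continuous
      hW.continuous.continuousOn
  obtain ⟨δ, hδ, h⟩ := Metric.uniformContinuousOn_iff.1 hc η hη
  refine ⟨min (δ / 2) 1, by positivity, min_le_right _ _, fun τ τ' u u' h1 h2 => ?_⟩
  have a1 := h1.trans (min_le_left _ _)
  have a2 := h1.trans (min_le_right _ _)
  have b1 := h2.trans (min_le_left _ _)
  have b2 := h2.trans (min_le_right _ _)
  by_cases ht : |τ| ≤ A + 1 ∧ |τ'| ≤ A + 1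
  -- The same integer is subtracted from both phases, so that they stay close; this puts them into
  -- `[-1, 2]`.
  · have e1 : W τ u = W τ (u - ⌊u⌋) := by
      simpa using ((hW.periodic τ).sub_int_mul_eq ⌊u⌋ (x := u)).symm
    have e2 : W τ' u' = W τ' (u' - ⌊u⌋) := by
      simpa using ((hW.periodic τ').sub_int_mul_eq ⌊u⌋ (x := u')).symm
    rw [e1, e2]
    have f1 := Int.floor_le u
    have f2 := Int.lt_floor_add_one u
    have g := abs_le.1 b2
    have := h (τ, u - ⌊u⌋) ⟨abs_le.1 ht.1, by constructor <;> dsimp only <;> linarith⟩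
      (τ', u' - ⌊u⌋) ⟨abs_le.1 ht.2, by constructor <;> dsimp only <;> linarith⟩ (by
        rw [Prod.dist_eq, Real.dist_eq, Real.dist_eq]
        apply max_lt
        · dsimp only; linarith
        · dsimp only
          rw [sub_sub_sub_cancel_right]; linarith)
    rw [Real.dist_eq] at this
    exact this.le
  -- As the two parameters differ by at most one, if one exceeds `A + 1` in modulus then both lie
  -- outside the support.
  · have hb : A < |τ| ∧ A < |τ'| := by
      have k1 := abs_sub_abs_le_abs_sub τ τ'
      have k2 := abs_sub_abs_le_abs_sub τ' τ
      rw [abs_sub_comm τ' τ] at k2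
      rw [not_and_or, not_le, not_le] at ht
      rcases ht with ht | ht <;> constructor <;> linarith
    rw [hW.support _ _ hb.1, hW.support _ _ hb.2]
    simpa using hη.le

lemma mean_continuous (hW : IsPeriodicFamily W A) :
    Continuous (fun τ => ∫ u in (0 : ℝ)..1, W τ u) :=
  intervalIntegral.continuous_parametric_intervalIntegral_of_continuous' hW.continuous 0 1

lemma mean_support (hW : IsPeriodicFamily W A) {τ : ℝ} (h : A < |τ|) :
    ∫ u in (0 : ℝ)..1, W τ u = 0 := by
  simp [hW.support τ _ h]

lemma continuous_right (hW : IsPeriodicFamily W A) (τ : ℝ) : Continuous (W τ) :=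
  hW.continuous.comp (by fun_prop : Continuous fun u : ℝ => (τ, u))

lemma mean_sub_le (hW : IsPeriodicFamily W A) {τ τ' η : ℝ}
    (h : ∀ u, |W τ u - W τ' u| ≤ η) :
    |(∫ u in (0 : ℝ)..1, W τ u) - ∫ u in (0 : ℝ)..1, W τ' u| ≤ η := by
  rw [← intervalIntegral.integral_sub ((hW.continuous_right τ).intervalIntegrable _ _)
    ((hW.continuous_right τ').intervalIntegrable _ _), ← Real.norm_eq_abs]
  refine (intervalIntegral.norm_integral_le_of_norm_le_const (C := η) fun u _ => h u).trans ?_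
  simp

/-- One block length `N` must serve all `τ`. It is found for the finitely many grid points `ρ * m`
near the support, and uniform continuity carries the estimate to the other `τ`. -/
lemma average (hW : IsPeriodicFamily W A) {θ : ℝ} (hθ : Irrational θ) {η : ℝ} (hη : 0 < η) :
    ∃ N : ℕ, 0 < N ∧ ∀ τ c : ℝ,
      |(∑ i ∈ Finset.range N, W τ (c + θ * i)) - N * ∫ u in (0 : ℝ)..1, W τ u| ≤ η * N := by
  obtain ⟨ρ, hρ, -, hu⟩ := hW.uniform (η := η / 3) (by positivity)
  have hfin := finite_progression hρ 0 (A + ρ)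
  have hev : ∀ᶠ N : ℕ in atTop, ∀ m ∈ {k : ℤ | |0 + ρ * k| ≤ A + ρ}, ∀ c : ℝ,
      |(∑ i ∈ Finset.range N, W (ρ * m) (c + θ * i)) - N * ∫ u in (0 : ℝ)..1, W (ρ * m) u|
        ≤ η / 3 * N :=
    (Filter.eventually_all_finite hfin).2 fun m _ =>
      periodic_average hθ (hW.continuous_right _) (hW.periodic _) (by positivity)
  obtain ⟨N, hN, hN0⟩ := (hev.and (eventually_gt_atTop 0)).exists
  refine ⟨N, hN0, fun τ c => ?_⟩
  rcases le_or_gt |τ| A with h | h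
  · set m : ℤ := ⌊τ / ρ⌋
    have h1 : ρ * m ≤ τ := by
      have := Int.floor_le (τ / ρ); rw [le_div_iff₀ hρ] at this; linarith
    have h2 : τ < ρ * m + ρ := by
      have := Int.lt_floor_add_one (τ / ρ)
      rw [div_lt_iff₀ hρ] at this
      linarith
    have h3 : |τ - ρ * m| ≤ ρ := abs_le.2 ⟨by linarith, by linarith⟩
    have hm := hN m (by
      have := abs_le.1 h
      rw [mem_ofPred_eq, abs_le]; constructor <;> linarith) c
    have hd : ∀ u, |W τ u - W (ρ * m) u| ≤ η / 3 := fun u => hu _ _ _ _ h3 (by simpa using hρ.le)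
    have hmean := hW.mean_sub_le hd
    have hs : |(∑ i ∈ Finset.range N, W τ (c + θ * i))
        - ∑ i ∈ Finset.range N, W (ρ * m) (c + θ * i)| ≤ η / 3 * N := by
      rw [← Finset.sum_sub_distrib]
      refine (Finset.abs_sum_le_sum_abs _ _).trans
        ((Finset.sum_le_card_nsmul _ _ _ fun i _ => hd _).trans (le_of_eq ?_))
      rw [Finset.card_range, nsmul_eq_mul, mul_comm]
    have hmean' : |N * (∫ u in (0 : ℝ)..1, W τ u) - N * ∫ u in (0 : ℝ)..1, W (ρ * m) u|
        ≤ η / 3 * N := by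
      rw [← mul_sub, abs_mul, Nat.abs_cast, mul_comm]
      gcongr
    rw [abs_le] at *
    constructor <;> linarith [hs.1, hs.2, hmean'.1, hmean'.2, hm.1, hm.2]
  · simp only [hW.support τ _ h]
    simp
    positivity

end IsPeriodicFamily

/-- Riemann sums over shifted lattices converge uniformly in the shift. -/
lemma riemann_sum_progression {f : ℝ → ℝ} (hf : Continuous f) {A : ℝ} (hA : 0 ≤ A)
    (hs : ∀ x, A < |x| → f x = 0) {η : ℝ} (hη : 0 < η) :
    ∃ ρ, 0 < ρ ∧ ∀ d, 0 < d → d < ρ → ∀ τ₀ : ℝ,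
      |d * (∑' k : ℤ, f (τ₀ + d * k)) - ∫ x, f x| ≤ η := by
  have hcs : HasCompactSupport f := HasCompactSupport.intro (isCompact_Icc (a := -A) (b := A))
    fun x hx => hs x (by
      by_contra h
      exact hx (abs_le.1 (not_lt.1 h)))
  obtain ⟨δ, hδ, h⟩ := Metric.uniformContinuous_iff.1
    (hcs.uniformContinuous_of_continuous hf) (η / (2 * A + 3)) (by positivity)
  refine ⟨min δ 1, by positivity, fun d hd hdρ τ₀ => ?_⟩
  have hd1 : d < 1 := hdρ.trans_le (min_le_right _ _)
  have hdδ : d < δ := hdρ.trans_le (min_le_left _ _)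
  have hint : MeasureTheory.Integrable f := hf.integrable_of_hasCompactSupport hcs
  -- In the variable `x` the mesh cells are the unit intervals, and the integral is unchanged; it
  -- can then be compared with the sum cell by cell.
  have hg : MeasureTheory.Integrable (fun x => d * f (τ₀ + d * x)) := by
    apply MeasureTheory.Integrable.const_mul
    exact ((hint.comp_add_left τ₀).comp_mul_left' hd.ne')
  have hgi : ∫ x, d * f (τ₀ + d * x) = ∫ x, f x := by
    rw [MeasureTheory.integral_const_mul,
      MeasureTheory.Measure.integral_comp_mul_left (fun x => f (τ₀ + x)) d,
      MeasureTheory.integral_add_left_eq_self f, abs_of_pos (inv_pos.2 hd), smul_eq_mul,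
      mul_inv_cancel_left₀ hd.ne']
  have hsum := hg.hasSum_intervalIntegral_comp_add_int
  rw [hgi] at hsum
  have hz : ∀ k : ℤ, A + 1 < |τ₀ + d * k| → f (τ₀ + d * k) = 0 := fun k hk =>
    hs _ (by linarith)
  have hsm : Summable fun k : ℤ => f (τ₀ + d * k) := summable_progression hd hz
  rw [← hsum.tsum_eq, ← tsum_mul_left, ← (hsm.mul_left d).tsum_sub hsum.summable]
  refine (abs_tsum_progression_le hd (τ₀ := τ₀) (B := A + 1) (c := d * (η / (2 * A + 3)))
    (by positivity) (by positivity) ?_ ?_).trans ?_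
  · intro k _
    have e : d * f (τ₀ + d * k) - (∫ x in (0 : ℝ)..1, d * f (τ₀ + d * (x + k)))
        = ∫ x in (0 : ℝ)..1, (d * f (τ₀ + d * k) - d * f (τ₀ + d * (x + k))) := by
      rw [intervalIntegral.integral_sub (by simp)
        (Continuous.intervalIntegrable (by fun_prop) _ _)]
      simp
    rw [e, ← Real.norm_eq_abs]
    refine (intervalIntegral.norm_integral_le_of_norm_le_const
      (C := d * (η / (2 * A + 3))) fun x hx => ?_).trans (by simp)
    rw [uIoc_of_le zero_le_one] at hx
    rw [← mul_sub, norm_mul, Real.norm_of_nonneg hd.le]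
    gcongr
    rw [← dist_eq_norm]
    refine (h ?_).le
    rw [Real.dist_eq, abs_lt]
    constructor <;> nlinarith [hx.1, hx.2]
  · intro k hk
    rw [hz k hk, mul_zero, zero_sub, neg_eq_zero]
    apply intervalIntegral.integral_zero_ae
    filter_upwards with x hx
    rw [uIoc_of_le zero_le_one] at hx
    rw [hs, mul_zero]
    have h1 : |τ₀ + d * k| ≤ |τ₀ + d * (x + k)| + |d * x| := by
      have := abs_sub (τ₀ + d * (x + k)) (d * x)
      refine le_trans (le_of_eq ?_) this
      congr 1; ring
    have h2 : |d * x| ≤ 1 := by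
      rw [abs_of_nonneg (mul_nonneg hd.le hx.1.le)]
      nlinarith [hx.1, hx.2]
    linarith
  · have : d * (η / (2 * A + 3)) * (2 * (A + 1) / d + 1) = η / (2 * A + 3) * (2 * (A + 1) + d) := by
      field_simp
    rw [this, div_mul_eq_mul_div, div_le_iff₀ (by positivity)]
    exact mul_le_mul_of_nonneg_left (by linarith) hη.le

/-- Sums of a periodic family along a sequence whose increments are almost an irrational
number. -/
lemma IsPeriodicFamily.equidistribution {W : ℝ → ℝ → ℝ} {A : ℝ} (hW : IsPeriodicFamily W A)
    {θ : ℝ} (hθ : Irrational θ) {η : ℝ} (hη : 0 < η) :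
    ∃ ρ, 0 < ρ ∧ ∀ d, 0 < d → d < ρ → ∀ (τ₀ : ℝ) (v : ℤ → ℝ),
      (∀ k : ℤ, |τ₀ + d * k| ≤ A + 1 → |v (k + 1) - v k - θ| ≤ ρ) →
      |d * (∑' k : ℤ, W (τ₀ + d * k) (v k)) - ∫ τ, ∫ u in (0 : ℝ)..1, W τ u| ≤ η := by
  have hA := hW.nonneg
  set η₁ : ℝ := η / (4 * (2 * A + 3)) with hη₁
  have hη₁0 : 0 < η₁ := by positivity
  obtain ⟨ρ₁, hρ₁, -, hu⟩ := hW.uniform hη₁0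
  obtain ⟨N, hN0, hN⟩ := hW.average hθ hη₁0
  obtain ⟨ρ₂, hρ₂, hR⟩ := riemann_sum_progression hW.mean_continuous hA
    (fun τ h => hW.mean_support h) (η := η / 2) (by positivity)
  have hNpos : (0 : ℝ) < N := by exact_mod_cast hN0
  -- Along a block of `N` terms `τ` moves by at most `d * N`, and the phase drifts from an exact
  -- rotation by at most `ρ * N`. Both must be below the modulus `ρ₁`. The last entry keeps `d * N ≤
  -- 1 / 2`, so that blocks starting in `|τ| ≤ A + 1 / 2` stay where `hv` controls the increments.
  refine ⟨min (min (ρ₁ / N) ρ₂) (1 / (2 * N)), by positivity, fun d hd hdρ τ₀ v hv => ?_⟩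
  have hd1 : d * N ≤ ρ₁ := by
    have : d ≤ ρ₁ / N := hdρ.le.trans ((min_le_left _ _).trans (min_le_left _ _))
    rwa [le_div_iff₀ hNpos] at this
  have hd2 : d < ρ₂ := hdρ.trans_le ((min_le_left _ _).trans (min_le_right _ _))
  have hd3 : d * N ≤ 1 / 2 := by
    have : d ≤ 1 / (2 * N) := hdρ.le.trans (min_le_right _ _)
    rw [le_div_iff₀ (by positivity)] at this
    linarith
  have hd4 : d ≤ 1 := by
    have : (1 : ℝ) ≤ N := by exact_mod_cast hN0
    nlinarith
  set ρ := min (min (ρ₁ / N) ρ₂) (1 / (2 * N))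
  have hρN : ρ * N ≤ ρ₁ := by
    have : ρ ≤ ρ₁ / N := (min_le_left _ _).trans (min_le_left _ _)
    rwa [le_div_iff₀ hNpos] at this
  have hρ0 : 0 < ρ := by positivity
  let a : ℤ → ℝ := fun k => W (τ₀ + d * k) (v k)
  have ha : Summable a := summable_progression hd fun k hk => hW.support _ _ hk
  have hash : ∀ i : ℕ, Summable fun k : ℤ => a (k + i) := fun i =>
    (Equiv.addRight (i : ℤ)).summable_iff.2 ha
  have hshift : ∀ i : ℕ, ∑' k : ℤ, a (k + i) = ∑' k, a k := fun i =>
    (Equiv.addRight (i : ℤ)).tsum_eq a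
  -- Each term lies in `N` of the blocks of length `N`, one block starting at every `k`.
  have hNsum : N * ∑' k, a k = ∑' k : ℤ, ∑ i ∈ Finset.range N, a (k + i) := by
    rw [Summable.tsum_finsetSum fun i _ => hash i]
    simp [hshift]
  have hM : Summable fun k : ℤ => ∫ u in (0 : ℝ)..1, W (τ₀ + d * k) u :=
    summable_progression hd fun k hk => hW.mean_support hk
  have hτ : ∀ (k : ℤ) (i : ℕ), i < N → |(τ₀ + d * (k + i : ℤ)) - (τ₀ + d * k)| ≤ d * N := by
    intro k i hi
    have : (i : ℝ) ≤ N := by exact_mod_cast hi.le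
    push_cast
    rw [show τ₀ + d * (k + i) - (τ₀ + d * k) = d * i by ring, abs_of_nonneg (by positivity)]
    gcongr
  have hvi : ∀ k : ℤ, |τ₀ + d * k| ≤ A + 1 / 2 → ∀ i : ℕ, i < N →
      |v (k + i) - (v k + θ * i)| ≤ ρ * i := by
    intro k hk i
    induction i with
    | zero => intro _; simp
    | succ i ih =>
      intro hi
      have h1 := ih (by omega)
      have h2 := hv (k + i) (by
        have k1 := abs_sub_abs_le_abs_sub (τ₀ + d * (k + i : ℤ)) (τ₀ + d * k)
        linarith [hτ k i (by omega)])
      push_cast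
      rw [← add_assoc]
      rw [abs_le] at *
      constructor <;> linarith [h1.1, h1.2, h2.1, h2.2]
  have hb : |∑' k : ℤ, ((∑ i ∈ Finset.range N, a (k + i))
      - N * ∫ u in (0 : ℝ)..1, W (τ₀ + d * k) u)| ≤ 2 * η₁ * N * (2 * (A + 1 / 2) / d + 1) := by
    apply abs_tsum_progression_le hd (τ₀ := τ₀) (by positivity) (by positivity)
    · intro k hk
      have h1 : |(∑ i ∈ Finset.range N, a (k + i))
          - ∑ i ∈ Finset.range N, W (τ₀ + d * k) (v k + θ * i)| ≤ η₁ * N := by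
        rw [← Finset.sum_sub_distrib]
        refine (Finset.abs_sum_le_sum_abs _ _).trans
          ((Finset.sum_le_card_nsmul _ _ η₁ fun i hi => ?_).trans (le_of_eq ?_))
        · rw [Finset.mem_range] at hi
          refine hu _ _ _ _ ((hτ k i hi).trans hd1) ((hvi k hk i hi).trans ?_)
          have : (i : ℝ) ≤ N := by exact_mod_cast hi.le
          exact (mul_le_mul_of_nonneg_left this hρ0.le).trans hρN
        · rw [Finset.card_range, nsmul_eq_mul, mul_comm]
      have h2 := hN (τ₀ + d * k) (v k)
      rw [abs_le] at *
      constructor <;> linarith [h1.1, h1.2, h2.1, h2.2]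
    · intro k hk
      rw [hW.mean_support (by linarith), mul_zero, sub_zero]
      apply Finset.sum_eq_zero
      intro i hi
      rw [Finset.mem_range] at hi
      apply hW.support
      have k1 := abs_sub_abs_le_abs_sub (τ₀ + d * k) (τ₀ + d * (k + i : ℤ))
      rw [abs_sub_comm] at k1
      linarith [hτ k i hi]
  rw [Summable.tsum_sub (summable_sum fun i _ => hash i) (hM.mul_left _), ← hNsum,
    tsum_mul_left, ← mul_sub, abs_mul, abs_of_pos hNpos, mul_comm (2 * η₁) (N : ℝ), mul_assoc] at hb
  have hb' := le_of_mul_le_mul_left hb hNpos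
  have hb2 : |d * (∑' k, a k) - d * ∑' k : ℤ, ∫ u in (0 : ℝ)..1, W (τ₀ + d * k) u| ≤ η / 2 := by
    rw [← mul_sub, abs_mul, abs_of_pos hd]
    calc _ ≤ d * (2 * η₁ * (2 * (A + 1 / 2) / d + 1)) := by gcongr
      _ = 2 * η₁ * (2 * A + 1 + d) := by field_simp
      _ ≤ 2 * η₁ * (2 * A + 3) := mul_le_mul_of_nonneg_left (by linarith) (by positivity)
      _ = η / 2 := by rw [hη₁]; field_simp; norm_num
  have hR' := hR d hd hd2 τ₀
  change |d * (∑' k, a k) - _| ≤ η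
  rw [abs_le] at *
  constructor <;> linarith [hb2.1, hb2.2, hR'.1, hR'.2]

/-- A tail bound for sums of inverse cubes along an arithmetic progression. -/
lemma abs_tsum_inv_cube_le {d X c : ℝ} (hd : 0 < d) (hX : d ≤ X) (hc : 0 ≤ c) {τ₀ B : ℝ}
    {a : ℤ → ℝ} (h : ∀ k : ℤ, X ≤ |τ₀ + d * k| → |a k| ≤ c / |τ₀ + d * k| ^ 3)
    (h0 : ∀ k : ℤ, |τ₀ + d * k| < X → a k = 0) (hB : ∀ k : ℤ, B < |τ₀ + d * k| → a k = 0) :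
    |∑' k, a k| ≤ 5 * Real.pi * c / (d * X ^ 2) := by
  have hX0 : 0 < X := hd.trans_le hX
  -- Each term is dominated by a multiple of an increment of `arctan (x / X)`; the increments
  -- telescope, and their total is at most `π`.
  have hstep : ∀ k : ℤ, |a k| ≤ 5 * c / (d * X ^ 2) *
      (Real.arctan ((τ₀ + d * (k + 1 : ℤ)) / X) - Real.arctan ((τ₀ + d * k) / X)) := by
    intro k
    have hmono : 0 ≤ Real.arctan ((τ₀ + d * (k + 1 : ℤ)) / X)
        - Real.arctan ((τ₀ + d * k) / X) := by
      rw [sub_nonneg]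
      apply Real.arctan_strictMono.monotone
      gcongr
      linarith
    rcases lt_or_ge |τ₀ + d * k| X with hk | hk
    · rw [h0 k hk, abs_zero]
      positivity
    · set x := τ₀ + d * k with hx
      have hxpos : 0 < |x| := hX0.trans_le hk
      have hx1 : τ₀ + d * (k + 1 : ℤ) = x + d := by push_cast; rw [hx]; ring
      rw [hx1]
      have hlt : x / X < (x + d) / X := by gcongr; linarith
      obtain ⟨z, hz, hz'⟩ := exists_deriv_eq_slope Real.arctan hlt
        Real.continuous_arctan.continuousOn Real.differentiable_arctan.differentiableOn
      rw [Real.deriv_arctan, eq_div_iff (by linarith)] at hz'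
      rw [← hz']
      -- Since `d ≤ X ≤ |x|`, the next point of the progression has modulus at most `2 * |x|`.
      have hzb : z ^ 2 ≤ 4 * |x| ^ 2 / X ^ 2 := by
        have hz1 : |z| ≤ 2 * |x| / X := by
          rw [le_div_iff₀ hX0, ← abs_of_pos hX0, ← abs_mul]
          have b1 := hz.1
          have b2 := hz.2
          rw [div_lt_iff₀ hX0] at b1
          rw [lt_div_iff₀ hX0] at b2
          rw [abs_le]
          have := neg_abs_le x
          have := le_abs_self x
          constructor <;> linarith
        calc z ^ 2 = |z| ^ 2 := (sq_abs z).symm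
          _ ≤ (2 * |x| / X) ^ 2 := by gcongr
          _ = _ := by ring
      have hz5 : 1 + z ^ 2 ≤ 5 * |x| ^ 2 / X ^ 2 := by
        have : 1 ≤ |x| ^ 2 / X ^ 2 := by
          rw [one_le_div (by positivity)]; gcongr
        calc 1 + z ^ 2 ≤ |x| ^ 2 / X ^ 2 + 4 * |x| ^ 2 / X ^ 2 := by linarith
          _ = _ := by ring
      have hinv : X ^ 2 / (5 * |x| ^ 2) ≤ 1 / (1 + z ^ 2) := by
        rw [div_le_div_iff₀ (by positivity) (by positivity)]
        rw [le_div_iff₀ (by positivity)] at hz5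
        linarith
      calc |a k| ≤ c / |x| ^ 3 := h k hk
        _ ≤ c / (|x| ^ 2 * X) := by
            gcongr
            nlinarith [sq_nonneg |x|]
        _ = 5 * c / (d * X ^ 2) * (X ^ 2 / (5 * |x| ^ 2) * ((x + d) / X - x / X)) := by
            field_simp; ring
        _ ≤ _ := by
            gcongr
  have hbound : ∀ (m : ℤ) (n : ℕ), ∑ i ∈ Finset.range n, |a (m + i)| ≤
      5 * c / (d * X ^ 2) * (Real.arctan ((τ₀ + d * (m + n : ℤ)) / X)
        - Real.arctan ((τ₀ + d * m) / X)) := by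
    intro m n
    induction n with
    | zero => simp
    | succ n ih =>
      rw [Finset.sum_range_succ]
      have := hstep (m + n)
      rw [show (m + (n + 1 : ℕ) : ℤ) = m + n + 1 by push_cast; ring]
      linarith
  set m : ℤ := ⌈(-B - τ₀) / d⌉
  set M : ℤ := ⌊(B - τ₀) / d⌋
  have hs : ∀ k ∉ (Finset.range (M + 1 - m).toNat).image (fun i : ℕ => m + (i : ℤ)), a k = 0 := by
    intro k hk
    apply hB
    by_contra hcon
    apply hk
    obtain ⟨h1, h2⟩ := abs_le.1 (not_lt.1 hcon)
    have h3 : m ≤ k := by rw [Int.ceil_le, div_le_iff₀ hd]; linarith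
    have h4 : k ≤ M := by rw [Int.le_floor, le_div_iff₀ hd]; linarith
    rw [Finset.mem_image]
    exact ⟨(k - m).toNat, by rw [Finset.mem_range]; omega, by omega⟩
  rw [tsum_eq_sum hs, Finset.sum_image (fun i _ j _ hij => by simpa using hij)]
  refine (Finset.abs_sum_le_sum_abs _ _).trans ((hbound m _).trans ?_)
  have h1 := Real.arctan_lt_pi_div_two ((τ₀ + d * (m + (M + 1 - m).toNat : ℤ)) / X)
  have h2 := Real.neg_pi_div_two_lt_arctan ((τ₀ + d * m) / X)
  calc _ ≤ 5 * c / (d * X ^ 2) * Real.pi := by gcongr; linarith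
    _ = _ := by ring

lemma integrable_of_bounded_of_support {X : Type*} [MeasurableSpace X] {μ : Measure X}
    {f : X → ℝ} (hf : Measurable f) {M : ℝ} (hM : ∀ x, |f x| ≤ M) {K : Set X} (hK : μ K < ⊤)
    (h0 : ∀ x, x ∉ K → f x = 0) : Integrable f μ := by
  have h1 : IntegrableOn f K μ := Measure.integrableOn_of_bounded hK.ne hf.aestronglyMeasurable
    (M := M) (Eventually.of_forall fun x => hM x)
  refine (integrableOn_iff_integrable_of_support_subset fun x hx => ?_).1 h1
  by_contra h
  exact hx (h0 x h)

/-! ### Chords of a parabola. -/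

/-- The length of the chord `{u | b u ^ 2 + τ u < v}`. -/
noncomputable def chord (b τ v : ℝ) : ℝ := √(τ ^ 2 + 4 * b * v) / b

lemma continuous_chord (b : ℝ) : Continuous (fun z : ℝ × ℝ => chord b z.1 z.2) := by
  unfold chord; fun_prop

lemma chord_nonneg {b : ℝ} (hb : 0 < b) (τ v : ℝ) : 0 ≤ chord b τ v := by
  unfold chord; positivity

/-- Complete the square. For a negative discriminant the real square root is `0` and the interval is
empty, so no case distinction is needed. -/
lemma setOf_quadratic_lt {b : ℝ} (hb : 0 < b) (τ v : ℝ) :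
    {u : ℝ | b * u ^ 2 + τ * u < v} =
      Ioo (-τ / (2 * b) - chord b τ v / 2) (-τ / (2 * b) + chord b τ v / 2) := by
  ext u
  have e : b * u ^ 2 + τ * u < v ↔ (2 * b * u + τ) ^ 2 < τ ^ 2 + 4 * b * v := by
    constructor <;> intro h <;> nlinarith
  rw [mem_ofPred_eq, e, ← abs_of_nonneg (sq_nonneg (2 * b * u + τ)), abs_pow,
    ← Real.lt_sqrt (abs_nonneg _), abs_lt, mem_Ioo, chord]
  set s := √(τ ^ 2 + 4 * b * v)
  have e1 : -τ / (2 * b) - s / b / 2 = (-τ - s) / (2 * b) := by field_simp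
  have e2 : -τ / (2 * b) + s / b / 2 = (-τ + s) / (2 * b) := by field_simp
  rw [e1, e2, div_lt_iff₀ (by positivity), lt_div_iff₀ (by positivity)]
  constructor <;> rintro ⟨h1, h2⟩ <;> constructor <;> linarith

lemma volume_quadratic_lt {b : ℝ} (hb : 0 < b) (τ v : ℝ) :
    volume.real {u : ℝ | b * u ^ 2 + τ * u < v} = chord b τ v := by
  rw [setOf_quadratic_lt hb, Real.volume_real_Ioo_of_le]
  · ring
  · have := chord_nonneg hb τ v
    linarith

lemma integral_indicator_quadratic_lt {b : ℝ} (hb : 0 < b) (τ v : ℝ) :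
    ∫ u : ℝ, (if b * u ^ 2 + τ * u < v then 1 else 0 : ℝ) = chord b τ v := by
  rw [← volume_quadratic_lt hb, ← integral_indicator_one]
  · rfl
  · exact measurableSet_lt (by fun_prop) (by fun_prop)

/-! ### Elementary properties of the interpolation kernel. -/

namespace IsInterpolationKernel

variable {φ : ℝ → ℝ}

lemma contDiff_deriv (hφ : IsInterpolationKernel φ) : ContDiff ℝ 1 (deriv φ) :=
  (contDiff_succ_iff_deriv.1 (show ContDiff ℝ (1 + 1) φ by
    simpa [one_add_one_eq_two] using hφ.contDiff)).2.2

lemma continuous_deriv_deriv (hφ : IsInterpolationKernel φ) : Continuous (deriv (deriv φ)) :=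
  hφ.contDiff_deriv.continuous_deriv le_rfl

lemma differentiable (hφ : IsInterpolationKernel φ) : Differentiable ℝ φ :=
  hφ.contDiff.differentiable (by norm_num)

lemma differentiable_deriv (hφ : IsInterpolationKernel φ) : Differentiable ℝ (deriv φ) :=
  hφ.contDiff_deriv.differentiable (by norm_num)

/-- A common radius of support of `φ` and its derivatives. -/
lemma exists_radius (hφ : IsInterpolationKernel φ) : ∃ R, 0 < R ∧ (∀ x, R < |x| → φ x = 0) ∧
    (∀ x, R < |x| → deriv φ x = 0) ∧ ∀ x, R < |x| → deriv (deriv φ) x = 0 := by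
  obtain ⟨R, hR⟩ := hφ.compactSupport.isCompact.isBounded.subset_closedBall 0
  have key : ∀ x, max R 1 < |x| → x ∉ tsupport φ := fun x hx h => by
    have := hR h
    rw [mem_closedBall_zero_iff, Real.norm_eq_abs] at this
    linarith [le_max_left R 1]
  have h1 : tsupport (deriv φ) ⊆ tsupport φ := closure_minimal support_deriv_subset
    (isClosed_tsupport _)
  have h2 : tsupport (deriv (deriv φ)) ⊆ tsupport (deriv φ) := closure_minimal
    support_deriv_subset (isClosed_tsupport _)
  exact ⟨max R 1, by positivity, fun x hx => image_eq_zero_of_notMem_tsupport (key x hx),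
    fun x hx => image_eq_zero_of_notMem_tsupport fun h => key x hx (h1 h),
    fun x hx => image_eq_zero_of_notMem_tsupport fun h => key x hx (h1 (h2 h))⟩

lemma exists_bound (hφ : IsInterpolationKernel φ) : ∃ M, 0 < M ∧ (∀ x, |φ x| ≤ M) ∧
    (∀ x, |deriv φ x| ≤ M) ∧ ∀ x, |deriv (deriv φ) x| ≤ M := by
  obtain ⟨M0, h0⟩ := hφ.compactSupport.exists_bound_of_continuous hφ.contDiff.continuous
  obtain ⟨M1, h1⟩ := hφ.compactSupport.deriv.exists_bound_of_continuous
    hφ.contDiff_deriv.continuous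
  obtain ⟨M2, h2⟩ := hφ.compactSupport.deriv.deriv.exists_bound_of_continuous
    hφ.continuous_deriv_deriv
  refine ⟨max (max M0 M1) (max M2 1), by positivity, fun x => (h0 x).trans ?_,
    fun x => (h1 x).trans ?_, fun x => (h2 x).trans ?_⟩ <;> simp

lemma integral_Iio_deriv_deriv (hφ : IsInterpolationKernel φ) (x : ℝ) :
    ∫ t : ℝ, (if t < x then deriv (deriv φ) t else 0) = deriv φ x := by
  have h := HasCompactSupport.integral_Iic_deriv_eq hφ.contDiff_deriv hφ.compactSupport.deriv x
  rw [← h, integral_Iic_eq_integral_Iio, ← integral_indicator measurableSet_Iio]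
  rfl

lemma integral_deriv_deriv (hφ : IsInterpolationKernel φ) : ∫ t : ℝ, deriv (deriv φ) t = 0 := by
  obtain ⟨R, hR, -, h1, h2⟩ := hφ.exists_radius
  have h := hφ.integral_Iio_deriv_deriv (R + 1)
  rw [h1 _ (by rw [abs_of_pos (by linarith)]; linarith)] at h
  rw [← h]
  congr 1
  ext t
  split_ifs with ht
  · rfl
  · exact h2 t (by rw [abs_of_pos] <;> linarith)

end IsInterpolationKernel

/-! ### The limiting angular profile, its integral, and the principal value. -/

/-- The limiting contribution of the scaled angle `τ`. -/
noncomputable def angleProfile (φ : ℝ → ℝ) (b h τ : ℝ) : ℝ :=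
  ∫ t : ℝ, deriv (deriv φ) t * chord b τ (h - t)

section Profile

variable {φ : ℝ → ℝ} (hφ : IsInterpolationKernel φ) {b : ℝ} (hb : 0 < b) (h : ℝ)
include hφ hb

omit hb in
lemma continuous_angleProfile : Continuous (angleProfile φ b h) := by
  obtain ⟨R, hR, -, -, h2⟩ := hφ.exists_radius
  have e : angleProfile φ b h = fun τ => ∫ t in (-R)..R, deriv (deriv φ) t * chord b τ (h - t) := by
    ext τ
    rw [angleProfile, intervalIntegral.integral_of_le (by linarith),
      ← integral_Icc_eq_integral_Ioc, ← setIntegral_eq_integral_of_forall_compl_eq_zero]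
    intro t ht
    rw [h2, zero_mul]
    by_contra hc
    exact ht (abs_le.1 (not_lt.1 hc))
  rw [e]
  have hc := hφ.continuous_deriv_deriv
  have hch := continuous_chord b
  apply intervalIntegral.continuous_parametric_intervalIntegral_of_continuous'
  exact (hc.comp continuous_snd).mul
    (hch.comp (by fun_prop : Continuous fun z : ℝ × ℝ => (z.1, h - z.2)))

/-- Since `φ''` has mean zero, the value of the chord at `t = 0` can be subtracted. For large `|τ|`
the radicand is at least of order `τ²`, so the difference of the square roots is of order `|t| /
|τ|`. The decay allows a sharp cut-off in `τ` to be replaced by a continuous one. -/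
lemma abs_angleProfile_le : ∃ C τ₁ : ℝ, 0 < C ∧ 0 < τ₁ ∧ ∀ τ, τ₁ ≤ |τ| →
    |angleProfile φ b h τ| ≤ C / |τ| := by
  obtain ⟨R, hR, -, -, h2⟩ := hφ.exists_radius
  obtain ⟨M, hM, -, -, hM2⟩ := hφ.exists_bound
  -- Beyond this threshold `4 * b * |h|` is at most `τ ^ 2 / 2`, so `h` does not spoil the lower
  -- bound for the radicand.
  refine ⟨M * (8 * R) * (2 * R), √(8 * b * |h|) + 1, by positivity, by positivity,
    fun τ hτ => ?_⟩
  have hτ0 : 0 < |τ| := lt_of_lt_of_le (by positivity) hτ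
  have hτ2 : 8 * b * |h| ≤ |τ| ^ 2 := by
    have h1 : √(8 * b * |h|) ≤ |τ| := by linarith
    exact (Real.sqrt_le_left hτ0.le).1 h1
  have hY : (|τ| / 2) ^ 2 ≤ τ ^ 2 + 4 * b * h := by
    have := neg_abs_le h
    rw [← sq_abs τ]
    nlinarith
  have hc := hφ.continuous_deriv_deriv
  have hch := continuous_chord b
  have hint : Integrable (fun t => deriv (deriv φ) t * chord b τ (h - t)) := by
    apply Continuous.integrable_of_hasCompactSupport
    · exact hc.mul (hch.comp (by fun_prop : Continuous fun t : ℝ => (τ, h - t)))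
    · exact hφ.compactSupport.deriv.deriv.mul_right
  have hint2 : Integrable (fun t => deriv (deriv φ) t * chord b τ h) :=
    (hc.integrable_of_hasCompactSupport hφ.compactSupport.deriv.deriv).mul_const _
  have e : angleProfile φ b h τ =
      ∫ t in Icc (-R) R, deriv (deriv φ) t * (chord b τ (h - t) - chord b τ h) := by
    rw [setIntegral_eq_integral_of_forall_compl_eq_zero]
    · simp only [mul_sub]
      rw [integral_sub hint hint2, integral_mul_const, hφ.integral_deriv_deriv, zero_mul, sub_zero,
        angleProfile]
    · intro t ht
      rw [h2, zero_mul]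
      by_contra hc
      exact ht (abs_le.1 (not_lt.1 hc))
  rw [e, ← Real.norm_eq_abs]
  have hbound : ∀ t ∈ Icc (-R) R,
      ‖deriv (deriv φ) t * (chord b τ (h - t) - chord b τ h)‖ ≤ M * (8 * R) / |τ| := by
    intro t ht
    rw [norm_mul, mul_div_assoc]
    refine mul_le_mul (hM2 t) ?_ (norm_nonneg _) hM.le
    rw [Real.norm_eq_abs, chord, chord, ← sub_div, abs_div, abs_of_pos hb]
    set X := τ ^ 2 + 4 * b * (h - t)
    set Y := τ ^ 2 + 4 * b * h
    have hsY : |τ| / 2 ≤ √Y := Real.le_sqrt_of_sq_le hY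
    have hY0 : 0 ≤ Y := le_trans (by positivity) hY
    have hXY : |√X - √Y| * √Y ≤ 4 * b * R := by
      have h1 : |X - Y| ≤ 4 * b * R := by
        rw [show X - Y = -(4 * b * t) by ring, abs_neg, abs_mul, abs_of_pos (by positivity)]
        have := abs_le.2 ht
        gcongr
      refine le_trans ?_ h1
      rcases le_or_gt 0 X with hX | hX
      · have h3 : X - Y = (√X - √Y) * (√X + √Y) := by
          ring_nf; rw [Real.sq_sqrt hX, Real.sq_sqrt hY0]
        rw [h3, abs_mul]
        gcongr
        rw [abs_of_nonneg (by positivity)]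
        linarith [Real.sqrt_nonneg X]
      · rw [Real.sqrt_eq_zero_of_nonpos hX.le, zero_sub, abs_neg, abs_of_nonneg (by positivity),
          Real.mul_self_sqrt hY0, abs_sub_comm, abs_of_nonneg] <;> linarith
    rw [div_le_div_iff₀ hb hτ0]
    have := mul_le_mul_of_nonneg_left hsY (abs_nonneg (√X - √Y))
    linarith
  refine (norm_setIntegral_le_of_norm_le_const (by simp) hbound).trans ?_
  rw [Real.volume_real_Icc_of_le (by linarith)]
  apply le_of_eq
  ring

/-- Write the chord as the integral of an indicator and exchange the integrals: for fixed `u`, the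
integral of `φ''` over the half line `t < h - b u² - τ u` is a value of `φ'`. -/
lemma angleProfile_eq (τ : ℝ) :
    angleProfile φ b h τ = ∫ u : ℝ, deriv φ (h - b * u ^ 2 - τ * u) := by
  obtain ⟨R, hR, -, -, h2⟩ := hφ.exists_radius
  obtain ⟨M, hM, -, -, hM2⟩ := hφ.exists_bound
  have hc := hφ.continuous_deriv_deriv
  have e1 : ∀ t, deriv (deriv φ) t * chord b τ (h - t) =
      ∫ u : ℝ, (if b * u ^ 2 + τ * u < h - t then deriv (deriv φ) t else 0) := by
    intro t
    rw [← integral_indicator_quadratic_lt hb, ← integral_const_mul]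
    congr 1
    ext u
    split_ifs <;> simp
  rw [angleProfile]
  simp_rw [e1]
  rw [integral_integral_swap]
  · congr 1
    ext u
    rw [← hφ.integral_Iio_deriv_deriv]
    congr 1
    ext t
    congr 1
    apply propext
    constructor <;> intro h <;> linarith
  -- For `|u| > U` the quadratic term outweighs `τ * u`, `h` and the support radius, so the double
  -- integrand has bounded support.
  · set U := max 1 ((R + |h| + |τ|) / b)
    refine integrable_of_bounded_of_support (M := M) (K := Icc (-R) R ×ˢ Icc (-U) U) ?_ ?_ ?_ ?_
    · refine Measurable.ite ?_ (hc.measurable.comp measurable_fst) measurable_const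
      exact measurableSet_lt (by fun_prop) (by fun_prop)
    · rintro ⟨t, u⟩
      dsimp only [Function.uncurry]
      split_ifs
      · exact hM2 t
      · simpa using hM.le
    · exact (isCompact_Icc.prod isCompact_Icc).measure_lt_top
    · rintro ⟨t, u⟩ hz
      dsimp only [Function.uncurry]
      split_ifs with hlt
      · apply h2
        by_contra hcon
        apply hz
        have hR' := abs_le.1 (not_lt.1 hcon)
        refine ⟨hR', abs_le.1 ?_⟩
        by_contra hU
        rw [not_le] at hU
        have hU1 : 1 < |u| := (le_max_left _ _).trans_lt hU
        have hU2 : (R + |h| + |τ|) / b < |u| := (le_max_right _ _).trans_lt hU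
        rw [div_lt_iff₀ hb] at hU2
        have k1 : -(|τ| * |u|) ≤ τ * u := by rw [← abs_mul]; exact neg_abs_le _
        have k2 := le_abs_self h
        have k3 : u ^ 2 = |u| * |u| := by rw [← sq, sq_abs]
        have k4 : (R + |h| + |τ|) * |u| < (|u| * b) * |u| := by gcongr
        have k5 : R + |h| ≤ (R + |h|) * |u| := by
          have : 0 ≤ R + |h| := by positivity
          nlinarith
        have k6 : b * u ^ 2 = |u| * b * |u| := by rw [k3]; ring
        nlinarith [hR'.1]
      · rfl

/-- With `u ≠ 0` fixed, `φ'(h - b u² - τ u)` is the `τ`-derivative of `-φ(h - b u² - τ u) / u`, so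
after exchanging the integrals the one over `τ` is explicit. -/
lemma integral_angleProfile {A : ℝ} (hA : 0 < A) :
    ∫ τ in (-A)..A, angleProfile φ b h τ =
      ∫ u : ℝ, (φ (h - b * u ^ 2 + A * u) - φ (h - b * u ^ 2 - A * u)) / u := by
  obtain ⟨R, hR, -, h1, -⟩ := hφ.exists_radius
  obtain ⟨M, hM, -, hM1, -⟩ := hφ.exists_bound
  have hc := hφ.contDiff_deriv.continuous
  set G : ℝ → ℝ → ℝ := fun τ u => if τ ∈ Ioc (-A) A then deriv φ (h - b * u ^ 2 - τ * u) else 0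
  have e1 : ∫ τ in (-A)..A, angleProfile φ b h τ = ∫ τ, ∫ u, G τ u := by
    rw [intervalIntegral.integral_of_le (by linarith), ← integral_indicator measurableSet_Ioc]
    congr 1
    ext τ
    rw [indicator_apply]
    split_ifs with hτ
    · rw [angleProfile_eq hφ hb]
      exact integral_congr_ae (Eventually.of_forall fun u => (if_pos hτ).symm)
    · simp only [G, hτ, if_false, integral_zero]
  rw [e1, integral_integral_swap]
  · apply integral_congr_ae
    have : ∀ᵐ u : ℝ, u ≠ 0 := by
      rw [ae_iff]; simp
    filter_upwards [this] with u hu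
    have e2 : ∫ τ, G τ u = ∫ τ in (-A)..A, deriv φ (h - b * u ^ 2 - τ * u) := by
      rw [intervalIntegral.integral_of_le (by linarith), ← integral_indicator measurableSet_Ioc]
      simp only [G, indicator_apply]
    rw [e2, intervalIntegral.integral_eq_sub_of_hasDerivAt
      (f := fun τ => -φ (h - b * u ^ 2 - τ * u) / u)]
    · rw [neg_mul, sub_neg_eq_add]
      ring
    · intro τ _
      have k1 : HasDerivAt (fun τ : ℝ => h - b * u ^ 2 - τ * u) (-u) τ := by
        simpa using ((hasDerivAt_id τ).mul_const u).const_sub (h - b * u ^ 2)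
      have k2 := ((hφ.differentiable (h - b * u ^ 2 - τ * u)).hasDerivAt.comp τ k1).neg.div_const u
      exact k2.congr_deriv (by rw [mul_neg, neg_neg, mul_div_cancel_right₀ _ hu])
    · apply Continuous.intervalIntegrable
      fun_prop
  · set U := max 1 ((R + |h| + A) / b)
    refine integrable_of_bounded_of_support (M := M) (K := Icc (-A) A ×ˢ Icc (-U) U) ?_ ?_ ?_ ?_
    · refine Measurable.ite ?_ (hc.measurable.comp (by fun_prop)) measurable_const
      exact measurable_fst measurableSet_Ioc
    · rintro ⟨t, u⟩
      dsimp only [Function.uncurry, G]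
      split_ifs
      · exact hM1 _
      · simpa using hM.le
    · exact (isCompact_Icc.prod isCompact_Icc).measure_lt_top
    · rintro ⟨τ, u⟩ hz
      dsimp only [Function.uncurry, G]
      split_ifs with hlt
      · apply h1
        by_contra hcon
        apply hz
        have hR' := abs_le.1 (not_lt.1 hcon)
        refine ⟨⟨hlt.1.le, hlt.2⟩, abs_le.1 ?_⟩
        by_contra hU
        rw [not_le] at hU
        have hU1 : 1 < |u| := (le_max_left _ _).trans_lt hU
        have hU2 : (R + |h| + A) / b < |u| := (le_max_right _ _).trans_lt hU
        rw [div_lt_iff₀ hb] at hU2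
        have hτ : |τ| ≤ A := abs_le.2 ⟨hlt.1.le, hlt.2⟩
        have k1 : -(A * |u|) ≤ τ * u := by
          have : |τ| * |u| ≤ A * |u| := by gcongr
          have := neg_abs_le (τ * u)
          rw [abs_mul] at this
          linarith
        have k2 := le_abs_self h
        have k3 : u ^ 2 = |u| * |u| := by rw [← sq, sq_abs]
        have k4 : (R + |h| + A) * |u| < (|u| * b) * |u| := by gcongr
        have k5 : R + |h| ≤ (R + |h|) * |u| := by
          have : 0 ≤ R + |h| := by positivity
          nlinarith
        have k6 : b * u ^ 2 = |u| * b * |u| := by rw [k3]; ring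
        nlinarith [hR'.1]
      · rfl

-- The integrand lives where `r` is bounded, and also near the second zeros `r = ± 1 / e` of `e r² ∓
-- r`. The first part converges by domination. The second is supported in two intervals of fixed
-- length, on which dividing by `r` makes the integrand `O(e)`.
omit hb in
lemma tendsto_integral_symmetric_quotient :
    Tendsto (fun e : ℝ => ∫ r : ℝ, (φ (h - e * r ^ 2 + r) - φ (h - e * r ^ 2 - r)) / r)
      (𝓝[>] 0) (𝓝 (∫ r : ℝ, (φ (h + r) - φ (h - r)) / r)) := by
  obtain ⟨R, hR, h0, -, -⟩ := hφ.exists_radius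
  obtain ⟨M, hM, hM0, hM1, -⟩ := hφ.exists_bound
  have hc := hφ.contDiff.continuous
  have hlip : ∀ x y, |φ x - φ y| ≤ M * |x - y| := by
    intro x y
    have := Convex.norm_image_sub_le_of_norm_deriv_le (f := φ) (C := M) (s := univ)
      (fun z _ => hφ.differentiable z) (fun z _ => hM1 z) convex_univ (mem_univ y) (mem_univ x)
    simpa using this
  set ρ := R + |h| with hρ
  have hρ0 : 0 < ρ := by positivity
  -- `N` and `Q` separate the two zeros: for `|r| ≤ 1 / (2 * e)` the term `e * r ^ 2` is at most
  -- `|r| / 2`.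
  set N : ℝ → ℝ → ℝ := fun e r =>
    if |r| ≤ 1 / (2 * e) then (φ (h - e * r ^ 2 + r) - φ (h - e * r ^ 2 - r)) / r else 0
  set Q : ℝ → ℝ → ℝ := fun e r =>
    if |r| ≤ 1 / (2 * e) then 0 else (φ (h - e * r ^ 2 + r) - φ (h - e * r ^ 2 - r)) / r
  have hQm : ∀ e, Measurable (Q e) := by
    intro e
    refine Measurable.ite (measurableSet_le (by fun_prop) (by fun_prop)) measurable_const ?_
    fun_prop
  have hNm : ∀ e, Measurable (N e) := by
    intro e
    refine Measurable.ite (measurableSet_le (by fun_prop) (by fun_prop)) ?_ measurable_const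
    fun_prop
  have hquot : ∀ e r, |(φ (h - e * r ^ 2 + r) - φ (h - e * r ^ 2 - r)) / r| ≤ 2 * M := by
    intro e r
    rcases eq_or_ne r 0 with rfl | hr
    · simp; positivity
    rw [abs_div, div_le_iff₀ (abs_pos.2 hr)]
    refine (hlip _ _).trans (le_of_eq ?_)
    rw [show h - e * r ^ 2 + r - (h - e * r ^ 2 - r) = 2 * r by ring, abs_mul, abs_two]
    ring
  have hNsupp : ∀ e, 0 < e → ∀ r, r ∉ Icc (-(2 * ρ)) (2 * ρ) → N e r = 0 := by
    intro e he r hr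
    have hr' : 2 * ρ < |r| := by
      by_contra hcon
      exact hr (abs_le.1 (not_lt.1 hcon))
    simp only [N]
    split_ifs with h1
    · have h2 : e * r ^ 2 ≤ |r| / 2 := by
        rw [← sq_abs r]
        rw [le_div_iff₀ (by positivity)] at h1
        nlinarith [abs_nonneg r]
      have h3 : 0 ≤ e * r ^ 2 := by positivity
      have k1 := abs_le.1 (le_refl |h|)
      have hz : ∀ s, |s| = |r| → φ (h - e * r ^ 2 + s) = 0 := by
        intro s hs
        apply h0
        rcases abs_cases s with ⟨k2, k3⟩ | ⟨k2, k3⟩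
        · refine lt_of_lt_of_le ?_ (le_abs_self _); linarith [k1.1, k1.2]
        · refine lt_of_lt_of_le ?_ (neg_le_abs _); linarith [k1.1, k1.2]
      rw [hz r rfl, sub_eq_add_neg (h - e * r ^ 2), hz (-r) (abs_neg r)]
      simp
    · rfl
  have hQsupp : ∀ e, 0 < e → 2 * ρ * e < 1 → ∀ r,
      r ∉ Icc (1 / e - 2 * ρ) (1 / e + 2 * ρ) ∪ Icc (-(1 / e) - 2 * ρ) (-(1 / e) + 2 * ρ) →
      Q e r = 0 := by
    intro e he he1 r hr
    simp only [Q]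
    split_ifs with h1
    · rfl
    · rw [not_le, div_lt_iff₀ (by positivity)] at h1
      rw [mem_union, not_or] at hr
      have k1 := abs_le.1 (le_refl |h|)
      have hr0 : ρ < |r| := by
        by_contra hcon
        have : |r| * (2 * e) ≤ ρ * (2 * e) := by
          apply mul_le_mul_of_nonneg_right (not_lt.1 hcon); positivity
        linarith
      have hz1 : φ (h - e * r ^ 2 - |r|) = 0 := by
        apply h0
        refine lt_of_lt_of_le ?_ (neg_le_abs _)
        have : 0 ≤ e * r ^ 2 := by positivity
        linarith [k1.1, k1.2]
      have hz2 : φ (h - e * r ^ 2 + |r|) = 0 := by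
        by_contra hne
        have h2 : |(h - e * r ^ 2 + |r|)| ≤ R := by
          by_contra hcon
          exact hne (h0 _ (not_le.1 hcon))
        have h3 : |(|r| * (1 - e * |r|))| ≤ ρ := by
          have : |r| * (1 - e * |r|) = (h - e * r ^ 2 + |r|) - h := by
            rw [← sq_abs r]; ring
          rw [this]
          exact (abs_sub _ _).trans (by linarith)
        rw [abs_mul, abs_abs] at h3
        have h4 : |(1 - e * |r|)| ≤ 2 * ρ * e := by
          have a0 := abs_nonneg (1 - e * |r|)
          have : |(1 - e * |r|)| * 1 ≤ |(1 - e * |r|)| * (|r| * (2 * e)) :=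
            mul_le_mul_of_nonneg_left h1.le a0
          have : 2 * e * (|r| * |(1 - e * |r|)|) ≤ 2 * e * ρ := by gcongr
          linarith
        have h5 : |(1 / e - |r|)| ≤ 2 * ρ := by
          have : 1 / e - |r| = (1 - e * |r|) / e := by field_simp
          rw [this, abs_div, abs_of_pos he, div_le_iff₀ he]
          exact h4
        rw [abs_le] at h5
        rcases abs_cases r with ⟨k2, k3⟩ | ⟨k2, k3⟩
        · exact hr.1 ⟨by linarith, by linarith⟩
        · exact hr.2 ⟨by linarith, by linarith⟩
      rcases abs_cases r with ⟨k2, k3⟩ | ⟨k2, k3⟩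
      · rw [k2] at hz1 hz2; rw [hz1, hz2]; simp
      · rw [k2] at hz1 hz2
        rw [sub_neg_eq_add] at hz1
        rw [← sub_eq_add_neg] at hz2
        rw [hz1, hz2]; simp
  have hsplit : ∀ e, 0 < e → 2 * ρ * e < 1 →
      ∫ r : ℝ, (φ (h - e * r ^ 2 + r) - φ (h - e * r ^ 2 - r)) / r
        = (∫ r, N e r) + ∫ r, Q e r := by
    intro e he he1
    rw [← integral_add]
    · congr 1
      ext r
      simp only [N, Q]
      split_ifs <;> simp
    · refine integrable_of_bounded_of_support (hNm e) (M := 2 * M) (fun r => ?_)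
        (isCompact_Icc.measure_lt_top) (hNsupp e he)
      simp only [N]
      split_ifs
      · exact hquot e r
      · simp; positivity
    · refine integrable_of_bounded_of_support (hQm e) (M := 2 * M) (fun r => ?_)
        ((isCompact_Icc.union isCompact_Icc).measure_lt_top) (hQsupp e he he1)
      simp only [Q]
      split_ifs
      · simp; positivity
      · exact hquot e r
  have hsmall : ∀ᶠ e : ℝ in 𝓝[>] 0, 0 < e ∧ 2 * ρ * e < 1 := by
    have h1 : ∀ᶠ e : ℝ in 𝓝[>] 0, 0 < e := self_mem_nhdsWithin
    have h2 : ∀ᶠ e : ℝ in 𝓝[>] 0, e < 1 / (2 * ρ) :=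
      nhdsWithin_le_nhds (eventually_lt_nhds (by positivity))
    filter_upwards [h1, h2] with e he he2
    rw [lt_div_iff₀ (by positivity)] at he2
    exact ⟨he, by linarith⟩
  have hN : Tendsto (fun e => ∫ r, N e r) (𝓝[>] 0) (𝓝 (∫ r : ℝ, (φ (h + r) - φ (h - r)) / r)) := by
    apply tendsto_integral_filter_of_dominated_convergence
      (fun r => (Icc (-(2 * ρ)) (2 * ρ)).indicator (fun _ => 2 * M) r)
    · exact Eventually.of_forall fun e => (hNm e).aestronglyMeasurable
    · filter_upwards [hsmall] with e he
      refine Eventually.of_forall fun r => ?_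
      by_cases hr : r ∈ Icc (-(2 * ρ)) (2 * ρ)
      · rw [indicator_of_mem hr]
        simp only [N]
        split_ifs
        · exact hquot e r
        · simp; positivity
      · rw [indicator_of_notMem hr, hNsupp e he.1 r hr, norm_zero]
    · exact (integrable_indicator_iff measurableSet_Icc).2 continuousOn_const.integrableOn_Icc
    · refine Eventually.of_forall fun r => ?_
      have hev : (fun e => (φ (h - e * r ^ 2 + r) - φ (h - e * r ^ 2 - r)) / r)
          =ᶠ[𝓝[>] 0] fun e => N e r := by
        have h2 : ∀ᶠ e : ℝ in 𝓝[>] 0, e < 1 / (2 * (|r| + 1)) :=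
          nhdsWithin_le_nhds (eventually_lt_nhds (by positivity))
        filter_upwards [hsmall, h2] with e he he2
        simp only [N]
        rw [if_pos]
        rw [lt_div_iff₀ (by positivity)] at he2
        rw [le_div_iff₀ (by linarith [he.1])]
        nlinarith [he.1]
      refine Tendsto.congr' hev (tendsto_nhdsWithin_of_tendsto_nhds ?_)
      have : Continuous fun e : ℝ => (φ (h - e * r ^ 2 + r) - φ (h - e * r ^ 2 - r)) / r := by
        fun_prop
      simpa using this.tendsto 0
  have hQ : Tendsto (fun e => ∫ r, Q e r) (𝓝[>] 0) (𝓝 0) := by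
    have hlim : Tendsto (fun e : ℝ => 4 * M * e * (8 * ρ)) (𝓝[>] 0) (𝓝 0) := by
      apply tendsto_nhdsWithin_of_tendsto_nhds
      have : Continuous fun e : ℝ => 4 * M * e * (8 * ρ) := by fun_prop
      simpa using this.tendsto 0
    apply squeeze_zero_norm' _ hlim
    filter_upwards [hsmall] with e he
    rw [← setIntegral_eq_integral_of_forall_compl_eq_zero (hQsupp e he.1 he.2)]
    refine (norm_setIntegral_le_of_norm_le_const (C := 4 * M * e)
      ((isCompact_Icc.union isCompact_Icc).measure_lt_top) fun r _ => ?_).trans ?_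
    · simp only [Q]
      split_ifs with h1
      · have := he.1
        simp; positivity
      · rw [not_le, div_lt_iff₀ (by linarith [he.1])] at h1
        have hr : 0 < |r| := by
          by_contra hcon
          nlinarith [abs_nonneg r, he.1]
        have k1 := hM0 (h - e * r ^ 2 + r)
        have k2 := hM0 (h - e * r ^ 2 - r)
        rw [Real.norm_eq_abs, abs_div, div_le_iff₀ hr]
        calc _ ≤ 2 * M := (abs_sub _ _).trans (by linarith)
          _ ≤ 2 * M * (|r| * (2 * e)) := by nlinarith
          _ = _ := by ring
    · have := he.1
      gcongr
      refine (measureReal_union_le _ _).trans ?_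
      rw [Real.volume_real_Icc_of_le (by linarith), Real.volume_real_Icc_of_le (by linarith)]
      linarith
  have := hN.add hQ
  rw [add_zero] at this
  refine this.congr' ?_
  filter_upwards [hsmall] with e he
  exact (hsplit e he.1 he.2).symm

/-- The substitution `u = r / A` turns the curvature parameter `b` into `b / A ^ 2`, which tends to
zero; hence the limit does not depend on the curvature. -/
lemma tendsto_integral_angleProfile :
    Tendsto (fun A : ℝ => ∫ τ in (-A)..A, angleProfile φ b h τ) atTop
      (𝓝 (∫ r : ℝ, (φ (h + r) - φ (h - r)) / r)) := by
  have h1 : Tendsto (fun A : ℝ => b / A ^ 2) atTop (𝓝[>] 0) := by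
    refine tendsto_nhdsWithin_iff.2 ⟨?_, ?_⟩
    · exact tendsto_const_nhds.div_atTop (tendsto_pow_atTop (by norm_num))
    · filter_upwards [eventually_gt_atTop 0] with A hA
      exact div_pos hb (by positivity)
  refine ((tendsto_integral_symmetric_quotient hφ h).comp h1).congr' ?_
  filter_upwards [eventually_gt_atTop 0] with A hA
  rw [integral_angleProfile hφ hb h hA, Function.comp_apply]
  set f : ℝ → ℝ := fun u => (φ (h - b * u ^ 2 + A * u) - φ (h - b * u ^ 2 - A * u)) / u
  have h2 := Measure.integral_comp_div f A
  rw [abs_of_pos hA, smul_eq_mul] at h2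
  have h3 : ∫ u, f u = A⁻¹ * ∫ r, f (r / A) := by
    rw [h2, inv_mul_cancel_left₀ hA.ne']
  change _ = ∫ u, f u
  rw [h3, ← integral_const_mul]
  congr 1
  ext r
  simp only [f]
  have e1 : b * (r / A) ^ 2 = b / A ^ 2 * r ^ 2 := by field_simp
  have e2 : A * (r / A) = r := by field_simp
  rw [e1, e2]
  field_simp

/-- The limiting contribution of all angles, with a continuous cut-off. -/
lemma tendsto_integral_cutoff_angleProfile :
    Tendsto (fun A : ℝ => ∫ τ, max 0 (min 1 (A + 1 - |τ|)) * angleProfile φ b h τ) atTop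
      (𝓝 (∫ r : ℝ, (φ (h + r) - φ (h - r)) / r)) := by
  obtain ⟨C, τ₁, hC, hτ₁, hV⟩ := abs_angleProfile_le hφ hb h
  have hcont := continuous_angleProfile hφ (b := b) h
  have hz : Tendsto (fun A : ℝ => C / A * 2) atTop (𝓝 0) := by
    have := (tendsto_const_nhds (x := C)).div_atTop (tendsto_id (α := ℝ)) |>.mul_const 2
    simpa using this
  -- The two cut-offs differ only for `A ≤ |τ| ≤ A + 1`, where the profile is at most `C / A`.
  have hd : Tendsto (fun A : ℝ => (∫ τ, max 0 (min 1 (A + 1 - |τ|)) * angleProfile φ b h τ)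
      - ∫ τ in (-A)..A, angleProfile φ b h τ) atTop (𝓝 0) := by
    apply squeeze_zero_norm' _ hz
    filter_upwards [eventually_ge_atTop τ₁] with A hA
    have hA0 : 0 < A := hτ₁.trans_le hA
    have hint : Integrable (fun τ => max 0 (min 1 (A + 1 - |τ|)) * angleProfile φ b h τ) := by
      apply Continuous.integrable_of_hasCompactSupport
      · fun_prop
      · refine HasCompactSupport.intro (isCompact_Icc (a := -(A + 1)) (b := A + 1)) fun τ hτ => ?_
        have : A + 1 < |τ| := by
          by_contra hcon
          exact hτ (abs_le.1 (not_lt.1 hcon))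
        rw [max_eq_left ((min_le_right _ _).trans (by linarith)), zero_mul]
    have hint2 : Integrable ((Ioc (-A) A).indicator (angleProfile φ b h)) :=
      (integrable_indicator_iff measurableSet_Ioc).2 (hcont.integrableOn_Ioc)
    rw [intervalIntegral.integral_of_le (by linarith), ← integral_indicator measurableSet_Ioc,
      ← integral_sub hint hint2]
    have hsupp : ∀ τ, τ ∉ Icc (-(A + 1)) (-A) ∪ Icc A (A + 1) →
        max 0 (min 1 (A + 1 - |τ|)) * angleProfile φ b h τ
          - (Ioc (-A) A).indicator (angleProfile φ b h) τ = 0 := by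
      intro τ hτ
      rw [mem_union, not_or, mem_Icc, mem_Icc] at hτ
      rcases lt_or_ge |τ| A with h1 | h1
      · have h2 := abs_lt.1 h1
        rw [indicator_of_mem (show τ ∈ Ioc (-A) A from ⟨h2.1, h2.2.le⟩), min_eq_left (by linarith), max_eq_right zero_le_one]
        ring
      · have h2 : A + 1 < |τ| := by
          by_contra hcon
          rw [not_lt] at hcon
          rcases abs_cases τ with ⟨k2, k3⟩ | ⟨k2, k3⟩
          · exact hτ.2 ⟨by linarith, by linarith⟩
          · exact hτ.1 ⟨by linarith, by linarith⟩
        rw [max_eq_left ((min_le_right _ _).trans (by linarith)), zero_mul, indicator_of_notMem,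
          sub_zero]
        rintro ⟨h3, h4⟩
        have := abs_le.2 ⟨h3.le, h4⟩
        linarith
    rw [← setIntegral_eq_integral_of_forall_compl_eq_zero hsupp]
    refine (norm_setIntegral_le_of_norm_le_const (C := C / A)
      ((isCompact_Icc.union isCompact_Icc).measure_lt_top) fun τ hτ => ?_).trans ?_
    · have h1 : A ≤ |τ| := by
        rcases hτ with h1 | h1
        · exact le_trans (by linarith [h1.2]) (neg_le_abs τ)
        · exact h1.1.trans (le_abs_self τ)
      have h2 : |angleProfile φ b h τ| ≤ C / A := (hV τ (hA.trans h1)).trans (by gcongr)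
      have h3 : 0 ≤ max 0 (min 1 (A + 1 - |τ|)) := le_max_left _ _
      have h4 : max 0 (min 1 (A + 1 - |τ|)) ≤ 1 := max_le zero_le_one (min_le_left _ _)
      rw [Real.norm_eq_abs]
      refine le_trans ?_ h2
      rw [indicator_apply]
      split_ifs
      · rw [← sub_one_mul, abs_mul]
        have : |max 0 (min 1 (A + 1 - |τ|)) - 1| ≤ 1 := by rw [abs_le]; constructor <;> linarith
        nlinarith [abs_nonneg (angleProfile φ b h τ)]
      · rw [sub_zero, abs_mul, abs_of_nonneg h3]
        nlinarith [abs_nonneg (angleProfile φ b h τ)]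
    · gcongr
      refine (measureReal_union_le _ _).trans ?_
      rw [Real.volume_real_Icc_of_le (by linarith), Real.volume_real_Icc_of_le (by linarith)]
      linarith
  have := hd.add (tendsto_integral_angleProfile hφ hb h)
  simpa using this

-- On the symmetric set `η < |r|` only the even part of `φ (h - r) / (π r)` contributes, and the
-- even part is bounded with compact support, so the truncation can be removed by dominated
-- convergence.
omit hb in
lemma isPVTransform_integral :
    IsPVTransform φ h (-(1 / (2 * Real.pi)) * ∫ r : ℝ, (φ (h + r) - φ (h - r)) / r) := by
  obtain ⟨R, hR, h0, -, -⟩ := hφ.exists_radius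
  obtain ⟨M, hM, hM0, hM1, -⟩ := hφ.exists_bound
  have hc := hφ.contDiff.continuous
  have hlip : ∀ x y, |φ x - φ y| ≤ M * |x - y| := by
    intro x y
    have := Convex.norm_image_sub_le_of_norm_deriv_le (f := φ) (C := M) (s := univ)
      (fun z _ => hφ.differentiable z) (fun z _ => hM1 z) convex_univ (mem_univ y) (mem_univ x)
    simpa using this
  set ρ := R + |h| with hρ
  have hρ0 : 0 < ρ := by positivity
  have hvan : ∀ r, ρ < |r| → φ (h - r) = 0 ∧ φ (h + r) = 0 := by
    intro r hr
    constructor <;> apply h0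
    · have := abs_sub_abs_le_abs_sub r h
      rw [abs_sub_comm] at this
      linarith
    · have := abs_sub_abs_le_abs_sub r (-h)
      rw [abs_neg, sub_neg_eq_add, add_comm] at this
      linarith
  set ψ : ℝ → ℝ := fun r => -(1 / (2 * Real.pi)) * ((φ (h + r) - φ (h - r)) / r) with hψ
  have hψm : Measurable ψ := by fun_prop
  have hψb : ∀ r, |ψ r| ≤ M := by
    intro r
    rcases eq_or_ne r 0 with rfl | hr
    · simp [hψ]; positivity
    have hpi : 1 / (2 * Real.pi) ≤ 1 / 2 := by
      have := Real.pi_gt_three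
      apply one_div_le_one_div_of_le <;> linarith
    have hq : |(φ (h + r) - φ (h - r)) / r| ≤ 2 * M := by
      rw [abs_div, div_le_iff₀ (abs_pos.2 hr)]
      refine (hlip _ _).trans (le_of_eq ?_)
      rw [show h + r - (h - r) = 2 * r by ring, abs_mul, abs_two]
      ring
    simp only [hψ]
    rw [abs_mul, abs_neg, abs_of_pos (by positivity)]
    calc _ ≤ 1 / 2 * (2 * M) := by gcongr
      _ = M := by ring
  have hψs : ∀ r, r ∉ Icc (-ρ) ρ → ψ r = 0 := by
    intro r hr
    have := hvan r (by
      by_contra hcon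
      exact hr (abs_le.1 (not_lt.1 hcon)))
    simp [hψ, this.1, this.2]
  have hψi : Integrable ψ := integrable_of_bounded_of_support hψm hψb
    isCompact_Icc.measure_lt_top hψs
  have hSm : ∀ η : ℝ, MeasurableSet {r : ℝ | η < |r|} := fun η =>
    measurableSet_lt measurable_const (by fun_prop)
  have heq : ∀ η : ℝ, 0 < η →
      ∫ r in {r : ℝ | η < |r|}, φ (h - r) / (Real.pi * r) = ∫ r in {r : ℝ | η < |r|}, ψ r := by
    intro η hη
    set q : ℝ → ℝ := fun r => {r : ℝ | η < |r|}.indicator (fun r => φ (h - r) / (Real.pi * r)) r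
      with hq
    have hqi : Integrable q := by
      refine integrable_of_bounded_of_support (M := M / (Real.pi * η)) (K := Icc (-ρ) ρ)
        (Measurable.indicator (by fun_prop) (hSm η)) ?_ isCompact_Icc.measure_lt_top ?_
      · intro r
        simp only [hq, indicator_apply]
        split_ifs with hr
        · rw [abs_div, abs_mul, abs_of_pos Real.pi_pos]
          have : η < |r| := hr
          have := Real.pi_pos
          gcongr
          exact hM0 _
        · simp; positivity
      · intro r hr
        have := hvan r (by
          by_contra hcon
          exact hr (abs_le.1 (not_lt.1 hcon)))
        simp only [hq, indicator_apply]
        simp [this.1]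
    rw [← integral_indicator (hSm η), ← integral_indicator (hSm η)]
    have h2 : ∫ r, q r = ∫ r, q (-r) := (integral_neg_eq_self q volume).symm
    have h3 : ∫ r, q r = 1 / 2 * ∫ r, (q r + q (-r)) := by
      rw [integral_add hqi hqi.comp_neg, ← h2]; ring
    change ∫ r, q r = _
    rw [h3, ← integral_const_mul]
    congr 1
    ext r
    simp only [hq, hψ, indicator_apply, mem_ofPred_eq, abs_neg, sub_neg_eq_add, mul_neg, div_neg]
    split_ifs
    · field_simp
      ring
    · simp
  have hlim : Tendsto (fun η : ℝ => ∫ r in {r : ℝ | η < |r|}, ψ r) (𝓝[>] 0) (𝓝 (∫ r, ψ r)) := by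
    simp_rw [← integral_indicator (hSm _)]
    apply tendsto_integral_filter_of_dominated_convergence (fun r => ‖ψ r‖)
    · exact Eventually.of_forall fun η => (hψm.indicator (hSm η)).aestronglyMeasurable
    · exact Eventually.of_forall fun η => Eventually.of_forall fun r =>
        norm_indicator_le_norm_self _ _
    · exact hψi.norm
    · have : ∀ᵐ u : ℝ, u ≠ 0 := by
        rw [ae_iff]; simp
      filter_upwards [this] with r hr
      apply tendsto_const_nhds.congr'
      filter_upwards [nhdsWithin_le_nhds (eventually_lt_nhds (abs_pos.2 hr))] with η hη
      rw [indicator_of_mem]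
      exact hη
  rw [← integral_const_mul]
  refine Tendsto.congr' ?_ hlim
  filter_upwards [self_mem_nhdsWithin] with η hη
  exact (heq η hη).symm

end Profile

/-! ### Slice integrals with a uniform first-order expansion in the offset. -/

/-- The integral of `f` over the line `y = p - t u`, with respect to `u`. -/
noncomputable def sliceInt (f : ℝ × ℝ → ℝ) (t p : ℝ) : ℝ := ∫ u : ℝ, f (u, p - t * u)

/-- Near `(t₁, 0)` the function `H t` is differentiable at `0` up to a uniformly small error. -/
def HasSlope (H : ℝ → ℝ → ℝ) (t₁ : ℝ) : Prop :=
  ∃ c, ∀ η > 0, ∃ ρ > 0, ∀ t p, |t - t₁| < ρ → |p| < ρ → |H t p - H t 0 - c * p| ≤ η * |p|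

namespace HasSlope

variable {H G : ℝ → ℝ → ℝ} {t₁ : ℝ}

lemma zero : HasSlope (fun _ _ => 0) t₁ := ⟨0, fun η hη => ⟨1, one_pos, fun t p _ _ => by
  simp; positivity⟩⟩

lemma add (hH : HasSlope H t₁) (hG : HasSlope G t₁) : HasSlope (fun t p => H t p + G t p) t₁ := by
  obtain ⟨c, hc⟩ := hH
  obtain ⟨c', hc'⟩ := hG
  refine ⟨c + c', fun η hη => ?_⟩
  obtain ⟨ρ, hρ, h⟩ := hc (η / 2) (by positivity)
  obtain ⟨ρ', hρ', h'⟩ := hc' (η / 2) (by positivity)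
  refine ⟨min ρ ρ', lt_min hρ hρ', fun t p ht hp => ?_⟩
  have h1 := h t p (ht.trans_le (min_le_left _ _)) (hp.trans_le (min_le_left _ _))
  have h2 := h' t p (ht.trans_le (min_le_right _ _)) (hp.trans_le (min_le_right _ _))
  have e : H t p + G t p - (H t 0 + G t 0) - (c + c') * p
      = (H t p - H t 0 - c * p) + (G t p - G t 0 - c' * p) := by ring
  rw [e]
  refine (abs_add_le _ _).trans ((add_le_add h1 h2).trans (le_of_eq ?_))
  ring

lemma const_mul (hH : HasSlope H t₁) (a : ℝ) : HasSlope (fun t p => a * H t p) t₁ := by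
  obtain ⟨c, hc⟩ := hH
  refine ⟨a * c, fun η hη => ?_⟩
  obtain ⟨ρ, hρ, h⟩ := hc (η / (|a| + 1)) (by positivity)
  refine ⟨ρ, hρ, fun t p ht hp => ?_⟩
  rw [show a * H t p - a * H t 0 - a * c * p = a * (H t p - H t 0 - c * p) by ring, abs_mul]
  calc _ ≤ (|a| + 1) * (η / (|a| + 1) * |p|) := by
        gcongr
        · linarith
        · exact h t p ht hp
    _ = η * |p| := by field_simp

lemma congr (hH : HasSlope H t₁) {ρ₀ : ℝ} (hρ₀ : 0 < ρ₀)
    (h : ∀ t p, |t - t₁| < ρ₀ → |p| < ρ₀ → G t p = H t p) : HasSlope G t₁ := by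
  obtain ⟨c, hc⟩ := hH
  refine ⟨c, fun η hη => ?_⟩
  obtain ⟨ρ, hρ, h'⟩ := hc η hη
  refine ⟨min ρ ρ₀, lt_min hρ hρ₀, fun t p ht hp => ?_⟩
  have ht' := ht.trans_le (min_le_right _ _)
  rw [h t p ht' (hp.trans_le (min_le_right _ _)), h t 0 ht' (by simpa using hρ₀)]
  exact h' t p (ht.trans_le (min_le_left _ _)) (hp.trans_le (min_le_left _ _))

lemma sum {ι : Type*} (s : Finset ι) {K : ι → ℝ → ℝ → ℝ} (hK : ∀ i ∈ s, HasSlope (K i) t₁) :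
    HasSlope (fun t p => ∑ i ∈ s, K i t p) t₁ := by
  classical
  induction s using Finset.induction_on with
  | empty => simpa using zero
  | insert a s ha ih =>
    simp_rw [Finset.sum_insert ha]
    exact (hK a (Finset.mem_insert_self _ _)).add
      (ih fun i hi => hK i (Finset.mem_insert_of_mem hi))

/-- An integral whose integrand depends smoothly on `p` and whose upper end point has a slope. -/
lemma intervalIntegral {F F' : ℝ → ℝ → ℝ → ℝ}
    (hF : Continuous fun z : ℝ × ℝ × ℝ => F z.1 z.2.1 z.2.2)
    (hF' : Continuous fun z : ℝ × ℝ × ℝ => F' z.1 z.2.1 z.2.2)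
    (hd : ∀ t p u, HasDerivAt (fun p => F t p u) (F' t p u) p) {e : ℝ → ℝ → ℝ} {u₁ μ : ℝ}
    (he : ∀ η > 0, ∃ ρ > 0, ∀ t p, |t - t₁| < ρ → |p| < ρ →
      |e t p - e t 0 - μ * p| ≤ η * |p| ∧ |e t p - u₁| ≤ η) (l : ℝ) :
    HasSlope (fun t p => ∫ u in l..e t p, F t p u) t₁ := by
  set K : Set ℝ := Icc (min l (u₁ - 1)) (max l (u₁ + 1)) with hK
  have hcomp : IsCompact (Icc (t₁ - 1) (t₁ + 1) ×ˢ Icc (-1 : ℝ) 1 ×ˢ K) :=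
    isCompact_Icc.prod (isCompact_Icc.prod isCompact_Icc)
  obtain ⟨M, hM⟩ := hcomp.exists_bound_of_continuousOn hF'.continuousOn
  have hM0 : 0 ≤ M := (norm_nonneg _).trans (hM (t₁, 0, l) ⟨⟨by simp, by simp⟩, ⟨by simp, by simp⟩,
    min_le_left _ _, le_max_left _ _⟩)
  have hFu : ∀ t p, Continuous (F t p) := fun t p =>
    hF.comp (by fun_prop : Continuous fun u : ℝ => (t, p, u))
  have hF'u : ∀ t p, Continuous (F' t p) := fun t p =>
    hF'.comp (by fun_prop : Continuous fun u : ℝ => (t, p, u))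
  set L : ℝ := max l (u₁ + 1) - min l (u₁ - 1)
  have hL : 0 ≤ L := by
    have := min_le_left l (u₁ - 1)
    have := le_max_left l (u₁ + 1)
    simp only [L]; linarith
  -- This is Leibniz's rule at `(t₁, 0)`: the derivative under the integral plus the moving end
  -- point.
  refine ⟨(∫ u in l..u₁, F' t₁ 0 u) + μ * F t₁ 0 u₁, fun η hη => ?_⟩
  -- The four summands match the four errors in `E` below: linearizing the integrand, moving the end
  -- point of the integral of `F'`, freezing `F` on the short end piece, and linearizing the end
  -- point.
  set η₁ : ℝ := η / (L + M + (|μ| + 1) + |F t₁ 0 u₁|) with hη₁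
  have hden : 0 < L + M + (|μ| + 1) + |F t₁ 0 u₁| := by positivity
  have hη₁0 : 0 < η₁ := by positivity
  obtain ⟨δ₁, hδ₁, h1⟩ := Metric.uniformContinuousOn_iff.1
    (hcomp.uniformContinuousOn_of_continuous hF'.continuousOn) η₁ hη₁0
  obtain ⟨δ₂, hδ₂, h2⟩ := Metric.continuous_iff.1 hF (t₁, 0, u₁) η₁ hη₁0
  obtain ⟨ρ, hρ, h3⟩ := he (min (min η₁ 1) (δ₂ / 2)) (by positivity)
  refine ⟨min ρ (min 1 (min δ₁ δ₂)), by positivity, fun t p ht hp => ?_⟩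
  have htρ := ht.trans_le (min_le_left _ _)
  have hpρ := hp.trans_le (min_le_left _ _)
  have ht' := ht.trans_le (min_le_right _ _)
  have hp' := hp.trans_le (min_le_right _ _)
  have ht1 : |t - t₁| < 1 := ht'.trans_le (min_le_left _ _)
  have hp1 : |p| < 1 := hp'.trans_le (min_le_left _ _)
  have ht2 : |t - t₁| < δ₁ := ht'.trans_le ((min_le_right _ _).trans (min_le_left _ _))
  have hp2 : |p| < δ₁ := hp'.trans_le ((min_le_right _ _).trans (min_le_left _ _))
  have ht3 : |t - t₁| < δ₂ := ht'.trans_le ((min_le_right _ _).trans (min_le_right _ _))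
  have hp3 : |p| < δ₂ := hp'.trans_le ((min_le_right _ _).trans (min_le_right _ _))
  have ht4 : t ∈ Icc (t₁ - 1) (t₁ + 1) := by
    rw [abs_lt] at ht1; constructor <;> linarith
  obtain ⟨a1, a2⟩ := h3 t p htρ hpρ
  obtain ⟨-, b2⟩ := h3 t 0 htρ (by simpa using hρ)
  have a3 := a2.trans (min_le_right _ _)
  have b3 := b2.trans (min_le_right _ _)
  have b4 : |e t 0 - u₁| ≤ η₁ := b2.trans ((min_le_left _ _).trans (min_le_left _ _))
  have b5 : |e t 0 - u₁| ≤ 1 := b2.trans ((min_le_left _ _).trans (min_le_right _ _))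
  have a4 : |e t p - e t 0 - μ * p| ≤ η₁ * |p| :=
    a1.trans (mul_le_mul_of_nonneg_right ((min_le_left _ _).trans (min_le_left _ _))
      (abs_nonneg _))
  have a5 : |e t p - e t 0| ≤ (|μ| + 1) * |p| := by
    have k1 := a1.trans (mul_le_mul_of_nonneg_right ((min_le_left _ _).trans (min_le_right _ _))
      (abs_nonneg p))
    have k2 := abs_add_le (e t p - e t 0 - μ * p) (μ * p)
    rw [sub_add_cancel, abs_mul] at k2
    linarith
  have hseg : ∀ u ∈ uIoc l (e t 0), u ∈ K := by
    intro u hu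
    obtain ⟨c1, c2⟩ := uIoc_subset_uIcc hu
    obtain ⟨d1, d2⟩ := abs_le.1 b5
    refine ⟨le_trans (le_min (min_le_left _ _) ?_) c1, c2.trans (max_le (le_max_left _ _) ?_)⟩
    · exact (min_le_right _ _).trans (by linarith)
    · exact le_trans (by linarith) (le_max_right _ _)
  have I1 : |∫ u in l..e t 0, (F t p u - F t 0 u - p * F' t₁ 0 u)| ≤ η₁ * |p| * L := by
    have k : ∀ u ∈ uIoc l (e t 0), ‖F t p u - F t 0 u - p * F' t₁ 0 u‖ ≤ η₁ * |p| := by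
      intro u hu
      have hu' := hseg u hu
      have key := Convex.norm_image_sub_le_of_norm_hasDerivWithin_le (𝕜 := ℝ)
        (f := fun p => F t p u - p * F' t₁ 0 u) (f' := fun q => F' t q u - F' t₁ 0 u) (C := η₁)
        (s := Icc (-|p|) |p|) (x := 0) (y := p) ?_ ?_ (convex_Icc _ _) ?_ ?_
      · simp only [zero_mul, sub_zero] at key
        rw [Real.norm_eq_abs p] at key
        refine le_trans (le_of_eq ?_) key
        congr 1; ring
      · intro q _
        have := (hd t q u).fun_sub ((hasDerivAt_id q).mul_const (F' t₁ 0 u))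
        simpa using this.hasDerivWithinAt
      · intro q hq
        have hq' : |q| ≤ |p| := abs_le.2 hq
        have := h1 (t, q, u) ⟨ht4, abs_le.1 (hq'.trans hp1.le), hu'⟩ (t₁, 0, u)
          ⟨⟨by simp, by simp⟩, ⟨by simp, by simp⟩, hu'⟩ (by
            simp only [Prod.dist_eq, Real.dist_eq, sub_self, sub_zero, abs_zero]
            exact max_lt ht2 (max_lt (hq'.trans_lt hp2) hδ₁))
        rw [dist_eq_norm] at this
        exact this.le
      · simp
      · exact ⟨neg_abs_le p, le_abs_self p⟩
    refine (intervalIntegral.norm_integral_le_of_norm_le_const k).trans ?_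
    gcongr
    obtain ⟨d1, d2⟩ := abs_le.1 b5
    have e1 := min_le_left l (u₁ - 1)
    have e2 := min_le_right l (u₁ - 1)
    have e3 := le_max_left l (u₁ + 1)
    have e4 := le_max_right l (u₁ + 1)
    rw [abs_le]
    constructor <;> simp only [L] <;> linarith
  have I2 : |∫ u in u₁..e t 0, F' t₁ 0 u| ≤ M * η₁ := by
    have k : ∀ u ∈ uIoc u₁ (e t 0), ‖F' t₁ 0 u‖ ≤ M := by
      intro u hu
      obtain ⟨c1, c2⟩ := uIoc_subset_uIcc hu
      obtain ⟨d1, d2⟩ := abs_le.1 b5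
      refine hM (t₁, 0, u) ⟨⟨by simp, by simp⟩, ⟨by simp, by simp⟩, ?_, ?_⟩
      · exact le_trans (le_min ((min_le_right _ _).trans (by linarith))
          ((min_le_right _ _).trans (by linarith))) c1
      · exact c2.trans (max_le (le_trans (by linarith) (le_max_right _ _))
          (le_trans (by linarith) (le_max_right _ _)))
    refine (intervalIntegral.norm_integral_le_of_norm_le_const k).trans ?_
    gcongr
  have I3 : |∫ u in e t 0..e t p, (F t p u - F t₁ 0 u₁)| ≤ η₁ * ((|μ| + 1) * |p|) := by
    have k : ∀ u ∈ uIoc (e t 0) (e t p), ‖F t p u - F t₁ 0 u₁‖ ≤ η₁ := by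
      intro u hu
      obtain ⟨c1, c2⟩ := uIoc_subset_uIcc hu
      have := h2 (t, p, u) (by
        simp only [Prod.dist_eq, Real.dist_eq, sub_zero]
        refine max_lt ht3 (max_lt hp3 (lt_of_le_of_lt ?_ (half_lt_self hδ₂)))
        rw [abs_le] at *
        constructor
        · exact (le_sub_iff_add_le.2 (le_trans (le_min (by linarith) (by linarith)) c1))
        · exact (sub_le_iff_le_add.2 (c2.trans (max_le (by linarith) (by linarith)))))
      rw [dist_eq_norm] at this
      exact this.le
    refine (intervalIntegral.norm_integral_le_of_norm_le_const k).trans ?_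
    gcongr
  have hi : ∀ t p a b, IntervalIntegrable (F t p) volume a b := fun t p a b =>
    (hFu t p).intervalIntegrable _ _
  have hi' : ∀ t p a b, IntervalIntegrable (F' t p) volume a b := fun t p a b =>
    (hF'u t p).intervalIntegrable _ _
  have E1 : ∫ u in l..e t 0, (F t p u - F t 0 u - p * F' t₁ 0 u)
      = (∫ u in l..e t 0, F t p u) - (∫ u in l..e t 0, F t 0 u)
        - p * ∫ u in l..e t 0, F' t₁ 0 u := by
    rw [intervalIntegral.integral_sub ((hi _ _ _ _).sub (hi _ _ _ _)) ((hi' _ _ _ _).const_mul _),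
      intervalIntegral.integral_sub (hi _ _ _ _) (hi _ _ _ _), intervalIntegral.integral_const_mul]
  have E2 : ∫ u in l..e t 0, F' t₁ 0 u
      = (∫ u in l..u₁, F' t₁ 0 u) + ∫ u in u₁..e t 0, F' t₁ 0 u :=
    (intervalIntegral.integral_add_adjacent_intervals (hi' _ _ _ _) (hi' _ _ _ _)).symm
  have E3 : ∫ u in e t 0..e t p, (F t p u - F t₁ 0 u₁)
      = (∫ u in e t 0..e t p, F t p u) - (e t p - e t 0) * F t₁ 0 u₁ := by
    rw [intervalIntegral.integral_sub (hi _ _ _ _) (by simp)]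
    simp
  have E4 : ∫ u in l..e t p, F t p u
      = (∫ u in l..e t 0, F t p u) + ∫ u in e t 0..e t p, F t p u :=
    (intervalIntegral.integral_add_adjacent_intervals (hi _ _ _ _) (hi _ _ _ _)).symm
  have E : (∫ u in l..e t p, F t p u) - (∫ u in l..e t 0, F t 0 u)
      - ((∫ u in l..u₁, F' t₁ 0 u) + μ * F t₁ 0 u₁) * p
      = (∫ u in l..e t 0, (F t p u - F t 0 u - p * F' t₁ 0 u))
        + p * (∫ u in u₁..e t 0, F' t₁ 0 u)
        + (∫ u in e t 0..e t p, (F t p u - F t₁ 0 u₁))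
        + (e t p - e t 0 - μ * p) * F t₁ 0 u₁ := by
    rw [E1, E3, E4, E2]; ring
  rw [E]
  have J2 : |p * (∫ u in u₁..e t 0, F' t₁ 0 u)| ≤ |p| * (M * η₁) := by
    rw [abs_mul]; gcongr
  have J4 : |(e t p - e t 0 - μ * p) * F t₁ 0 u₁| ≤ η₁ * |p| * |F t₁ 0 u₁| := by
    rw [abs_mul]; gcongr
  refine (abs_add_le _ _).trans ((add_le_add_left ((abs_add_le _ _).trans
    (add_le_add_left (abs_add_le _ _) _)) _).trans ?_)
  have : η * |p| = η₁ * |p| * L + |p| * (M * η₁) + η₁ * ((|μ| + 1) * |p|)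
      + η₁ * |p| * |F t₁ 0 u₁| := by
    rw [hη₁]; field_simp
  linarith

end HasSlope

/-! ### Sets crossed transversally by a line. -/

/-- Near `z` the set `D` is described by the sign of a strictly differentiable function that
increases in the direction `(1, -t)`. -/
def LocalSide (D : Set (ℝ × ℝ)) (z : ℝ × ℝ) (t : ℝ) : Prop :=
  ∃ (ρ : ℝ × ℝ → ℝ) (ρ' : ℝ × ℝ →L[ℝ] ℝ), HasStrictFDerivAt ρ ρ' z ∧ ρ z = 0 ∧ 0 < ρ' (1, -t) ∧
    ∃ cp cm : Prop, ∀ᶠ x in 𝓝 z, (0 < ρ x → (x ∈ D ↔ cp)) ∧ (ρ x < 0 → (x ∈ D ↔ cm))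

/-- Strict differentiability linearizes `ρ` between any two points near the base point, which makes
the expansion uniform in the slope `t`. Replacing the direction `(1, -t)` by `(1, -t₁)` costs `|t -
t₁|` times a multiple of `|u - u'|` and is absorbed in the error. -/
lemma strictFDeriv_line_estimate {ρ : ℝ × ℝ → ℝ} {ρ' : ℝ × ℝ →L[ℝ] ℝ} {u₁ t₁ : ℝ}
    (hρ : HasStrictFDerivAt ρ ρ' (u₁, -t₁ * u₁)) {P : ℝ × ℝ → Prop}
    (hP : ∀ᶠ x in 𝓝 (u₁, -t₁ * u₁), P x) {η : ℝ} (hη : 0 < η) :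
    ∃ r > 0, ∀ t p p' u u', |t - t₁| < r → |p| < r → |p'| < r → |u - u₁| < r → |u' - u₁| < r →
      P (u, p - t * u) ∧
      |ρ (u, p - t * u) - ρ (u', p' - t * u') - ρ' (1, -t₁) * (u - u') - ρ' (0, 1) * (p - p')|
        ≤ η * (|u - u'| + |p - p'|) := by
  set m := ρ' (0, 1) with hm
  set lam := ρ' (1, -t₁) with hlam
  set T := |t₁| + 1 with hT
  have hT0 : 0 < T := by positivity
  set c := η / (2 * (1 + T)) with hc
  have hc0 : 0 < c := by positivity
  have h1 := hρ.isLittleO.def hc0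
  rw [nhds_prod_eq] at h1
  obtain ⟨S, hS, h2⟩ := Filter.eventually_prod_self_iff'.1 h1
  obtain ⟨δ, hδ, h3⟩ := Metric.eventually_nhds_iff.1 (Filter.Eventually.and hS hP)
  refine ⟨min 1 (min (δ / (2 + T + |u₁|)) (η / (2 * (|m| + 1)))), by positivity,
    fun t p p' u u' ht hp hp' hu hu' => ?_⟩
  have ht1 : |t - t₁| < 1 := ht.trans_le (min_le_left _ _)
  have htT : |t| ≤ T := by
    have := abs_sub_abs_le_abs_sub t t₁
    rw [hT]; linarith
  set r' := δ / (2 + T + |u₁|) with hr'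
  have hr'0 : 0 < r' := by positivity
  have hle : min 1 (min r' (η / (2 * (|m| + 1)))) ≤ r' := (min_le_right _ _).trans (min_le_left _ _)
  have htm : |t - t₁| * |m| ≤ η / 2 := by
    have : |t - t₁| ≤ η / (2 * (|m| + 1)) :=
      ht.le.trans ((min_le_right _ _).trans (min_le_right _ _))
    rw [le_div_iff₀ (by positivity)] at this
    nlinarith [abs_nonneg (t - t₁), abs_nonneg m]
  have hball : ∀ p u, |p| < r' → |u - u₁| < r' →
      dist (u, p - t * u) (u₁, -t₁ * u₁) < δ := by
    intro p u hp hu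
    have hδe : δ = r' * (2 + T + |u₁|) := by rw [hr']; field_simp
    rw [Prod.dist_eq, Real.dist_eq, Real.dist_eq]
    have hu₁ : 0 ≤ |u₁| := abs_nonneg _
    apply max_lt
    · rw [hδe]; dsimp only; nlinarith
    · dsimp only
      rw [show p - t * u - -t₁ * u₁ = p + -(t * (u - u₁)) + -((t - t₁) * u₁) by ring]
      refine (abs_add_three _ _ _).trans_lt ?_
      rw [abs_neg, abs_neg, abs_mul, abs_mul, hδe]
      have e1 : |t| * |u - u₁| ≤ T * r' := by gcongr
      have e2 : |t - t₁| * |u₁| ≤ r' * |u₁| := by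
        gcongr
        exact ht.le.trans hle
      nlinarith
  have b1 := h3 (hball p u (hp.trans_le hle) (hu.trans_le hle))
  have b2 := h3 (hball p' u' (hp'.trans_le hle) (hu'.trans_le hle))
  refine ⟨b1.2, ?_⟩
  have h4 := h2 _ b1.1 _ b2.1
  dsimp only at h4
  set d := u - u' with hd
  set q := p - p' with hq
  have hxx : ((u, p - t * u) : ℝ × ℝ) - (u', p' - t * u')
      = d • ((1 : ℝ), -t₁) + (q - (t - t₁) * d) • ((0 : ℝ), (1 : ℝ)) := by
    ext
    · simp [hd]
    · simp [hd, hq]; ring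
  have hnorm : ‖((u, p - t * u) : ℝ × ℝ) - (u', p' - t * u')‖ ≤ |q| + (1 + T) * |d| := by
    rw [Prod.norm_def]
    have hd0 := abs_nonneg d
    have hq0 := abs_nonneg q
    apply max_le
    · simp only [Prod.fst_sub, Real.norm_eq_abs]
      nlinarith
    · simp only [Prod.snd_sub, Real.norm_eq_abs]
      rw [show p - t * u - (p' - t * u') = q + -(t * d) by rw [hd, hq]; ring]
      refine (abs_add_le _ _).trans ?_
      rw [abs_neg, abs_mul]
      have : |t| * |d| ≤ T * |d| := by gcongr
      linarith
  rw [hxx, map_add, map_smul, map_smul, smul_eq_mul, smul_eq_mul, ← hm, ← hlam, ← hxx,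
    Real.norm_eq_abs] at h4
  have e : ρ (u, p - t * u) - ρ (u', p' - t * u') - lam * d - m * q
      = (ρ (u, p - t * u) - ρ (u', p' - t * u') - (d * lam + (q - (t - t₁) * d) * m))
        + -((t - t₁) * m * d) := by ring
  rw [e]
  refine (abs_add_le _ _).trans ?_
  rw [abs_neg, abs_mul, abs_mul]
  have f1 : c * ‖((u, p - t * u) : ℝ × ℝ) - (u', p' - t * u')‖ ≤ η / 2 * (|d| + |q|) := by
    calc _ ≤ c * (|q| + (1 + T) * |d|) := by gcongr
      _ ≤ c * ((1 + T) * (|d| + |q|)) := by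
          gcongr
          nlinarith [abs_nonneg q]
      _ = _ := by rw [hc]; field_simp
  have f2 : |t - t₁| * |m| * |d| ≤ η / 2 * |d| := by gcongr
  have := abs_nonneg q
  nlinarith

/-- A set with a local side meets nearby lines in half lines, whose end point has a slope. -/
lemma LocalSide.exists_crossing {D : Set (ℝ × ℝ)} {u₁ t₁ : ℝ} (h : LocalSide D (u₁, -t₁ * u₁) t₁) :
    ∃ r > 0, ∃ ρ₀ > 0, ∃ (e : ℝ → ℝ → ℝ) (μ : ℝ) (cp cm : Prop),
      (∀ t p, |t - t₁| < ρ₀ → |p| < ρ₀ → e t p ∈ Ioo (u₁ - r) (u₁ + r) ∧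
        ∀ u ∈ Ioo (u₁ - r) (u₁ + r), (e t p < u → ((u, p - t * u) ∈ D ↔ cp)) ∧
          (u < e t p → ((u, p - t * u) ∈ D ↔ cm))) ∧
      ∀ η > 0, ∃ ρ > 0, ∀ t p, |t - t₁| < ρ → |p| < ρ →
        |e t p - e t 0 - μ * p| ≤ η * |p| ∧ |e t p - u₁| ≤ η := by
  obtain ⟨ρ, ρ', hρ, hz, hpos, cp, cm, hside⟩ := h
  set lam := ρ' (1, -t₁) with hlam
  set m := ρ' (0, 1) with hm
  obtain ⟨r₀, hr₀, hest⟩ := strictFDeriv_line_estimate hρ hside (η := lam / 4) (by positivity)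
  set r := r₀ / 2 with hr
  have hr0 : 0 < r := by positivity
  have hrr : r < r₀ := by rw [hr]; linarith
  set ρ₀ := min (r₀ / (1 + |u₁|)) (lam * r / (4 * (1 + |u₁|) * (|m| + lam))) with hρ₀
  have hρ₀0 : 0 < ρ₀ := by positivity
  have hu₁ : 0 ≤ |u₁| := abs_nonneg _
  have hρr : ρ₀ * (1 + |u₁|) ≤ r₀ := by
    rw [← le_div_iff₀ (by positivity)]; exact min_le_left _ _
  have hρr1 : ρ₀ ≤ r₀ := by nlinarith
  have hρr2 : ρ₀ * |u₁| < r₀ := by nlinarith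
  have hρlam : 2 * (ρ₀ * (1 + |u₁|)) * (|m| + lam) ≤ lam * r / 2 := by
    have : ρ₀ ≤ lam * r / (4 * (1 + |u₁|) * (|m| + lam)) := min_le_right _ _
    rw [le_div_iff₀ (by positivity)] at this
    linarith
  -- The line with parameter `t` through the base point has offset `(t - t₁) * u₁`. There `ρ`
  -- vanishes, so it is the reference for all values of `ρ` on nearby lines.
  have hbase : ∀ t, |t - t₁| < ρ₀ → |((t - t₁) * u₁)| < r₀ ∧
      ρ (u₁, (t - t₁) * u₁ - t * u₁) = 0 := by
    intro t ht
    constructor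
    · rw [abs_mul]
      exact lt_of_le_of_lt (by gcongr) hρr2
    · rw [← hz]; congr 2; ring
  have hval : ∀ t p u, |t - t₁| < ρ₀ → |p| < ρ₀ → |u - u₁| < r₀ →
      |ρ (u, p - t * u) - lam * (u - u₁)| ≤ lam / 4 * |u - u₁| + lam * r / 2 := by
    intro t p u ht hp hu
    obtain ⟨g1, g2⟩ := hbase t ht
    have := (hest t p ((t - t₁) * u₁) u u₁ (ht.trans_le hρr1) (hp.trans_le hρr1) g1 hu
      (by simpa using hr₀)).2
    rw [g2, sub_zero] at this
    have hq : |p - (t - t₁) * u₁| ≤ ρ₀ * (1 + |u₁|) := by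
      refine (abs_sub _ _).trans ?_
      rw [abs_mul]
      have : |t - t₁| * |u₁| ≤ ρ₀ * |u₁| := by gcongr
      linarith
    have hmq : |m * (p - (t - t₁) * u₁)| ≤ |m| * (ρ₀ * (1 + |u₁|)) := by
      rw [abs_mul]; gcongr
    have e : ρ (u, p - t * u) - lam * (u - u₁)
        = (ρ (u, p - t * u) - lam * (u - u₁) - m * (p - (t - t₁) * u₁))
          + m * (p - (t - t₁) * u₁) := by ring
    rw [e]
    refine (abs_add_le _ _).trans ?_
    have h0 : 0 ≤ ρ₀ * (1 + |u₁|) := by positivity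
    have hm0 := abs_nonneg m
    nlinarith
  have hmono : ∀ t p u u', |t - t₁| < ρ₀ → |p| < ρ₀ → |u - u₁| < r₀ → |u' - u₁| < r₀ →
      |ρ (u, p - t * u) - ρ (u', p - t * u') - lam * (u - u')| ≤ lam / 4 * |u - u'| := by
    intro t p u u' ht hp hu hu'
    have := (hest t p p u u' (ht.trans_le hρr1) (hp.trans_le hρr1) (hp.trans_le hρr1) hu hu').2
    simpa using this
  -- The restrictions on `t` and `p` stand inside the existential so that the root can be chosen as
  -- a total function.
  have hzero : ∀ t p, ∃ u, |t - t₁| < ρ₀ → |p| < ρ₀ →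
      u ∈ Ioo (u₁ - r) (u₁ + r) ∧ ρ (u, p - t * u) = 0 := by
    intro t p
    by_cases htp : |t - t₁| < ρ₀ ∧ |p| < ρ₀
    · obtain ⟨ht, hp⟩ := htp
      have hcont : ContinuousOn (fun u => ρ (u, p - t * u)) (Icc (u₁ - r) (u₁ + r)) := by
        have : LipschitzOnWith (Real.toNNReal (5 / 4 * lam)) (fun u => ρ (u, p - t * u))
            (Icc (u₁ - r) (u₁ + r)) := by
          apply LipschitzOnWith.of_dist_le_mul
          intro u hu u' hu'
          rw [Real.coe_toNNReal _ (by positivity), Real.dist_eq, Real.dist_eq]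
          have := hmono t p u u' ht hp (by rw [abs_lt]; constructor <;> linarith [hu.1, hu.2])
            (by rw [abs_lt]; constructor <;> linarith [hu'.1, hu'.2])
          have k := abs_add_le (ρ (u, p - t * u) - ρ (u', p - t * u') - lam * (u - u'))
            (lam * (u - u'))
          rw [sub_add_cancel, abs_mul, abs_of_pos hpos] at k
          linarith
        exact this.continuousOn
      have v1 := hval t p (u₁ + r) ht hp (by simpa [abs_of_pos hr0] using hrr)
      have v2 := hval t p (u₁ - r) ht hp (by simpa [abs_of_pos hr0] using hrr)
      rw [show u₁ + r - u₁ = r by ring, abs_of_pos hr0, abs_le] at v1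
      rw [show u₁ - r - u₁ = -r by ring, abs_neg, abs_of_pos hr0, abs_le] at v2
      have hlr : 0 < lam * r := by positivity
      obtain ⟨u, hu, hu0⟩ := intermediate_value_Ioo (by linarith) hcont
        (show (0 : ℝ) ∈ Ioo _ _ from ⟨by linarith [v2.2], by linarith [v1.1]⟩)
      exact ⟨u, fun _ _ => ⟨hu, hu0⟩⟩
    · exact ⟨0, fun h1 h2 => absurd ⟨h1, h2⟩ htp⟩
  choose e he using hzero
  have habs : ∀ {u}, u ∈ Ioo (u₁ - r) (u₁ + r) → |u - u₁| < r₀ := fun {u} hu => by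
    rw [abs_lt]; constructor <;> linarith [hu.1, hu.2]
  -- The slope of the crossing point is that of the root of `lam * du + m * dp = 0`.
  refine ⟨r, hr0, ρ₀, hρ₀0, e, -m / lam, cp, cm, ?_, ?_⟩
  · intro t p ht hp
    obtain ⟨h1, h2⟩ := he t p ht hp
    refine ⟨h1, fun u hu => ?_⟩
    have hs := (hest t p p u u (ht.trans_le hρr1) (hp.trans_le hρr1) (hp.trans_le hρr1) (habs hu)
      (habs hu)).1
    have hm' := hmono t p u (e t p) ht hp (habs hu) (habs h1)
    rw [h2, sub_zero, abs_le] at hm'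
    constructor
    · intro hlt
      apply hs.1
      have : 0 < lam * (u - e t p) := mul_pos hpos (by linarith)
      rw [abs_of_pos (by linarith)] at hm'
      linarith [hm'.1]
    · intro hlt
      apply hs.2
      have : 0 < lam * (e t p - u) := mul_pos hpos (by linarith)
      rw [abs_of_neg (by linarith)] at hm'
      linarith [hm'.2]
  · intro η hη
    set C := 2 * (|m| + lam) / lam with hC
    have hC0 : 0 < C := by positivity
    obtain ⟨r₁, hr₁, hest₁⟩ := strictFDeriv_line_estimate hρ hside
      (η := min (lam / 4) (η * lam / (C + 1))) (by positivity)
    have hclose : ∀ t p, |t - t₁| < ρ₀ → |p| < ρ₀ →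
        |e t p - u₁| ≤ C * (|p| + |t - t₁| * |u₁|) := by
      intro t p ht hp
      obtain ⟨h1, h2⟩ := he t p ht hp
      obtain ⟨g1, g2⟩ := hbase t ht
      have := (hest t p ((t - t₁) * u₁) (e t p) u₁ (ht.trans_le hρr1) (hp.trans_le hρr1) g1
        (habs h1) (by simpa using hr₀)).2
      rw [g2, h2, sub_zero, zero_sub] at this
      have hq : |p - (t - t₁) * u₁| ≤ |p| + |t - t₁| * |u₁| := by
        rw [← abs_mul]; exact abs_sub _ _
      set q := p - (t - t₁) * u₁
      have k1 : lam * |e t p - u₁| ≤ |(-(lam * (e t p - u₁)) - m * q)| + |m| * |q| := by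
        have := abs_add_le (-(lam * (e t p - u₁)) - m * q) (m * q)
        rwa [sub_add_cancel, abs_neg, abs_mul, abs_mul, abs_of_pos hpos] at this
      have k2 : lam / 2 * |e t p - u₁| ≤ (|m| + lam) * |q| := by
        have := abs_nonneg (e t p - u₁)
        have := abs_nonneg q
        nlinarith
      calc |e t p - u₁| = (lam / 2 * |e t p - u₁|) * (2 / lam) := by field_simp
        _ ≤ ((|m| + lam) * |q|) * (2 / lam) := by gcongr
        _ = C * |q| := by rw [hC]; ring
        _ ≤ _ := by gcongr
    refine ⟨min ρ₀ (min r₁ (min η r₁ / (C * (1 + |u₁|) + 1))), by positivity,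
      fun t p ht hp => ?_⟩
    have ht0 := ht.trans_le (min_le_left _ _)
    have hp0 := hp.trans_le (min_le_left _ _)
    have ht1 := ht.trans_le ((min_le_right _ _).trans (min_le_left _ _))
    have hp1 := hp.trans_le ((min_le_right _ _).trans (min_le_left _ _))
    set w := min η r₁ / (C * (1 + |u₁|) + 1) with hw
    have ht2 : |t - t₁| < w := ht.trans_le ((min_le_right _ _).trans (min_le_right _ _))
    have hp2 : |p| < w := hp.trans_le ((min_le_right _ _).trans (min_le_right _ _))
    have hw0 : 0 < w := by positivity
    have hww : C * (w * (1 + |u₁|)) < min η r₁ := by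
      have : w * (C * (1 + |u₁|) + 1) = min η r₁ := by rw [hw]; field_simp
      linarith
    have hcl : ∀ p, |p| < ρ₀ → |p| < w → |e t p - u₁| < min η r₁ := by
      intro p hp hpw
      refine (hclose t p ht0 hp).trans_lt (lt_of_le_of_lt ?_ hww)
      have : |t - t₁| * |u₁| ≤ w * |u₁| := by gcongr
      gcongr
      linarith
    have c1 := hcl p hp0 hp2
    have c0 := hcl 0 (by simpa using hρ₀0) (by simpa using hw0)
    refine ⟨?_, c1.le.trans (min_le_left _ _)⟩
    obtain ⟨h1, h2⟩ := he t p ht0 hp0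
    obtain ⟨h3, h4⟩ := he t 0 ht0 (by simpa using hρ₀0)
    have key := (hest₁ t p 0 (e t p) (e t 0) ht1 hp1 (by simpa using hr₁)
      (c1.trans_le (min_le_right _ _)) (c0.trans_le (min_le_right _ _))).2
    rw [h2, h4, sub_zero, zero_sub, sub_zero, ← hlam, ← hm] at key
    set d := e t p - e t 0
    have kabs : |(-(lam * d) - m * p)| = |lam * d + m * p| := by
      rw [← abs_neg]; congr 1; ring
    rw [kabs] at key
    have key1 : |lam * d + m * p| ≤ lam / 4 * (|d| + |p|) :=
      key.trans (by gcongr; exact min_le_left _ _)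
    have key2 : |lam * d + m * p| ≤ η * lam / (C + 1) * (|d| + |p|) :=
      key.trans (by gcongr; exact min_le_right _ _)
    have hd : |d| ≤ C * |p| := by
      have k1 : lam * |d| ≤ |lam * d + m * p| + |m| * |p| := by
        have := abs_sub (lam * d + m * p) (m * p)
        rwa [add_sub_cancel_right, abs_mul, abs_mul, abs_of_pos hpos] at this
      have k2 : lam / 2 * |d| ≤ (|m| + lam) * |p| := by
        have := abs_nonneg d
        have := abs_nonneg p
        nlinarith
      calc |d| = (lam / 2 * |d|) * (2 / lam) := by field_simp
        _ ≤ ((|m| + lam) * |p|) * (2 / lam) := by gcongr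
        _ = C * |p| := by rw [hC]; ring
    have e1 : d - -m / lam * p = (lam * d + m * p) / lam := by field_simp; ring
    rw [e1, abs_div, abs_of_pos hpos, div_le_iff₀ hpos]
    calc _ ≤ η * lam / (C + 1) * (|d| + |p|) := key2
      _ ≤ η * lam / (C + 1) * ((C + 1) * |p|) := by gcongr; linarith
      _ = η * |p| * lam := by field_simp

lemma integrable_slice_weighted {D : Set (ℝ × ℝ)} (hD : MeasurableSet D) {F : ℝ × ℝ → ℝ}
    (hF : Continuous F) {w : ℝ → ℝ} (hw : Continuous w) (hwc : HasCompactSupport w) (t p : ℝ) :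
    Integrable (fun u => w u * D.indicator F (u, p - t * u)) := by
  have h1 : Integrable (fun u => w u * F (u, p - t * u)) := by
    apply Continuous.integrable_of_hasCompactSupport (by fun_prop)
    exact hwc.mul_right
  refine h1.mono ?_ (Eventually.of_forall fun u => ?_)
  · refine (hw.measurable.mul ?_).aestronglyMeasurable
    exact (hF.measurable.indicator hD).comp (by fun_prop)
  · rw [norm_mul, norm_mul]
    gcongr
    exact norm_indicator_le_norm_self _ _

/-- Inside the window the line is in `D` on each side of a single crossing point according to `cp`
and `cm`. Hence the integral is a combination of two integrals of a smooth function with that moving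
end point. -/
lemma LocalSide.hasSlope_weighted {D : Set (ℝ × ℝ)} {F : ℝ × ℝ → ℝ}
    (hF : ContDiff ℝ 1 F) {u₁ t₁ : ℝ} (h : LocalSide D (u₁, -t₁ * u₁) t₁) :
    ∃ r > 0, ∀ w : ℝ → ℝ, Continuous w → tsupport w ⊆ Ioo (u₁ - r) (u₁ + r) →
      HasSlope (fun t p => ∫ u, w u * D.indicator F (u, p - t * u)) t₁ := by
  classical
  obtain ⟨r, hr, ρ₀, hρ₀, e, μ, cp, cm, h1, h2⟩ := h.exists_crossing
  refine ⟨r, hr, fun w hw hws => ?_⟩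
  set a : ℝ := if cp then 1 else 0 with ha
  set b : ℝ := if cm then 1 else 0 with hb
  have hFc : Continuous F := hF.continuous
  have hdF : Differentiable ℝ F := hF.differentiable (by norm_num)
  have hfd : Continuous (fun z => fderiv ℝ F z) := hF.continuous_fderiv (by norm_num)
  set G : ℝ → ℝ → ℝ → ℝ := fun t p u => w u * F (u, p - t * u) with hG
  set G' : ℝ → ℝ → ℝ → ℝ := fun t p u => w u * fderiv ℝ F (u, p - t * u) (0, 1) with hG'
  have hGc : Continuous fun z : ℝ × ℝ × ℝ => G z.1 z.2.1 z.2.2 := by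
    simp only [hG]; fun_prop
  have hGc' : Continuous fun z : ℝ × ℝ × ℝ => G' z.1 z.2.1 z.2.2 := by
    simp only [hG']; fun_prop
  have hGd : ∀ t p u, HasDerivAt (fun p => G t p u) (G' t p u) p := by
    intro t p u
    have k1 : HasDerivAt (fun p : ℝ => ((u, p - t * u) : ℝ × ℝ)) ((0 : ℝ), (1 : ℝ)) p :=
      (hasDerivAt_const p u).prodMk ((hasDerivAt_id p).sub_const _)
    exact ((hdF (u, p - t * u)).hasFDerivAt.comp_hasDerivAt p k1).const_mul (w u)
  have hs : ∀ l, HasSlope (fun t p => ∫ u in l..e t p, G t p u) t₁ :=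
    HasSlope.intervalIntegral hGc hGc' hGd h2
  refine (((hs (u₁ - r)).const_mul b).add ((hs (u₁ + r)).const_mul (-a))).congr hρ₀ ?_
  intro t p ht hp
  obtain ⟨he, hu⟩ := h1 t p ht hp
  have hGi : ∀ x y, IntervalIntegrable (G t p) volume x y := fun x y =>
    Continuous.intervalIntegrable (hGc.comp (by fun_prop : Continuous fun u : ℝ => (t, p, u))) x y
  have hzero : ∀ u, u ∉ Ioo (u₁ - r) (u₁ + r) → w u = 0 := fun u hu =>
    image_eq_zero_of_notMem_tsupport fun hh => hu (hws hh)
  have e1 : ∫ u, w u * D.indicator F (u, p - t * u)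
      = ∫ u in (u₁ - r)..(u₁ + r), w u * D.indicator F (u, p - t * u) := by
    rw [intervalIntegral.integral_of_le (by linarith),
      setIntegral_eq_integral_of_forall_compl_eq_zero]
    intro u hu'
    rw [hzero u fun hh => hu' ⟨hh.1, hh.2.le⟩, zero_mul]
  have e2 : ∀ u ∈ Ioo (u₁ - r) (e t p), w u * D.indicator F (u, p - t * u) = b * G t p u := by
    intro u hu'
    have := (hu u ⟨hu'.1, hu'.2.trans he.2⟩).2 hu'.2
    simp only [indicator_apply, this, hG, hb]
    split_ifs <;> simp
  have e3 : ∀ u ∈ Ioo (e t p) (u₁ + r), w u * D.indicator F (u, p - t * u) = a * G t p u := by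
    intro u hu'
    have := (hu u ⟨he.1.trans hu'.1, hu'.2⟩).1 hu'.1
    simp only [indicator_apply, this, hG, ha]
    split_ifs <;> simp
  have i2 : IntervalIntegrable (fun u => w u * D.indicator F (u, p - t * u)) volume
      (u₁ - r) (e t p) := by
    rw [intervalIntegrable_iff_integrableOn_Ioo_of_le he.1.le]
    exact ((intervalIntegrable_iff_integrableOn_Ioo_of_le he.1.le).1
      ((hGi _ _).const_mul b)).congr_fun (fun u hu' => (e2 u hu').symm) measurableSet_Ioo
  have i3 : IntervalIntegrable (fun u => w u * D.indicator F (u, p - t * u)) volume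
      (e t p) (u₁ + r) := by
    rw [intervalIntegrable_iff_integrableOn_Ioo_of_le he.2.le]
    exact ((intervalIntegrable_iff_integrableOn_Ioo_of_le he.2.le).1
      ((hGi _ _).const_mul a)).congr_fun (fun u hu' => (e3 u hu').symm) measurableSet_Ioo
  rw [e1, ← intervalIntegral.integral_add_adjacent_intervals i2 i3,
    intervalIntegral.integral_of_le he.1.le, integral_Ioc_eq_integral_Ioo,
    setIntegral_congr_fun measurableSet_Ioo e2, intervalIntegral.integral_of_le he.2.le,
    integral_Ioc_eq_integral_Ioo, setIntegral_congr_fun measurableSet_Ioo e3,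
    integral_const_mul, integral_const_mul,
    ← integral_Ioc_eq_integral_Ioo, ← integral_Ioc_eq_integral_Ioo,
    ← intervalIntegral.integral_of_le he.1.le, ← intervalIntegral.integral_of_le he.2.le,
    intervalIntegral.integral_symm (e t p) (u₁ + r)]
  ring

/-- If the line `y = -t₁ u` is transversal to the boundary of `D`, then the integrals of a smooth
function on `D` over nearby lines have a slope. -/
lemma hasSlope_sliceInt_of_localSide {D : Set (ℝ × ℝ)} (hD : MeasurableSet D) {B : ℝ}
    (hB : ∀ x ∈ D, |x.1| ≤ B) {F : ℝ × ℝ → ℝ} (hF : ContDiff ℝ 1 F) {t₁ : ℝ}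
    (hloc : ∀ u, LocalSide D (u, -t₁ * u) t₁) : HasSlope (sliceInt (D.indicator F)) t₁ := by
  choose r hr hw using fun u => (hloc u).hasSlope_weighted hF
  obtain ⟨s, hs⟩ := (isCompact_Icc (a := -B) (b := B)).elim_finite_subcover
    (fun u => Ioo (u - r u) (u + r u)) (fun u => isOpen_Ioo) fun u _ =>
      mem_iUnion.2 ⟨u, by linarith [hr u], by linarith [hr u]⟩
  -- A partition of unity along the line reduces the statement to finitely many windows with one
  -- crossing each.
  obtain ⟨f, hf⟩ := PartitionOfUnity.exists_isSubordinate (isClosed_Icc (a := -B) (b := B))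
    (fun i : s => Ioo ((i : ℝ) - r i) (i + r i)) (fun i => isOpen_Ioo) (by
      intro x hx
      obtain ⟨i, hi, hxi⟩ := mem_iUnion₂.1 (hs hx)
      exact mem_iUnion.2 ⟨⟨i, hi⟩, hxi⟩)
  have hslope : HasSlope (fun t p => ∑ i ∈ Finset.univ, ∫ u, f i u * D.indicator F (u, p - t * u))
      t₁ := HasSlope.sum _ fun i _ => hw i (f i) (f i).continuous (hf i)
  refine hslope.congr one_pos fun t p _ _ => ?_
  rw [← integral_finsetSum]
  · unfold sliceInt
    congr 1
    ext u
    rw [← Finset.sum_mul]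
    by_cases hu : (u, p - t * u) ∈ D
    · have := f.sum_eq_one (x := u) (abs_le.1 (hB _ hu))
      rw [finsum_eq_sum_of_fintype] at this
      rw [this, one_mul]
    · rw [indicator_of_notMem hu, mul_zero]
  · intro i _
    refine integrable_slice_weighted hD hF.continuous (f i).continuous ?_ t p
    exact HasCompactSupport.of_support_subset_isCompact (isCompact_Icc (a := (i : ℝ) - r i)
      (b := i + r i)) ((subset_tsupport _).trans ((hf i).trans Ioo_subset_Icc_self))

/-! ### Local sides of sets bounded by curves. -/

/-- Side constancy across a curve. -/
lemma eventually_side_of_chart {D : Set (ℝ × ℝ)} {z : ℝ × ℝ} {Ψ : ℝ × ℝ → ℝ × ℝ}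
    {e ρ : ℝ × ℝ → ℝ} (hρz : ρ z = 0) (hΨ : ∀ᶠ w in 𝓝 (e z, (0 : ℝ)), ContinuousAt Ψ w)
    (hinv : ∀ᶠ x in 𝓝 z, Ψ (e x, ρ x) = x) (he : ContinuousAt e z) (hρ : ContinuousAt ρ z)
    (hfr : ∀ᶠ w in 𝓝 (e z, (0 : ℝ)), w.2 ≠ 0 → Ψ w ∉ frontier D) :
    ∃ cp cm : Prop, ∀ᶠ x in 𝓝 z, (0 < ρ x → (x ∈ D ↔ cp)) ∧ (ρ x < 0 → (x ∈ D ↔ cm)) := by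
  obtain ⟨d, hd, hQ⟩ := Metric.eventually_nhds_iff_ball.1 (hΨ.and hfr)
  -- A half ball in the chart is convex, so its image is connected. Missing the frontier, the image
  -- lies either in `D` or in the complement.
  have half : ∀ I : Set ℝ, Convex ℝ I → (∀ v ∈ I, v ≠ 0) →
      ∃ c : Prop, ∀ w ∈ Metric.ball (e z, (0 : ℝ)) d, w.2 ∈ I → (Ψ w ∈ D ↔ c) := by
    intro I hI hI0
    set Q := Metric.ball (e z, (0 : ℝ)) d ∩ {w | w.2 ∈ I} with hQdef
    have hconv : Convex ℝ Q := (convex_ball _ _).inter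
      (hI.linear_preimage (LinearMap.snd ℝ ℝ ℝ))
    have hpre : IsPreconnected (Ψ '' Q) := hconv.isPreconnected.image _ fun w hw =>
      (hQ w hw.1).1.continuousWithinAt
    have hdisj : ∀ x ∈ Ψ '' Q, x ∉ frontier D := by
      rintro _ ⟨w, hw, rfl⟩
      exact (hQ w hw.1).2 (hI0 _ hw.2)
    by_cases hne : (Ψ '' Q ∩ D).Nonempty
    · refine ⟨True, fun w hw hwI => ?_⟩
      rw [iff_true]
      by_contra hnot
      obtain ⟨x, hx1, hx2⟩ := hne
      have hmem := mem_image_of_mem Ψ (show w ∈ Q from ⟨hw, hwI⟩)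
      obtain ⟨y, -, hy1, hy2⟩ := hpre (interior D) (closure D)ᶜ isOpen_interior
        isClosed_closure.isOpen_compl
        (fun y hy => by
          by_contra hcon
          rw [mem_union, not_or, mem_compl_iff, not_not] at hcon
          exact hdisj y hy ⟨hcon.2, hcon.1⟩)
        ⟨x, hx1, by
          by_contra hcon
          exact hdisj x hx1 ⟨subset_closure hx2, hcon⟩⟩
        ⟨Ψ w, hmem, fun hcl => hdisj _ hmem ⟨hcl, fun hint => hnot (interior_subset hint)⟩⟩
      exact hy2 (interior_subset_closure hy1)
    · refine ⟨False, fun w hw hwI => ?_⟩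
      rw [iff_false]
      exact fun hmem => hne ⟨Ψ w, mem_image_of_mem _ ⟨hw, hwI⟩, hmem⟩
  obtain ⟨cp, hcp⟩ := half (Ioi 0) (convex_Ioi 0) fun v hv => (mem_Ioi.1 hv).ne'
  obtain ⟨cm, hcm⟩ := half (Iio 0) (convex_Iio 0) fun v hv => (mem_Iio.1 hv).ne
  refine ⟨cp, cm, ?_⟩
  have hball : ∀ᶠ x in 𝓝 z, (e x, ρ x) ∈ Metric.ball (e z, (0 : ℝ)) d := by
    have : ContinuousAt (fun x => (e x, ρ x)) z := he.prodMk hρ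
    apply this
    dsimp only
    rw [hρz]
    exact Metric.ball_mem_nhds _ hd
  filter_upwards [hball, hinv] with x hx hxi
  have h1 := hcp _ hx
  have h2 := hcm _ hx
  rw [hxi] at h1 h2
  exact ⟨h1, h2⟩

lemma LocalSide.of_ne {D : Set (ℝ × ℝ)} {z : ℝ × ℝ} {t : ℝ} {ρ : ℝ × ℝ → ℝ}
    {ρ' : ℝ × ℝ →L[ℝ] ℝ} (hρ : HasStrictFDerivAt ρ ρ' z) (hz : ρ z = 0) (hne : ρ' (1, -t) ≠ 0)
    (h : ∃ cp cm : Prop, ∀ᶠ x in 𝓝 z, (0 < ρ x → (x ∈ D ↔ cp)) ∧ (ρ x < 0 → (x ∈ D ↔ cm))) :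
    LocalSide D z t := by
  rcases hne.lt_or_gt with h1 | h1
  · obtain ⟨cp, cm, h⟩ := h
    refine ⟨fun x => -ρ x, -ρ', hρ.fun_neg, by simp [hz], by simpa using h1, cm, cp, ?_⟩
    filter_upwards [h] with x hx
    exact ⟨fun h0 => hx.2 (by linarith), fun h0 => hx.1 (by linarith)⟩
  · exact ⟨ρ, ρ', hρ, hz, h1, h⟩

/-- Away from the frontier membership is locally constant, so any function increasing along the line
will do, with the same answer on both sides. -/
lemma localSide_of_notMem_frontier {D : Set (ℝ × ℝ)} {z : ℝ × ℝ} (hz : z ∉ frontier D) (t : ℝ) :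
    LocalSide D z t := by
  refine ⟨fun x => x.1 - z.1, ContinuousLinearMap.fst ℝ ℝ ℝ,
    (hasStrictFDerivAt_fst (p := z)).sub_const z.1, by simp, by simp, z ∈ D, z ∈ D, ?_⟩
  have : ∀ᶠ x in 𝓝 z, (x ∈ D ↔ z ∈ D) := by
    by_cases h : z ∈ closure D
    · have hint : z ∈ interior D := by
        by_contra hcon
        exact hz ⟨h, hcon⟩
      filter_upwards [mem_interior_iff_mem_nhds.1 hint] with x hx
      simp [hx, interior_subset hint]
    · filter_upwards [isClosed_closure.isOpen_compl.mem_nhds h] with x hx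
      have h1 : x ∉ D := fun hh => hx (subset_closure hh)
      have h2 : z ∉ D := fun hh => h (subset_closure hh)
      simp [h1, h2]
  filter_upwards [this] with x hx
  exact ⟨fun _ => hx, fun _ => hx⟩

lemma localSide_of_graph {D : Set (ℝ × ℝ)} {z : ℝ × ℝ} {t : ℝ} {g : ℝ → ℝ}
    (hg : ContDiff ℝ 1 g) (hz : z.2 = g z.1) (ht : deriv g z.1 + t ≠ 0)
    (h : ∃ cp cm : Prop, ∀ᶠ x in 𝓝 z,
      (0 < x.2 - g x.1 → (x ∈ D ↔ cp)) ∧ (x.2 - g x.1 < 0 → (x ∈ D ↔ cm))) :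
    LocalSide D z t := by
  have hd : HasStrictDerivAt g (deriv g z.1) z.1 :=
    hg.contDiffAt.hasStrictDerivAt (by norm_num)
  have h1 : HasStrictFDerivAt (fun x : ℝ × ℝ => x.2 - g x.1)
      (ContinuousLinearMap.snd ℝ ℝ ℝ - deriv g z.1 • ContinuousLinearMap.fst ℝ ℝ ℝ) z :=
    (hasStrictFDerivAt_snd (p := z)).fun_sub
      (hd.comp_hasStrictFDerivAt z (hasStrictFDerivAt_fst (p := z)))
  refine LocalSide.of_ne h1 (by rw [hz, sub_self]) ?_ h
  simp only [sub_apply, smul_apply,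
    ContinuousLinearMap.coe_fst', ContinuousLinearMap.coe_snd', smul_eq_mul, mul_one]
  intro h0
  exact ht (by linarith)

/-- Transversality lets the offset `y + t x` serve as a local parameter of the arc. The arc is
straightened by using as second coordinate the difference of abscissas between a point and the arc
point with the same offset. By `hfr`, the frontier near `z` lies on this one branch of the arc. -/
lemma localSide_of_arc {D : Set (ℝ × ℝ)} {z : ℝ × ℝ} {t τ₀ : ℝ} {γ : ℝ → ℝ × ℝ}
    (hγ : ContDiff ℝ 1 γ) (hz : γ τ₀ = z) (hne : (deriv γ τ₀).2 + t * (deriv γ τ₀).1 ≠ 0)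
    (hfr : ∀ N ∈ 𝓝 τ₀, ∀ᶠ x in 𝓝 z, x ∈ frontier D → ∃ τ ∈ N, γ τ = x) :
    LocalSide D z t := by
  have hd : HasStrictDerivAt γ (deriv γ τ₀) τ₀ := hγ.contDiffAt.hasStrictDerivAt (by norm_num)
  have hd1 : HasStrictDerivAt (fun τ => (γ τ).1) (deriv γ τ₀).1 τ₀ :=
    (ContinuousLinearMap.fst ℝ ℝ ℝ).hasStrictFDerivAt.comp_hasStrictDerivAt τ₀ hd
  have hd2 : HasStrictDerivAt (fun τ => (γ τ).2) (deriv γ τ₀).2 τ₀ :=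
    (ContinuousLinearMap.snd ℝ ℝ ℝ).hasStrictFDerivAt.comp_hasStrictDerivAt τ₀ hd
  set ψ : ℝ → ℝ := fun τ => (γ τ).2 + t * (γ τ).1 with hψ
  have hdψ : HasStrictDerivAt ψ ((deriv γ τ₀).2 + t * (deriv γ τ₀).1) τ₀ :=
    hd2.fun_add (hd1.const_mul t)
  set R := (hdψ.hasStrictFDerivAt_equiv hne).toOpenPartialHomeomorph ψ with hR
  have hRψ : ∀ τ, R τ = ψ τ := fun τ => rfl
  have hτs : τ₀ ∈ R.source := (hdψ.hasStrictFDerivAt_equiv hne).mem_toOpenPartialHomeomorph_source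
  have hinvd : HasStrictDerivAt R.symm ((deriv γ τ₀).2 + t * (deriv γ τ₀).1)⁻¹ (ψ τ₀) :=
    hdψ.to_localInverse hne
  have hinv0 : R.symm (ψ τ₀) = τ₀ := by rw [← hRψ]; exact R.left_inv hτs
  have hψz : z.2 + t * z.1 = ψ τ₀ := by rw [hψ, ← hz]
  set e : ℝ × ℝ → ℝ := fun x => x.2 + t * x.1 with he
  have hed : HasStrictFDerivAt e
      (ContinuousLinearMap.snd ℝ ℝ ℝ + t • ContinuousLinearMap.fst ℝ ℝ ℝ) z :=
    (hasStrictFDerivAt_snd (p := z)).fun_add ((hasStrictFDerivAt_fst (p := z)).const_mul t)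
  have hez : e z = ψ τ₀ := hψz
  have hcompd : HasStrictDerivAt (fun p => (γ (R.symm p)).1)
      ((deriv γ τ₀).1 * ((deriv γ τ₀).2 + t * (deriv γ τ₀).1)⁻¹) (e z) := by
    rw [hez]
    rw [← hinv0] at hd1
    have := HasStrictDerivAt.comp (ψ τ₀) hd1 hinvd
    rw [hinv0] at this
    exact this
  set ρ : ℝ × ℝ → ℝ := fun x => x.1 - (γ (R.symm (e x))).1 with hρ
  have hρd := (hasStrictFDerivAt_fst (𝕜 := ℝ) (p := z)).fun_sub
    (hcompd.comp_hasStrictFDerivAt z hed)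
  have hρz : ρ z = 0 := by
    simp only [hρ]; rw [hez, hinv0, hz, sub_self]
  -- Along `(1, -t)` the offset `e` is constant, so the derivative of `ρ` in that direction is `1`.
  refine LocalSide.of_ne (ρ := ρ) hρd hρz (by simp) ?_
  have htgt : R.target ∈ 𝓝 (ψ τ₀) := R.open_target.mem_nhds (by rw [← hRψ]; exact R.map_source hτs)
  set Ψ : ℝ × ℝ → ℝ × ℝ := fun w =>
    ((γ (R.symm w.1)).1 + w.2, w.1 - t * ((γ (R.symm w.1)).1 + w.2)) with hΨ
  have hΨc : ∀ w : ℝ × ℝ, w.1 ∈ R.target → ContinuousAt Ψ w := by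
    intro w hw
    have h1 : ContinuousAt (fun w : ℝ × ℝ => R.symm w.1) w :=
      ContinuousAt.comp (f := Prod.fst) (R.continuousAt_symm hw) continuousAt_fst
    have h2 : ContinuousAt (fun w : ℝ × ℝ => γ (R.symm w.1)) w :=
      ContinuousAt.comp (f := fun w : ℝ × ℝ => R.symm w.1) hγ.continuous.continuousAt h1
    have h3 : ContinuousAt (fun w : ℝ × ℝ => (γ (R.symm w.1)).1 + w.2) w :=
      h2.fst.add continuousAt_snd
    exact h3.prodMk (continuousAt_fst.sub (continuousAt_const.mul h3))
  have hev : ∀ᶠ w : ℝ × ℝ in 𝓝 (e z, (0 : ℝ)), w.1 ∈ R.target :=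
    continuousAt_fst (by dsimp only; rw [hez]; exact htgt)
  have hΨz : Ψ (e z, 0) = z := by
    simp only [hΨ]
    rw [hez, hinv0, hz, add_zero, ← hψz]
    ext <;> simp
  refine eventually_side_of_chart (Ψ := Ψ) (e := e) hρz (hev.mono fun w hw => hΨc w hw) ?_
    hed.continuousAt hρd.continuousAt ?_
  · refine Eventually.of_forall fun x => ?_
    simp only [hΨ, hρ, he]
    ext <;> simp
  · have hc : Tendsto Ψ (𝓝 (e z, (0 : ℝ))) (𝓝 z) := by
      have := hΨc (e z, 0) (by dsimp only; rw [hez]; exact mem_of_mem_nhds htgt)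
      rw [ContinuousAt, hΨz] at this
      exact this
    filter_upwards [hc.eventually (hfr _ (R.open_source.mem_nhds hτs))] with w hw hw2 hmem
    obtain ⟨τ, hτ, hτw⟩ := hw hmem
    have h1 : ψ τ = w.1 := by
      simp only [hψ]
      rw [hτw]
      simp only [hΨ]
      ring
    have h2 : R.symm w.1 = τ := by rw [← h1, ← hRψ]; exact R.left_inv hτ
    have h3 : (γ τ).1 = (γ τ).1 + w.2 := by
      conv_lhs => rw [hτw]
      simp only [hΨ]
      rw [h2]
    exact hw2 (by linarith)

/-! ### Strictly convex graphs. -/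

/-- A curved graph over its tangent line at the origin. -/
structure IsCurvedGraph (g : ℝ → ℝ) : Prop where
  smooth : ContDiff ℝ ∞ g
  map_zero : g 0 = 0
  deriv_zero : deriv g 0 = 0
  curvature_pos : 0 < deriv (deriv g) 0

/-- A radius on which the second derivative of `g` is pinched between `c` and `C`. -/
structure IsCurvedOn (g : ℝ → ℝ) (r c C : ℝ) : Prop where
  graph : IsCurvedGraph g
  radius_pos : 0 < r
  lower_pos : 0 < c
  lower_le_upper : c ≤ C
  lower : ∀ u v, |u| ≤ r → |v| ≤ r → u ≤ v → c * (v - u) ≤ deriv g v - deriv g u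
  upper : ∀ u v, |u| ≤ r → |v| ≤ r → u ≤ v → deriv g v - deriv g u ≤ C * (v - u)

lemma IsCurvedGraph.hasDerivAt {g : ℝ → ℝ} (hg : IsCurvedGraph g) (u : ℝ) :
    HasDerivAt g (deriv g u) u :=
  (hg.smooth.differentiable (by simp) u).hasDerivAt

lemma IsCurvedGraph.contDiff_one {g : ℝ → ℝ} (hg : IsCurvedGraph g) : ContDiff ℝ 1 g :=
  hg.smooth.of_le (by exact_mod_cast le_top)

lemma IsCurvedGraph.contDiff_deriv {g : ℝ → ℝ} (hg : IsCurvedGraph g) : ContDiff ℝ ∞ (deriv g) :=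
  (contDiff_infty_iff_deriv.1 hg.smooth).2

lemma IsCurvedGraph.exists_isCurvedOn {g : ℝ → ℝ} (hg : IsCurvedGraph g) :
    ∃ r, IsCurvedOn g r (deriv (deriv g) 0 / 2) (2 * deriv (deriv g) 0) := by
  have hpos := hg.curvature_pos
  have hc : Continuous (deriv (deriv g)) := hg.contDiff_deriv.continuous_deriv (by simp)
  have h1 : ∀ᶠ u in 𝓝 (0 : ℝ), deriv (deriv g) 0 / 2 < deriv (deriv g) u ∧
      deriv (deriv g) u < 2 * deriv (deriv g) 0 :=
    (hc.continuousAt.eventually (lt_mem_nhds (by linarith))).and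
      (hc.continuousAt.eventually (gt_mem_nhds (by linarith)))
  obtain ⟨r, hr, h2⟩ := Metric.eventually_nhds_iff.1 h1
  have hd : Differentiable ℝ (deriv g) := hg.contDiff_deriv.differentiable (by simp)
  have hball : ∀ u v w : ℝ, |u| ≤ r / 2 → |v| ≤ r / 2 → w ∈ Ioo u v → dist w 0 < r := by
    intro u v w hu hv hw
    rw [abs_le] at hu hv
    rw [dist_zero_right, Real.norm_eq_abs, abs_lt]
    constructor <;> linarith [hw.1, hw.2, hu.1, hv.2]
  refine ⟨r / 2, hg, by positivity, by positivity, by linarith, fun u v hu hv huv => ?_,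
    fun u v hu hv huv => ?_⟩
  all_goals
    rcases huv.eq_or_lt with rfl | hlt
    · simp
    obtain ⟨w, hw, hw'⟩ := exists_deriv_eq_slope (deriv g) hlt hd.continuous.continuousOn
      hd.differentiableOn
    have := h2 (hball u v w hu hv hw)
    rw [eq_div_iff (by linarith)] at hw'
    rw [← hw']
    apply mul_le_mul_of_nonneg_right _ (by linarith)
    linarith [this.1, this.2]

namespace IsCurvedOn

variable {g : ℝ → ℝ} {r c C : ℝ}

/-- The graph lies above the tangent at `u`, with quadratic lower bound. -/
lemma quadratic_lower (h : IsCurvedOn g r c C) {u v : ℝ} (hu : |u| ≤ r) (hv : |v| ≤ r) :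
    c / 2 * (v - u) ^ 2 ≤ g v - g u - deriv g u * (v - u) := by
  have hmem : ∀ w, w ∈ uIcc u v → |w| ≤ r := by
    intro w hw
    rw [abs_le] at *
    rcases mem_uIcc.1 hw with k | k <;> constructor <;> linarith [k.1, k.2]
  set f : ℝ → ℝ := fun w => g w - g u - deriv g u * (w - u) - c / 2 * (w - u) ^ 2 with hf
  have hd : ∀ w, HasDerivAt f (deriv g w - deriv g u - c * (w - u)) w := by
    intro w
    have k1 := ((h.graph.hasDerivAt w).sub_const (g u)).fun_sub
      (((hasDerivAt_id w).sub_const u).const_mul (deriv g u))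
    have k2 := k1.fun_sub ((((hasDerivAt_id w).sub_const u).pow 2).const_mul (c / 2))
    refine k2.congr_deriv ?_
    simp
    ring
  have hcont : Continuous f := continuous_iff_continuousAt.2 fun w => (hd w).continuousAt
  have hfu : f u = 0 := by simp [hf]
  have key : 0 ≤ f v := by
    rcases lt_trichotomy u v with huv | rfl | huv
    · obtain ⟨w, hw, hw'⟩ := exists_hasDerivAt_eq_slope f _ huv hcont.continuousOn fun w _ => hd w
      rw [eq_div_iff (by linarith), hfu, sub_zero] at hw'
      rw [← hw']
      have := h.lower u w hu (hmem w (Ioo_subset_Icc_self.trans Icc_subset_uIcc hw)) hw.1.le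
      apply mul_nonneg <;> linarith
    · exact hfu.ge
    · obtain ⟨w, hw, hw'⟩ := exists_hasDerivAt_eq_slope f _ huv hcont.continuousOn fun w _ => hd w
      rw [eq_div_iff (by linarith), hfu, zero_sub] at hw'
      have := h.lower w u (hmem w (Ioo_subset_Icc_self.trans Icc_subset_uIcc' hw)) hu hw.2.le
      have k : (deriv g w - deriv g u - c * (w - u)) * (u - v) ≤ 0 :=
        mul_nonpos_of_nonpos_of_nonneg (by linarith) (by linarith)
      linarith
  simp only [hf] at key
  linarith

lemma lower_sq (h : IsCurvedOn g r c C) {u : ℝ} (hu : |u| ≤ r) : c / 2 * u ^ 2 ≤ g u := by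
  have := h.quadratic_lower (u := 0) (v := u) (by simpa using h.radius_pos.le) hu
  rw [h.graph.map_zero, h.graph.deriv_zero] at this
  simpa using this

end IsCurvedOn

lemma eventually_side_of_graph {D : Set (ℝ × ℝ)} {g : ℝ → ℝ} (hg : Continuous g) {z : ℝ × ℝ}
    (hz : z.2 = g z.1) (hfr : ∀ᶠ x in 𝓝 z, x ∈ frontier D → x.2 = g x.1) :
    ∃ cp cm : Prop, ∀ᶠ x in 𝓝 z,
      (0 < x.2 - g x.1 → (x ∈ D ↔ cp)) ∧ (x.2 - g x.1 < 0 → (x ∈ D ↔ cm)) := by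
  set Ψ : ℝ × ℝ → ℝ × ℝ := fun w => (w.1, g w.1 + w.2) with hΨ
  have hΨc : Continuous Ψ := by fun_prop
  refine eventually_side_of_chart (Ψ := Ψ) (e := Prod.fst) (ρ := fun x => x.2 - g x.1)
    (by rw [hz, sub_self]) (Eventually.of_forall fun w => hΨc.continuousAt)
    (Eventually.of_forall fun x => by simp [hΨ]) continuousAt_fst
    (by fun_prop) ?_
  have hc : Tendsto Ψ (𝓝 (z.1, (0 : ℝ))) (𝓝 z) := by
    have := hΨc.tendsto (z.1, 0)
    simpa [hΨ, ← hz] using this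
  filter_upwards [hc.eventually hfr] with w hw hw2 hmem
  have := hw hmem
  simp only [hΨ] at this
  exact hw2 (by linarith)

/-! ### Pieces in normal coordinates: transversality away from the origin. -/

/-- A smooth piece in coordinates in which the tangent line at the point of interest is the
horizontal axis; that line is not tangent to the boundary away from the origin. -/
structure IsNormalPiece (g : ℝ → ℝ) (D : Set (ℝ × ℝ)) (F : ℝ × ℝ → ℝ) : Prop where
  isOpen : IsOpen D
  bounded : ∃ B, ∀ x ∈ D, |x.1| ≤ B
  contDiff : ContDiff ℝ 1 F
  compactSupport : HasCompactSupport F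
  graph : ∀ᶠ x in 𝓝 (0 : ℝ × ℝ), x ∈ frontier D → x.2 = g x.1
  boundary : ∃ (m : ℕ) (γ : Fin m → ℝ → ℝ × ℝ),
    (∀ i, ContDiff ℝ 1 (γ i)) ∧ (∀ i, InjOn (γ i) (Icc (0 : ℝ) 1)) ∧
    (∀ i j, i ≠ j → ∀ s ∈ Icc (0 : ℝ) 1, ∀ t ∈ Icc (0 : ℝ) 1, γ i s = γ j t →
      (s = 0 ∨ s = 1) ∧ (t = 0 ∨ t = 1)) ∧
    frontier D = ⋃ i, γ i '' Icc (0 : ℝ) 1 ∧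
    ∀ i, ∀ s ∈ Icc (0 : ℝ) 1, (γ i s).2 = 0 → γ i s ≠ 0 → (deriv (γ i) s).2 ≠ 0

lemma exists_pos_forall_of_finite {ι : Type*} [Finite ι] {P : ι → ℝ → Prop}
    (hmono : ∀ i δ δ', 0 < δ → δ ≤ δ' → P i δ' → P i δ) (h : ∀ i, ∃ δ > 0, P i δ) :
    ∃ δ > 0, ∀ i, P i δ := by
  have h1 : ∀ i, ∀ᶠ δ in 𝓝[>] (0 : ℝ), P i δ := by
    intro i
    obtain ⟨δ, hδ, hP⟩ := h i
    filter_upwards [self_mem_nhdsWithin, nhdsWithin_le_nhds (eventually_le_nhds hδ)] with x hx hx2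
    exact hmono i x δ hx hx2 hP
  obtain ⟨δ, hδ, h0⟩ := ((eventually_all.2 h1).and self_mem_nhdsWithin).exists
  exact ⟨δ, h0, hδ⟩

/-- On the set `N`, an arc avoids the lines of slope less than `δ` near the origin, or crosses them
transversally, or stays near the origin. -/
def ArcAlternative (γ : ℝ → ℝ × ℝ) (r₀ : ℝ) (N : Set ℝ) (δ : ℝ) : Prop :=
  (∀ τ ∈ N, ∀ t, |t| < δ → δ ≤ |(γ τ).2 + t * (γ τ).1|) ∨
  (∀ τ ∈ N, ∀ t, |t| < δ → δ ≤ |(deriv γ τ).2 + t * (deriv γ τ).1|) ∨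
  ∀ τ ∈ N, γ τ ∈ Metric.ball (0 : ℝ × ℝ) r₀

lemma ArcAlternative.mono {γ : ℝ → ℝ × ℝ} {r₀ δ δ' : ℝ} {N : Set ℝ} (hδ : δ ≤ δ')
    (h : ArcAlternative γ r₀ N δ') : ArcAlternative γ r₀ N δ := by
  rcases h with h | h | h
  · exact Or.inl fun τ hτ t ht => hδ.trans (h τ hτ t (ht.trans_le hδ))
  · exact Or.inr (Or.inl fun τ hτ t ht => hδ.trans (h τ hτ t (ht.trans_le hδ)))
  · exact Or.inr (Or.inr h)

lemma exists_nonvanishing_near {h : ℝ → ℝ × ℝ} (hh : Continuous h) {τ₀ : ℝ} (h0 : (h τ₀).2 ≠ 0) :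
    ∃ δ > 0, ∀ τ ∈ Ioo (τ₀ - δ) (τ₀ + δ), ∀ t, |t| < δ → δ ≤ |(h τ).2 + t * (h τ).1| := by
  have hc : Continuous fun z : ℝ × ℝ => |(h z.1).2 + z.2 * (h z.1).1| := by fun_prop
  have h1 : |(h τ₀).2| / 2 < |(h τ₀).2 + 0 * (h τ₀).1| := by
    rw [zero_mul, add_zero]
    exact half_lt_self (abs_pos.2 h0)
  obtain ⟨δ, hδ, h2⟩ := Metric.eventually_nhds_iff.1
    (hc.continuousAt (x := (τ₀, (0 : ℝ))) (lt_mem_nhds h1))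
  refine ⟨min δ (|(h τ₀).2| / 2), lt_min hδ (half_pos (abs_pos.2 h0)), fun τ hτ t ht => ?_⟩
  have := h2 (y := (τ, t)) (by
    rw [Prod.dist_eq, Real.dist_eq, Real.dist_eq]
    have hm := min_le_left δ (|(h τ₀).2| / 2)
    apply max_lt
    · rw [abs_lt]; constructor <;> dsimp only <;> linarith [hτ.1, hτ.2]
    · dsimp only; rw [sub_zero]; exact ht.trans_le hm)
  exact (min_le_right _ _).trans (le_of_lt this)

/-- By continuity it suffices to look at `τ₀`: the point is the origin, or it lies on the axis with
a tangent that is not horizontal, or it lies off the axis. -/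
lemma exists_arcAlternative {γ : ℝ → ℝ × ℝ} (hγ : ContDiff ℝ 1 γ) {r₀ τ₀ : ℝ} (hr₀ : 0 < r₀)
    (h : (γ τ₀).2 = 0 → γ τ₀ ≠ 0 → (deriv γ τ₀).2 ≠ 0) :
    ∃ δ > 0, ArcAlternative γ r₀ (Ioo (τ₀ - δ) (τ₀ + δ)) δ := by
  by_cases h0 : γ τ₀ = 0
  · have h1 : ∀ᶠ τ in 𝓝 τ₀, γ τ ∈ Metric.ball (0 : ℝ × ℝ) r₀ :=
      hγ.continuous.continuousAt (by rw [h0]; exact Metric.ball_mem_nhds _ hr₀)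
    obtain ⟨δ, hδ, h2⟩ := Metric.eventually_nhds_iff.1 h1
    refine ⟨δ, hδ, Or.inr (Or.inr fun τ hτ => h2 ?_)⟩
    rw [Real.dist_eq, abs_lt]
    constructor <;> linarith [hτ.1, hτ.2]
  by_cases h1 : (γ τ₀).2 = 0
  · obtain ⟨δ, hδ, h2⟩ := exists_nonvanishing_near (hγ.continuous_deriv le_rfl) (h h1 h0)
    exact ⟨δ, hδ, Or.inr (Or.inl h2)⟩
  · obtain ⟨δ, hδ, h2⟩ := exists_nonvanishing_near hγ.continuous h1
    exact ⟨δ, hδ, Or.inl h2⟩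

/-- A finite cover of an arc by pieces with uniform alternatives. -/
lemma exists_arc_cover {γ : ℝ → ℝ × ℝ} (hγ : ContDiff ℝ 1 γ) {r₀ : ℝ} (hr₀ : 0 < r₀)
    (h : ∀ s ∈ Icc (0 : ℝ) 1, (γ s).2 = 0 → γ s ≠ 0 → (deriv γ s).2 ≠ 0) :
    ∃ (T : Finset ℝ) (w : ℝ → ℝ), Icc (0 : ℝ) 1 ⊆ ⋃ τ ∈ T, Ioo (τ - w τ) (τ + w τ) ∧
      ∃ δ > 0, ∀ τ ∈ T, ArcAlternative γ r₀ (Ioo (τ - w τ) (τ + w τ)) δ := by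
  have h1 : ∀ τ : ℝ, ∃ δ > 0, τ ∈ Icc (0 : ℝ) 1 →
      ArcAlternative γ r₀ (Ioo (τ - δ) (τ + δ)) δ := by
    intro τ
    by_cases hτ : τ ∈ Icc (0 : ℝ) 1
    · obtain ⟨δ, hδ, h2⟩ := exists_arcAlternative hγ hr₀ (h τ hτ)
      exact ⟨δ, hδ, fun _ => h2⟩
    · exact ⟨1, one_pos, fun h => absurd h hτ⟩
  choose w hw hA using h1
  obtain ⟨T, hT, hcov⟩ := (isCompact_Icc (a := (0 : ℝ)) (b := 1)).elim_nhds_subcover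
    (fun τ => Ioo (τ - w τ) (τ + w τ)) fun τ _ =>
      Ioo_mem_nhds (by linarith [hw τ]) (by linarith [hw τ])
  refine ⟨T, w, hcov, ?_⟩
  obtain ⟨δ, hδ, h3⟩ := exists_pos_forall_of_finite
    (P := fun (τ : T) δ => ArcAlternative γ r₀ (Ioo ((τ : ℝ) - w τ) (τ + w τ)) δ)
    (fun τ δ δ' _ hle hh => hh.mono hle) fun τ => ⟨w τ, hw τ, hA τ (hT τ τ.2)⟩
  exact ⟨δ, hδ, fun τ hτ => h3 ⟨τ, hτ⟩⟩

/-- Where an arc is transversal to lines, it meets a thin strip in a short interval. -/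
lemma exists_short_interval {γ : ℝ → ℝ × ℝ} (hγ : ContDiff ℝ 1 γ) {a b δ L : ℝ} (hδ : 0 < δ)
    (hL : ∀ τ ∈ Ioo a b ∩ Icc 0 1, ∀ τ' ∈ Ioo a b ∩ Icc 0 1,
      |(γ τ).1 - (γ τ').1| ≤ L * |τ - τ'|) (hL0 : 0 ≤ L) {t : ℝ}
    (h : ∀ τ ∈ Ioo a b, δ ≤ |(deriv γ τ).2 + t * (deriv γ τ).1|) (ε : ℝ) (hε : 0 < ε) :
    ∃ u₀, ∀ τ ∈ Ioo a b ∩ Icc 0 1, |(γ τ).2 + t * (γ τ).1| ≤ ε →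
      (γ τ).1 ∈ Icc (u₀ - L * (2 * ε / δ)) (u₀ + L * (2 * ε / δ)) := by
  by_cases hne : ∃ τ ∈ Ioo a b ∩ Icc (0 : ℝ) 1, |(γ τ).2 + t * (γ τ).1| ≤ ε
  swap
  · exact ⟨0, fun τ hτ hh => absurd ⟨τ, hτ, hh⟩ hne⟩
  obtain ⟨τ₀, hτ₀, h0⟩ := hne
  refine ⟨(γ τ₀).1, fun τ hτ hτε => ?_⟩
  set ψ : ℝ → ℝ := fun τ => (γ τ).2 + t * (γ τ).1 with hψ
  have hd : ∀ τ, HasDerivAt ψ ((deriv γ τ).2 + t * (deriv γ τ).1) τ := by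
    intro τ
    have k : HasDerivAt γ (deriv γ τ) τ := (hγ.differentiable (by norm_num) τ).hasDerivAt
    have k1 : HasDerivAt (fun τ => (γ τ).1) (deriv γ τ).1 τ :=
      (ContinuousLinearMap.fst ℝ ℝ ℝ).hasFDerivAt.comp_hasDerivAt τ k
    have k2 : HasDerivAt (fun τ => (γ τ).2) (deriv γ τ).2 τ :=
      (ContinuousLinearMap.snd ℝ ℝ ℝ).hasFDerivAt.comp_hasDerivAt τ k
    exact k2.fun_add (k1.const_mul t)
  have hcont : Continuous ψ := continuous_iff_continuousAt.2 fun w => (hd w).continuousAt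
  -- The offset along the arc has derivative at least `δ` in modulus, hence expands distances in the
  -- parameter by at least `δ`.
  have key : ∀ x ∈ Ioo a b, ∀ y ∈ Ioo a b, x < y → δ * (y - x) ≤ |ψ y - ψ x| := by
    intro x hx y hy hxy
    obtain ⟨z, hz, hz'⟩ := exists_hasDerivAt_eq_slope ψ _ hxy hcont.continuousOn fun w _ => hd w
    have := h z ⟨hx.1.trans hz.1, hz.2.trans hy.2⟩
    rw [hz', abs_div, abs_of_pos (sub_pos.2 hxy), le_div_iff₀ (sub_pos.2 hxy)] at this
    exact this
  have key2 : δ * |τ - τ₀| ≤ 2 * ε := by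
    have hb : |ψ τ - ψ τ₀| ≤ 2 * ε := (abs_sub _ _).trans (by linarith)
    rcases lt_trichotomy τ τ₀ with hlt | rfl | hlt
    · have := key τ hτ.1 τ₀ hτ₀.1 hlt
      rw [abs_sub_comm] at this
      rw [abs_sub_comm τ τ₀, abs_of_pos (sub_pos.2 hlt)]
      linarith
    · simp; positivity
    · have := key τ₀ hτ₀.1 τ hτ.1 hlt
      rw [abs_of_pos (sub_pos.2 hlt)]
      linarith
  have h3 : |τ - τ₀| ≤ 2 * ε / δ := by rw [le_div_iff₀ hδ]; linarith
  have h4 : |(γ τ).1 - (γ τ₀).1| ≤ L * (2 * ε / δ) := (hL τ hτ τ₀ hτ₀).trans (by gcongr)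
  rw [abs_le] at h4
  constructor <;> linarith

namespace IsNormalPiece

variable {g : ℝ → ℝ} {D : Set (ℝ × ℝ)} {F : ℝ × ℝ → ℝ}

/-- The parts of nearby lines that meet the boundary away from the origin are small. -/
lemma exists_bad_set (h : IsNormalPiece g D F) {r₀ : ℝ} (hr₀ : 0 < r₀) :
    ∃ δ > 0, ∃ K, 0 ≤ K ∧ ∀ t, |t| < δ → ∀ ε, 0 < ε → ε < δ →
      ∃ Bd : Set ℝ, MeasurableSet Bd ∧ volume Bd ≤ ENNReal.ofReal (K * ε) ∧
        ∀ x ∈ frontier D, |x.2 + t * x.1| ≤ ε → x ∈ Metric.ball (0 : ℝ × ℝ) r₀ ∨ x.1 ∈ Bd := by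
  obtain ⟨m, γ, hγ, -, -, hfr, htan⟩ := h.boundary
  choose T w hcov δ hδ hA using fun i => exists_arc_cover (hγ i) hr₀ (htan i)
  obtain ⟨δ₀, hδ₀, hle⟩ := exists_pos_forall_of_finite (P := fun i x => x ≤ δ i)
    (fun i x x' _ hx hx' => hx.trans hx') fun i => ⟨δ i, hδ i, le_rfl⟩
  have hLip : ∀ i, ∃ L, 0 ≤ L ∧ ∀ τ ∈ Icc (0 : ℝ) 1, ∀ τ' ∈ Icc (0 : ℝ) 1,
      |(γ i τ).1 - (γ i τ').1| ≤ L * |τ - τ'| := by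
    intro i
    obtain ⟨L, hL⟩ := isCompact_Icc.exists_bound_of_continuousOn
      (((hγ i).continuous_deriv le_rfl).continuousOn (s := Icc (0 : ℝ) 1))
    refine ⟨L, (norm_nonneg _).trans (hL 0 (by simp)), fun τ hτ τ' hτ' => ?_⟩
    have := Convex.norm_image_sub_le_of_norm_deriv_le (f := γ i)
      (fun x _ => (hγ i).differentiable (by norm_num) x) hL (convex_Icc 0 1) hτ' hτ
    exact (norm_fst_le (γ i τ - γ i τ')).trans this
  choose L hL0 hL using hLip
  refine ⟨δ₀, hδ₀, ∑ i, ∑ _τ ∈ T i, 2 * (L i * (2 / δ₀)),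
    Finset.sum_nonneg fun i _ => Finset.sum_nonneg fun τ _ => by have := hL0 i; positivity,
    fun t ht ε hε hεδ => ?_⟩
  have hshort : ∀ i τ, ∃ u₀, τ ∈ T i →
      (∀ s ∈ Ioo (τ - w i τ) (τ + w i τ), δ₀ ≤ |(deriv (γ i) s).2 + t * (deriv (γ i) s).1|) →
      ∀ s ∈ Ioo (τ - w i τ) (τ + w i τ) ∩ Icc 0 1, |(γ i s).2 + t * (γ i s).1| ≤ ε →
        (γ i s).1 ∈ Icc (u₀ - L i * (2 * ε / δ₀)) (u₀ + L i * (2 * ε / δ₀)) := by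
    intro i τ
    by_cases hh : ∀ s ∈ Ioo (τ - w i τ) (τ + w i τ),
      δ₀ ≤ |(deriv (γ i) s).2 + t * (deriv (γ i) s).1|
    · obtain ⟨u₀, hu₀⟩ := exists_short_interval (hγ i) hδ₀
        (fun x hx y hy => hL i x hx.2 y hy.2) (hL0 i) hh ε hε
      exact ⟨u₀, fun _ _ => hu₀⟩
    · exact ⟨0, fun _ h1 => absurd h1 hh⟩
  choose u₀ hu₀ using hshort
  refine ⟨⋃ i, ⋃ τ ∈ T i, Icc (u₀ i τ - L i * (2 * ε / δ₀)) (u₀ i τ + L i * (2 * ε / δ₀)),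
    MeasurableSet.iUnion fun i => Finset.measurableSet_biUnion _ fun τ _ => measurableSet_Icc,
    ?_, ?_⟩
  · refine (measure_iUnion_fintype_le _ _).trans ?_
    rw [Finset.sum_mul, ENNReal.ofReal_sum_of_nonneg fun i _ => ?_]
    · refine Finset.sum_le_sum fun i _ => (measure_biUnion_finset_le _ _).trans ?_
      rw [Finset.sum_mul, ENNReal.ofReal_sum_of_nonneg fun τ _ => ?_]
      · refine Finset.sum_le_sum fun τ _ => ?_
        rw [Real.volume_Icc]
        apply ENNReal.ofReal_le_ofReal
        apply le_of_eq
        ring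
      · have := hL0 i; positivity
    · have := hL0 i
      exact mul_nonneg (Finset.sum_nonneg fun τ _ => by positivity) hε.le
  · intro x hx hxε
    rw [hfr] at hx
    obtain ⟨i, s, hs, rfl⟩ := mem_iUnion.1 hx
    obtain ⟨τ, hτ, hsτ⟩ := mem_iUnion₂.1 (hcov i hs)
    rcases (hA i τ hτ).mono (hle i) with h1 | h1 | h1
    · have := h1 s hsτ t ht
      linarith
    · right
      exact mem_iUnion.2 ⟨i, mem_iUnion₂.2 ⟨τ, hτ, hu₀ i τ hτ (fun s hs => h1 s hs t ht) s
        ⟨hsτ, hs⟩ hxε⟩⟩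
    · exact Or.inl (h1 s hsτ)

/-- Near the origin the piece is a union of sides of the graph. -/
lemma exists_sides (h : IsNormalPiece g D F) (hg : IsCurvedGraph g) :
    ∃ cp cm : Prop, ∀ᶠ x in 𝓝 (0 : ℝ × ℝ),
      (0 < x.2 - g x.1 → (x ∈ D ↔ cp)) ∧ (x.2 - g x.1 < 0 → (x ∈ D ↔ cm)) :=
  eventually_side_of_graph hg.smooth.continuous (by simp [hg.map_zero]) h.graph

/-- Lines through the origin that are close to, but different from, the tangent line are
transversal to the boundary. -/
lemma exists_hasSlope (h : IsNormalPiece g D F) (hg : IsCurvedGraph g) :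
    ∃ δ > 0, ∀ t, t ≠ 0 → |t| < δ → HasSlope (sliceInt (D.indicator F)) t := by
  obtain ⟨r, hr⟩ := hg.exists_isCurvedOn
  obtain ⟨cp, cm, hside⟩ := h.exists_sides hg
  obtain ⟨r₁, hr₁, hball⟩ := Metric.eventually_nhds_iff_ball.1
    (hside.eventually_nhds.and (h.graph.and hside))
  set r₀ := min r r₁ with hr₀
  have hr₀0 : 0 < r₀ := lt_min hr.radius_pos hr₁
  obtain ⟨m, γ, hγ, hinj, hend, hfr, htan⟩ := h.boundary
  choose T w hcov δ hδ hA using fun i => exists_arc_cover (hγ i) hr₀0 (htan i)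
  obtain ⟨δ₀, hδ₀, hle⟩ := exists_pos_forall_of_finite (P := fun i x => x ≤ δ i)
    (fun i x x' _ hx hx' => hx.trans hx') fun i => ⟨δ i, hδ i, le_rfl⟩
  -- A line through the origin with small nonzero slope misses any given point other than the
  -- origin. Applied to the end points of the arcs, this keeps the line away from the corners.
  have hpoint : ∀ z : ℝ × ℝ, ∃ δ > 0, z ≠ 0 → ∀ t, t ≠ 0 → |t| < δ → z.2 + t * z.1 ≠ 0 := by
    intro z
    by_cases h2 : z.2 = 0
    · refine ⟨1, one_pos, fun hz t ht _ => ?_⟩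
      rw [h2, zero_add]
      refine mul_ne_zero ht fun h1 => hz ?_
      ext <;> simp [h1, h2]
    · refine ⟨|z.2| / (|z.1| + 1), by positivity, fun _ t _ ht h0 => ?_⟩
      rw [lt_div_iff₀ (by positivity)] at ht
      have : |z.2| = |t| * |z.1| := by
        rw [← abs_mul, ← abs_neg]; congr 1; linarith
      nlinarith [abs_nonneg t]
  choose η hη hηz using hpoint
  obtain ⟨δ₁, hδ₁, hle₁⟩ := exists_pos_forall_of_finite
    (P := fun (i : Fin m × Bool) x => x ≤ η (γ i.1 (if i.2 then 1 else 0)))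
    (fun i x x' _ hx hx' => hx.trans hx') fun i => ⟨_, hη _, le_rfl⟩
  refine ⟨min δ₀ δ₁, lt_min hδ₀ hδ₁, fun t ht0 ht => ?_⟩
  have ht1 : |t| < δ₀ := ht.trans_le (min_le_left _ _)
  have ht2 : |t| < δ₁ := ht.trans_le (min_le_right _ _)
  obtain ⟨B, hB⟩ := h.bounded
  refine hasSlope_sliceInt_of_localSide h.isOpen.measurableSet hB h.contDiff fun u => ?_
  by_cases hz : (u, -t * u) ∈ frontier D
  swap
  · exact localSide_of_notMem_frontier hz t
  by_cases hzb : (u, -t * u) ∈ Metric.ball (0 : ℝ × ℝ) r₀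
  · obtain ⟨k1, k2, -⟩ := hball _ (Metric.ball_subset_ball (min_le_right _ _) hzb)
    have hgz := k2 hz
    dsimp only at hgz
    refine localSide_of_graph hg.contDiff_one hgz ?_ ⟨cp, cm, k1⟩
    dsimp only
    have hur : |u| ≤ r := by
      have h1 := (norm_fst_le _).trans_lt (mem_ball_zero_iff.1 hzb)
      exact h1.le.trans (min_le_left _ _)
    rcases eq_or_ne u 0 with rfl | hu0
    · rw [hg.deriv_zero, zero_add]; exact ht0
    -- Otherwise the line would be the tangent at `(u, g u)`, and it passes through the origin. By
    -- strict convexity the graph lies strictly above that tangent at `0`, which is a contradiction.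
    · intro hcon
      have := hr.quadratic_lower hur (v := 0) (by simpa using hr.radius_pos.le)
      rw [hg.map_zero, ← hgz, show deriv g u = -t by linarith] at this
      have hpos : 0 < deriv (deriv g) 0 / 2 / 2 * (0 - u) ^ 2 := by
        have := hr.lower_pos
        have : 0 < (0 - u) ^ 2 := by positivity
        positivity
      linarith
  · have hz' := hz
    rw [hfr] at hz'
    obtain ⟨i, s, hs, hsz⟩ := mem_iUnion.1 hz'
    obtain ⟨τ, hτ, hsτ⟩ := mem_iUnion₂.1 (hcov i hs)
    have hz0 : ((u, -t * u) : ℝ × ℝ) ≠ 0 := fun h0 => hzb (by rw [h0]; simpa using hr₀0)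
    have hline : (γ i s).2 + t * (γ i s).1 = 0 := by rw [hsz]; ring
    have htr : (deriv (γ i) s).2 + t * (deriv (γ i) s).1 ≠ 0 := by
      rcases (hA i τ hτ).mono (hle i) with h1 | h1 | h1
      · have := h1 s hsτ t ht1
        rw [hline, abs_zero] at this
        linarith
      · intro h0
        have := h1 s hsτ t ht1
        rw [h0, abs_zero] at this
        linarith
      · have := h1 s hsτ
        rw [hsz] at this
        exact absurd this hzb
    have hcorner : ∀ b : Bool, s ≠ (if b then 1 else 0) := by
      intro b hsb
      refine hηz (γ i (if b then 1 else 0)) ?_ t ht0 (ht2.trans_le (hle₁ (i, b))) ?_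
      · rw [← hsb, hsz]; exact hz0
      · rw [← hsb]; exact hline
    have hs0 : s ≠ 0 := by simpa using hcorner false
    have hs1 : s ≠ 1 := by simpa using hcorner true
    refine localSide_of_arc (hγ i) hsz htr fun N hN => ?_
    -- At an interior parameter the other arcs, and the remote part of the same injective arc, are
    -- compact sets missing the point; so near it the frontier is a single branch.
    have hcl1 : ∀ j, j ≠ i → ∀ᶠ x in 𝓝 ((u, -t * u) : ℝ × ℝ), x ∉ γ j '' Icc (0 : ℝ) 1 := by
      intro j hj
      refine ((isCompact_Icc.image (hγ j).continuous).isClosed.isOpen_compl).mem_nhds ?_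
      rintro ⟨s', hs', hss'⟩
      rcases (hend i j hj.symm s hs s' hs' (hsz.trans hss'.symm)).1 with h0 | h0
      · exact hs0 h0
      · exact hs1 h0
    have hcl2 : ∀ᶠ x in 𝓝 ((u, -t * u) : ℝ × ℝ), x ∉ γ i '' (Icc (0 : ℝ) 1 \ interior N) := by
      refine (((isCompact_Icc.diff isOpen_interior).image
        (hγ i).continuous).isClosed.isOpen_compl).mem_nhds ?_
      rintro ⟨s', hs', hss'⟩
      rw [← hsz] at hss'
      have := hinj i hs'.1 hs hss'
      rw [this] at hs'
      exact hs'.2 (mem_interior_iff_mem_nhds.2 hN)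
    have hcl3 : ∀ᶠ x in 𝓝 ((u, -t * u) : ℝ × ℝ), ∀ j, j ≠ i → x ∉ γ j '' Icc (0 : ℝ) 1 := by
      rw [eventually_all]
      intro j
      by_cases hj : j = i
      · exact Eventually.of_forall fun x h0 => absurd hj h0
      · filter_upwards [hcl1 j hj] with x hx _ using hx
    filter_upwards [hcl2, hcl3] with x hx2 hx3 hxf
    rw [hfr] at hxf
    obtain ⟨j, s', hs', rfl⟩ := mem_iUnion.1 hxf
    by_cases hj : j = i
    · subst hj
      refine ⟨s', ?_, rfl⟩
      by_contra hN'
      exact hx2 ⟨s', ⟨hs', fun hh => hN' (interior_subset hh)⟩, rfl⟩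
    · exact absurd ⟨s', hs', rfl⟩ (hx3 j hj)

end IsNormalPiece

/-! ### The region above the graph: level sets and first moments. -/

/-- The part of the plane above the graph of `g` over the interval of radius `r`. -/
def graphRegion (g : ℝ → ℝ) (r : ℝ) : Set (ℝ × ℝ) := {x | |x.1| < r ∧ g x.1 < x.2}

lemma measurableSet_graphRegion {g : ℝ → ℝ} (hg : Continuous g) (r : ℝ) :
    MeasurableSet (graphRegion g r) := by
  have h1 : IsOpen {x : ℝ × ℝ | |x.1| < r} := isOpen_lt (by fun_prop) continuous_const
  have h2 : IsOpen {x : ℝ × ℝ | g x.1 < x.2} := isOpen_lt (by fun_prop) continuous_snd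
  exact (h1.inter h2).measurableSet

namespace IsCurvedOn

variable {g : ℝ → ℝ} {r c C : ℝ}

/-- The slopes `g u / u` increase at least linearly, on both sides of the origin. -/
lemma mul_slope_le (h : IsCurvedOn g r c C) {σ u v : ℝ} (hσ : |σ| = 1) (hu : 0 ≤ u) (huv : u ≤ v)
    (hv : v ≤ r) : c / 2 * (u * v * (v - u)) ≤ u * g (σ * v) - v * g (σ * u) := by
  have hσ2 : σ ^ 2 = 1 := by rw [← sq_abs, hσ, one_pow]
  have hau : |σ * u| ≤ r := by rw [abs_mul, hσ, one_mul, abs_of_nonneg hu]; linarith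
  have hav : |σ * v| ≤ r := by rw [abs_mul, hσ, one_mul, abs_of_nonneg (hu.trans huv)]; exact hv
  -- The tangent at `σ * u` is compared with the graph at `σ * v` with weight `u`, and at `0` with
  -- weight `v - u`; with these weights the derivative cancels.
  have k1 := mul_le_mul_of_nonneg_left (h.quadratic_lower hau hav) hu
  have k2 := mul_le_mul_of_nonneg_left
    (h.quadratic_lower hau (v := 0) (by simpa using h.radius_pos.le)) (sub_nonneg.2 huv)
  rw [h.graph.map_zero] at k2
  have e1 : (σ * v - σ * u) ^ 2 = (v - u) ^ 2 := by
    rw [← mul_sub, mul_pow, hσ2, one_mul]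
  have e2 : (0 - σ * u) ^ 2 = u ^ 2 := by
    rw [zero_sub, neg_sq, mul_pow, hσ2, one_mul]
  rw [e1] at k1
  rw [e2] at k2
  linear_combination k1 + k2

/-- The linear term `t` cancels from `u q(σ v) - v q(σ u)`, where `q(x) = g x + t x`; this is why
the bound is uniform in the slope. -/
lemma mul_sub_le_of_small (h : IsCurvedOn g r c C) {σ u v t ε : ℝ} (hσ : |σ| = 1) (hu : 0 ≤ u)
    (huv : u ≤ v) (hv : v ≤ r) (hqu : |g (σ * u) + t * (σ * u)| ≤ ε)
    (hqv : |g (σ * v) + t * (σ * v)| ≤ ε) : u * (v - u) ≤ 4 * ε / c := by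
  have hc := h.lower_pos
  rcases hu.eq_or_lt with rfl | hu0
  · rw [zero_mul]
    have := (abs_nonneg _).trans hqu
    positivity
  have k := h.mul_slope_le hσ hu huv hv
  rw [abs_le] at hqu hqv
  have hv0 : 0 < v := hu0.trans_le huv
  have k1 := mul_le_mul_of_nonneg_left hqv.2 hu
  have k2 := mul_le_mul_of_nonneg_left hqu.1 hv0.le
  have hε : 0 ≤ ε := by linarith
  rw [le_div_iff₀ hc]
  have k3 : v * (u * (v - u) * c) ≤ v * (4 * ε) := by nlinarith
  exact le_of_mul_le_mul_left k3 hv0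

/-- The level sets of `g u + t * u` are negligible. -/
lemma volume_level (h : IsCurvedOn g r c C) (t p : ℝ) :
    volume {u | |u| ≤ r ∧ g u + t * u = p} = 0 := by
  -- By strict convexity a level is attained at most once where the derivative is nonnegative, and
  -- at most once where it is nonpositive.
  have hsub : {u | |u| ≤ r ∧ g u + t * u = p} ⊆
      {u | (|u| ≤ r ∧ g u + t * u = p) ∧ 0 ≤ deriv g u + t} ∪
      {u | (|u| ≤ r ∧ g u + t * u = p) ∧ deriv g u + t ≤ 0} := by
    intro u hu
    rcases le_total 0 (deriv g u + t) with h1 | h1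
    · exact Or.inl ⟨hu, h1⟩
    · exact Or.inr ⟨hu, h1⟩
  have hc := h.lower_pos
  have key : ∀ u v, |u| ≤ r ∧ g u + t * u = p → |v| ≤ r ∧ g v + t * v = p → u ≠ v →
      (deriv g u + t) * (v - u) < 0 := by
    intro u v hu hv huv
    have k := h.quadratic_lower hu.1 hv.1
    have : 0 < c / 2 * (v - u) ^ 2 := by
      have : v - u ≠ 0 := sub_ne_zero.2 huv.symm
      positivity
    nlinarith [hu.2, hv.2]
  refine measure_mono_null hsub (measure_union_null ?_ ?_)
  · refine Set.Subsingleton.measure_zero (fun u hu v hv => ?_) _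
    by_contra hne
    rcases lt_or_gt_of_ne hne with hlt | hlt
    · have := key u v hu.1 hv.1 hne
      nlinarith [hu.2]
    · have := key v u hv.1 hu.1 (Ne.symm hne)
      nlinarith [hv.2]
  · refine Set.Subsingleton.measure_zero (fun u hu v hv => ?_) _
    by_contra hne
    rcases lt_or_gt_of_ne hne with hlt | hlt
    · have := key v u hv.1 hu.1 (Ne.symm hne)
      nlinarith [hv.2]
    · have := key u v hu.1 hv.1 hne
      nlinarith [hu.2]

end IsCurvedOn

/-- A set in which `u * (v - u) ≤ K` for all `u ≤ v` is covered by two intervals with small first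
moment. -/
lemma exists_cover_of_mul_sub_le {E : Set ℝ} {K : ℝ} (hK : 0 < K) (hE : ∀ u ∈ E, 0 ≤ u)
    (h : ∀ u ∈ E, ∀ v ∈ E, u ≤ v → u * (v - u) ≤ K) :
    ∃ a, 0 < a ∧ K / a ≤ a ∧ E ⊆ Icc 0 (√K) ∪ Icc a (a + K / a) := by
  have hs : 0 < √K := Real.sqrt_pos.2 hK
  have hsq : √K * √K = K := Real.mul_self_sqrt hK.le
  by_cases hne : (E ∩ Ici (√K)).Nonempty
  -- Beyond `√K`, the set starts at its infimum `a` and cannot extend further than `K / a`. Position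
  -- times length of either interval is then of order `K`.
  · set a := sInf (E ∩ Ici (√K)) with ha
    have hbdd : BddBelow (E ∩ Ici (√K)) := ⟨√K, fun x hx => hx.2⟩
    have hsa : √K ≤ a := le_csInf hne fun x hx => hx.2
    have ha0 : 0 < a := hs.trans_le hsa
    refine ⟨a, ha0, ?_, fun v hv => ?_⟩
    · rw [div_le_iff₀ ha0]
      nlinarith
    · rcases le_total v (√K) with h1 | h1
      · exact Or.inl ⟨hE v hv, h1⟩
      · have hav : a ≤ v := csInf_le hbdd ⟨hv, h1⟩
        refine Or.inr ⟨hav, ?_⟩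
        have : a * (v - a) ≤ K := by
          refine le_of_forall_pos_le_add fun η hη => ?_
          obtain ⟨u, hu, hlt⟩ := exists_lt_of_csInf_lt hne
            (show sInf (E ∩ Ici (√K)) < a + η / a from lt_add_of_pos_right _ (by positivity))
          rcases le_total u v with huv | huv
          · have k1 := h u hu.1 v hv huv
            have k2 : a ≤ u := csInf_le hbdd hu
            have k3 : a * (u - a) ≤ η := by
              have : u - a ≤ η / a := by linarith
              calc a * (u - a) ≤ a * (η / a) := by gcongr
                _ = η := by field_simp
            nlinarith
          · have k3 : a * (v - a) ≤ η := by
              have : v - a ≤ η / a := by linarith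
              calc a * (v - a) ≤ a * (η / a) := by gcongr
                _ = η := by field_simp
            linarith
        have : v - a ≤ K / a := by rw [le_div_iff₀ ha0]; linarith
        linarith
  · refine ⟨√K, hs, (div_le_iff₀ hs).2 hsq.ge, fun v hv => Or.inl ⟨hE v hv, ?_⟩⟩
    by_contra hlt
    exact hne ⟨v, hv, (not_le.1 hlt).le⟩

/-- The function `f` is integrable with integral at most `a`. -/
def IntegralLE (f : ℝ → ℝ) (a : ℝ) : Prop := Integrable f ∧ ∫ u, f u ≤ a

lemma IntegralLE.add {f f' : ℝ → ℝ} {a a' : ℝ} (h : IntegralLE f a) (h' : IntegralLE f' a') :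
    IntegralLE (fun u => f u + f' u) (a + a') := by
  refine ⟨h.1.add h'.1, ?_⟩
  rw [integral_add h.1 h'.1]
  exact add_le_add h.2 h'.2

lemma integralLE_indicator_const {S : Set ℝ} (hS : MeasurableSet S) {m k : ℝ} (hk : 0 ≤ k)
    (hm : 0 ≤ m) (hSm : volume S ≤ ENNReal.ofReal m) :
    IntegralLE (S.indicator fun _ => k) (k * m) := by
  constructor
  · rw [integrable_indicator_iff hS]
    exact integrableOn_const (hSm.trans_lt ENNReal.ofReal_lt_top).ne
  · rw [integral_indicator_const _ hS, smul_eq_mul, mul_comm]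
    gcongr
    exact ENNReal.toReal_le_of_le_ofReal hm hSm

lemma integralLE_indicator_Icc (a : ℝ) {b k : ℝ} (hk : 0 ≤ k) (hb : 0 ≤ b) :
    IntegralLE ((Icc a (a + b)).indicator fun _ => k) (k * b) :=
  integralLE_indicator_const measurableSet_Icc hk hb (by rw [Real.volume_Icc, add_sub_cancel_left])

/-- The first moment of the set where `|g u + t * u| ≤ ε` is of order `ε`. -/
lemma IsCurvedOn.exists_moment_bound {g : ℝ → ℝ} {r c C : ℝ} (h : IsCurvedOn g r c C) (t : ℝ)
    {ε : ℝ} (hε : 0 < ε) :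
    ∃ G : ℝ → ℝ, IntegralLE G (24 * ε / c) ∧ (∀ u, 0 ≤ G u) ∧
      ∀ u, |u| ≤ r → |g u + t * u| ≤ ε → |u| ≤ G u := by
  have hc := h.lower_pos
  set K := 4 * ε / c with hK
  have hK0 : 0 < K := by positivity
  have hcov : ∀ σ : ℝ, |σ| = 1 → ∃ a, 0 < a ∧ K / a ≤ a ∧
      {u | (0 ≤ u ∧ u ≤ r) ∧ |g (σ * u) + t * (σ * u)| ≤ ε} ⊆ Icc 0 (√K) ∪ Icc a (a + K / a) :=
    fun σ hσ => exists_cover_of_mul_sub_le hK0 (fun u hu => hu.1.1) fun u hu v hv huv =>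
      h.mul_sub_le_of_small hσ hu.1.1 huv hv.1.2 hu.2 hv.2
  obtain ⟨a, ha, haK, hac⟩ := hcov 1 (by simp)
  obtain ⟨b, hb, hbK, hbc⟩ := hcov (-1) (by simp)
  have hsK : 0 < √K := Real.sqrt_pos.2 hK0
  have hind : ∀ (S : Set ℝ) (k u : ℝ), 0 ≤ k → 0 ≤ S.indicator (fun _ => k) u :=
    fun S k u hk => indicator_nonneg (fun _ _ => hk) u
  -- One central interval and one remote interval on each side; each summand has integral `2 * K`,
  -- in total `6 * K = 24 * ε / c`.
  refine ⟨fun u => (Icc (-√K) (-√K + 2 * √K)).indicator (fun _ => √K) u +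
      (Icc a (a + K / a)).indicator (fun _ => 2 * a) u +
      (Icc (-(b + K / b)) (-(b + K / b) + K / b)).indicator (fun _ => 2 * b) u, ?_, ?_, ?_⟩
  · have e : 24 * ε / c = √K * (2 * √K) + 2 * a * (K / a) + 2 * b * (K / b) := by
      have e1 : 2 * a * (K / a) = 2 * K := by field_simp
      have e2 : 2 * b * (K / b) = 2 * K := by field_simp
      have e3 : √K * (2 * √K) = 2 * K := by
        rw [mul_left_comm, Real.mul_self_sqrt hK0.le]
      rw [e1, e2, e3, hK]
      ring
    rw [e]
    exact ((integralLE_indicator_Icc _ hsK.le (by positivity)).add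
      (integralLE_indicator_Icc _ (by positivity) (by positivity))).add
      (integralLE_indicator_Icc _ (by positivity) (by positivity))
  · intro u
    exact add_nonneg (add_nonneg (hind _ _ _ hsK.le) (hind _ _ _ (by positivity)))
      (hind _ _ _ (by positivity))
  · intro u hur hqu
    have n1 := hind (Icc (-√K) (-√K + 2 * √K)) (√K) u hsK.le
    have n2 := hind (Icc a (a + K / a)) (2 * a) u (by positivity)
    have n3 := hind (Icc (-(b + K / b)) (-(b + K / b) + K / b)) (2 * b) u (by positivity)
    dsimp only
    rcases le_total 0 u with hu | hu
    · rw [abs_of_nonneg hu] at hur ⊢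
      rcases hac ⟨⟨hu, hur⟩, by simpa using hqu⟩ with k | k
      · rw [indicator_of_mem (show u ∈ Icc (-√K) (-√K + 2 * √K) from
          ⟨by linarith, by linarith [k.2]⟩)] at n1 ⊢
        linarith [k.2]
      · rw [indicator_of_mem k] at n2 ⊢
        linarith [k.2]
    · rw [abs_of_nonpos hu] at hur ⊢
      rcases hbc ⟨⟨neg_nonneg.2 hu, hur⟩, by simpa using hqu⟩ with k | k
      · rw [indicator_of_mem (show u ∈ Icc (-√K) (-√K + 2 * √K) from
          ⟨by linarith [k.2], by linarith⟩)] at n1 ⊢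
        linarith [k.2]
      · rw [indicator_of_mem (show u ∈ Icc (-(b + K / b)) (-(b + K / b) + K / b) from
          ⟨by linarith [k.2], by linarith [k.1]⟩)] at n3 ⊢
        linarith [k.2]

/-! ### Comparison of a piece with its jump across the graph. -/

/-- A vertical segment that misses the boundary lies on one side of it. -/
lemma mem_iff_of_segment {D : Set (ℝ × ℝ)} {u y y' : ℝ}
    (h : ∀ x ∈ uIcc y y', (u, x) ∉ frontier D) : (u, y) ∈ D ↔ (u, y') ∈ D := by
  have hpre : IsPreconnected ((fun x : ℝ => (u, x)) '' uIcc y y') :=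
    isPreconnected_uIcc.image _ (by fun_prop)
  have hcov : (fun x : ℝ => (u, x)) '' uIcc y y' ⊆ interior D ∪ (closure D)ᶜ := by
    rintro _ ⟨x, hx, rfl⟩
    by_contra hcon
    rw [mem_union, not_or, notMem_compl_iff] at hcon
    exact h x hx ⟨hcon.2, hcon.1⟩
  have key : ∀ x ∈ uIcc y y', ∀ x' ∈ uIcc y y', (u, x) ∈ D → (u, x') ∈ D := by
    intro x hx x' hx' hxD
    by_contra hx'D
    obtain ⟨z, -, hz1, hz2⟩ := hpre _ _ isOpen_interior isClosed_closure.isOpen_compl hcov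
      ⟨_, ⟨x, hx, rfl⟩, (hcov ⟨x, hx, rfl⟩).resolve_right fun hn => hn (subset_closure hxD)⟩
      ⟨_, ⟨x', hx', rfl⟩, (hcov ⟨x', hx', rfl⟩).resolve_left fun hn => hx'D (interior_subset hn)⟩
    exact hz2 (subset_closure (interior_subset hz1))
  exact ⟨key y left_mem_uIcc y' right_mem_uIcc, key y' right_mem_uIcc y left_mem_uIcc⟩

lemma integrable_indicator_slice {D : Set (ℝ × ℝ)} (hD : MeasurableSet D) {B : ℝ}
    (hB : ∀ x ∈ D, |x.1| ≤ B) {F : ℝ × ℝ → ℝ} (hF : Measurable F) {M : ℝ} (hM : ∀ x, |F x| ≤ M)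
    (t p : ℝ) : Integrable fun u => D.indicator F (u, p - t * u) := by
  have hm : Measurable fun u : ℝ => (u, p - t * u) := by fun_prop
  refine integrable_of_bounded_of_support (K := Icc (-B) B) (M := M)
    ((hF.indicator hD).comp hm) (fun u => ?_) isCompact_Icc.measure_lt_top fun u hu => ?_
  · by_cases hx : (u, p - t * u) ∈ D
    · simpa [indicator_of_mem hx] using hM _
    · simpa [indicator_of_notMem hx] using (abs_nonneg _).trans (hM 0)
  · exact indicator_of_notMem (fun hx => hu (abs_le.1 (hB _ hx))) _

lemma integrable_graphRegion_slice {g : ℝ → ℝ} (hg : Continuous g) (r t p : ℝ) :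
    Integrable fun u => (graphRegion g r).indicator (fun _ => (1 : ℝ)) (u, p - t * u) :=
  integrable_indicator_slice (measurableSet_graphRegion hg r) (B := r) (fun _ hx => hx.1.le)
    measurable_const (M := 1) (by simp) t p

open Classical in
/-- On nearby lines, a piece differs from its jump across the graph by a Lipschitz function of the
offset. -/
lemma IsNormalPiece.exists_remainder_bound {g : ℝ → ℝ} {D : Set (ℝ × ℝ)} {F : ℝ × ℝ → ℝ}
    (h : IsNormalPiece g D F) {r c C : ℝ} (hr : IsCurvedOn g r c C) {cp cm : Prop}
    (hside : ∀ᶠ x in 𝓝 (0 : ℝ × ℝ),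
      (0 < x.2 - g x.1 → (x ∈ D ↔ cp)) ∧ (x.2 - g x.1 < 0 → (x ∈ D ↔ cm))) :
    ∃ δ > 0, ∃ K, 0 ≤ K ∧ ∀ t p ε, |t| < δ → 0 < ε → ε < δ → |p| ≤ ε →
      |(sliceInt (D.indicator F) t p - sliceInt (D.indicator F) t 0) -
        ((if cp then F 0 else 0) - (if cm then F 0 else 0)) *
        (sliceInt ((graphRegion g r).indicator fun _ => 1) t p -
          sliceInt ((graphRegion g r).indicator fun _ => 1) t 0)| ≤ K * ε := by
  obtain ⟨B, hB⟩ := h.bounded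
  obtain ⟨M, hM⟩ := h.contDiff.continuous.bounded_above_of_compact_support h.compactSupport
  obtain ⟨L, hL⟩ := h.contDiff.lipschitzWith_of_hasCompactSupport h.compactSupport (by norm_num)
  have hM0 : 0 ≤ M := (norm_nonneg _).trans (hM 0)
  have hrpos := hr.radius_pos
  have hc := hr.lower_pos
  obtain ⟨r₁, hr₁, hball⟩ := Metric.eventually_nhds_iff_ball.1 hside
  set r₀ := min r (r₁ / 2) with hr₀
  have hr₀0 : 0 < r₀ := lt_min hrpos (by positivity)
  obtain ⟨δ₁, hδ₁, K₁, hK₁, hbad⟩ := h.exists_bad_set hr₀0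
  set B' := max B r with hB'
  have hB'0 : 0 < B' := hrpos.trans_le (le_max_right _ _)
  set Δ := (if cp then F 0 else 0) - (if cm then F 0 else 0) with hΔ
  have hΔM : |Δ| ≤ 2 * M := by
    have h0 : |F 0| ≤ M := hM 0
    have k1 : |if cp then F 0 else 0| ≤ M := by split_ifs <;> simp [h0, hM0]
    have k2 : |if cm then F 0 else 0| ≤ M := by split_ifs <;> simp [h0, hM0]
    exact (abs_sub _ _).trans (by linarith)
  refine ⟨min (min δ₁ 1) (min (r₁ / (2 * (r + 1))) (c * r₀ ^ 2 / (2 * (r + 1)))),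
    by positivity, L * (2 * B') + 4 * L * (2 * r) + 6 * M * K₁ + 8 * L * (24 / c), by positivity,
    fun t p ε ht hε hεδ hp => ?_⟩
  simp only [lt_min_iff] at ht hεδ
  obtain ⟨⟨ht1, ht2⟩, ht3, ht4⟩ := ht
  obtain ⟨⟨he1, he2⟩, he3, he4⟩ := hεδ
  rw [lt_div_iff₀ (by positivity)] at ht3 ht4 he3 he4
  obtain ⟨Bd, hBd, hBdv, hBdf⟩ := hbad t ht1 ε hε he1
  obtain ⟨G, hG, hG0, hGu⟩ := hr.exists_moment_bound t hε
  set Ω := graphRegion g r with hΩ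
  -- Subtracting `Δ` times the indicator of the region removes the jump at the origin; what remains
  -- across the graph is of the order of the distance to the origin.
  set ρ : ℝ × ℝ → ℝ := fun x => D.indicator F x - Δ * Ω.indicator (fun _ => 1) x with hρ
  have hgc : Continuous g := hr.graph.smooth.continuous
  have iD := integrable_indicator_slice h.isOpen.measurableSet hB h.contDiff.continuous.measurable
    hM t
  have iΩ := integrable_graphRegion_slice hgc r t
  have hint : (sliceInt (D.indicator F) t p - sliceInt (D.indicator F) t 0) -
      Δ * (sliceInt (Ω.indicator fun _ => 1) t p - sliceInt (Ω.indicator fun _ => 1) t 0) =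
      ∫ u, (ρ (u, p - t * u) - ρ (u, 0 - t * u)) := by
    have j : ∀ p, Integrable (fun u => ρ (u, p - t * u)) :=
      fun p => (iD p).sub ((iΩ p).const_mul Δ)
    have j' : ∀ p, ∫ u, ρ (u, p - t * u) =
        sliceInt (D.indicator F) t p - Δ * sliceInt (Ω.indicator fun _ => 1) t p := by
      intro p
      simp only [sliceInt, hρ]
      rw [integral_sub (iD p) ((iΩ p).const_mul Δ), integral_const_mul]
    rw [integral_sub (j p) (j 0), j', j']
    ring
  rw [hint]
  -- A majorant of the change of `ρ` between offsets `p` and `0`. The first term covers equal sides,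
  -- `6 * M` the short bad set away from the origin, and the terms with `4 * L * ε` and `G` the
  -- abscissas where the two points are on opposite sides of the graph.
  set H : ℝ → ℝ := fun u => (Icc (-B') (-B' + 2 * B')).indicator (fun _ => L * ε) u +
    (Icc (-r) (-r + 2 * r)).indicator (fun _ => 4 * L * ε) u +
    Bd.indicator (fun _ => 6 * M) u + 8 * L * G u with hH
  have hHI : IntegralLE H
      ((L * (2 * B') + 4 * L * (2 * r) + 6 * M * K₁ + 8 * L * (24 / c)) * ε) := by
    have e : (L * (2 * B') + 4 * L * (2 * r) + 6 * M * K₁ + 8 * L * (24 / c)) * ε =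
        L * ε * (2 * B') + 4 * L * ε * (2 * r) + 6 * M * (K₁ * ε) + 8 * L * (24 * ε / c) := by
      ring
    rw [e]
    refine ((((integralLE_indicator_Icc _ (by positivity) (by positivity))).add
      (integralLE_indicator_Icc _ (by positivity) (by positivity))).add
      (integralLE_indicator_const hBd (by positivity) (by positivity) hBdv)).add
      ⟨hG.1.const_mul _, ?_⟩
    rw [integral_const_mul]
    have := hG.2
    gcongr
  -- Points on the graph itself, where the side is not determined, are discarded.
  have hnull : ∀ᵐ u, ¬(|u| ≤ r ∧ g u + t * u = p) ∧ ¬(|u| ≤ r ∧ g u + t * u = 0) :=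
    (measure_eq_zero_iff_ae_notMem.1 (hr.volume_level t p)).and
      (measure_eq_zero_iff_ae_notMem.1 (hr.volume_level t 0))
  refine (norm_integral_le_of_norm_le (G := ℝ) hHI.1 ?_).trans hHI.2
  have hind : ∀ (S : Set ℝ) (k u : ℝ), 0 ≤ k → 0 ≤ S.indicator (fun _ => k) u :=
    fun S k u hk => indicator_nonneg (fun _ _ => hk) u
  have hLip : ∀ z z', |F z - F z'| ≤ L * ‖z - z'‖ := fun z z' => hL.norm_sub_le z z'
  have hsame : ∀ u, ((u, p - t * u) ∈ D ↔ (u, 0 - t * u) ∈ D) →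
      ((u, p - t * u) ∈ Ω ↔ (u, 0 - t * u) ∈ Ω) →
      ‖ρ (u, p - t * u) - ρ (u, 0 - t * u)‖ ≤ L * ε := by
    intro u k1 k2
    have k3 : |F (u, p - t * u) - F (u, 0 - t * u)| ≤ L * ε := by
      refine (hLip _ _).trans ?_
      have : ‖((u, p - t * u) : ℝ × ℝ) - (u, 0 - t * u)‖ ≤ ε := by
        rw [Prod.mk_sub_mk, sub_self, sub_sub_sub_cancel_right, sub_zero, Prod.norm_def]
        simpa using hp
      gcongr
    simp only [hρ, Real.norm_eq_abs, indicator_apply, k1, k2]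
    split_ifs
    · simpa using k3
    · simpa using k3
    · simp; positivity
    · simp; positivity
  have hdiff : ∀ z z', (z ∈ D ↔ cp) → (z' ∈ D ↔ cm) → z ∈ Ω → z' ∉ Ω →
      |ρ z - ρ z'| ≤ L * ‖z‖ + L * ‖z'‖ := by
    intro z z' k1 k2 k3 k4
    have e1 : |(if cp then F z else 0) - (if cp then F 0 else 0)| ≤ L * ‖z‖ := by
      split_ifs
      · simpa using hLip z 0
      · simp; positivity
    have e2 : |(if cm then F z' else 0) - (if cm then F 0 else 0)| ≤ L * ‖z'‖ := by
      split_ifs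
      · simpa using hLip z' 0
      · simp; positivity
    have e3 : ρ z - ρ z' = ((if cp then F z else 0) - (if cp then F 0 else 0)) -
        ((if cm then F z' else 0) - (if cm then F 0 else 0)) := by
      simp only [hρ, indicator_apply, k1, k2, if_pos k3, if_neg k4, hΔ]
      ring
    rw [e3]
    exact (abs_sub _ _).trans (add_le_add e1 e2)
  filter_upwards [hnull] with u hu
  have n1 := hind (Icc (-B') (-B' + 2 * B')) (L * ε) u (by positivity)
  have n2 := hind (Icc (-r) (-r + 2 * r)) (4 * L * ε) u (by positivity)
  have n3 := hind Bd (6 * M) u (by positivity)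
  have n4 : 0 ≤ 8 * L * G u := mul_nonneg (by positivity) (hG0 u)
  have hoff : ∀ q, |q| ≤ ε → |q - t * u| ≤ |t| * |u| + ε := by
    intro q hq
    have := abs_sub q (t * u)
    rw [abs_mul] at this
    linarith
  simp only [hH]
  rcases lt_or_ge B' |u| with hu1 | hu1
  · have k1 : ∀ q, ρ (u, q) = 0 := by
      intro q
      have m1 : (u, q) ∉ D := fun hx => absurd (hB _ hx) (not_le.2 ((le_max_left _ _).trans_lt hu1))
      have m2 : (u, q) ∉ Ω := fun hx => absurd hx.1 (not_lt.2 ((le_max_right _ _).trans hu1.le))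
      simp [hρ, m1, m2]
    rw [k1, k1, sub_self, norm_zero]
    positivity
  rw [indicator_of_mem (show u ∈ Icc (-B') (-B' + 2 * B') from by
    rw [abs_le] at hu1; constructor <;> linarith [hu1.1, hu1.2])] at n1 ⊢
  by_cases hub : u ∈ Bd
  · have k1 : ∀ z, |ρ z| ≤ 3 * M := by
      intro z
      have m1 : |D.indicator F z| ≤ M := by
        rw [indicator_apply]
        split_ifs
        · exact hM z
        · simpa using hM0
      have m2 : |Δ * Ω.indicator (fun _ => (1 : ℝ)) z| ≤ 2 * M := by
        rw [indicator_apply]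
        split_ifs
        · simpa using hΔM
        · simpa using hM0
      exact (abs_sub _ _).trans (by linarith)
    rw [indicator_of_mem hub] at n3 ⊢
    refine (abs_sub _ _).trans ?_
    linarith [k1 (u, p - t * u), k1 (u, 0 - t * u)]
  rcases le_or_gt r₀ |u| with hu2 | hu2
  -- Away from the origin and off the bad set the vertical segment between the two points misses the
  -- frontier. Neither point is in the region, as the graph is too high there or the abscissa is out
  -- of range.
  · refine (hsame u (mem_iff_of_segment fun x hx hxf => ?_) ?_).trans (by linarith)
    · have k0 : |x + t * u| ≤ ε := by
        rw [abs_le] at hp ⊢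
        rcases mem_uIcc.1 hx with k | k <;> constructor <;> linarith [k.1, k.2, hp.1, hp.2]
      rcases hBdf _ hxf k0 with k | k
      · have k1 := (norm_fst_le _).trans_lt (mem_ball_zero_iff.1 k)
        exact absurd hu2 (not_le.2 k1)
      · exact hub k
    · have k1 : ∀ q, |q| ≤ ε → (u, q - t * u) ∉ Ω := by
        rintro q hq ⟨m1, m2⟩
        dsimp only at m1 m2
        have m3 := hr.lower_sq m1.le
        have m4 : r₀ ^ 2 ≤ u ^ 2 := by
          rw [← sq_abs u]
          gcongr
        have m5 := (le_abs_self _).trans (hoff q hq)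
        have m6 : |t| * |u| ≤ |t| * r := by gcongr
        have m7 : (|t| * r + ε) * (2 * (r + 1)) ≤ (r + 1) * (c * r₀ ^ 2) := by
          nlinarith [mul_le_mul_of_nonneg_left ht4.le hrpos.le]
        have m8 : |t| * r + ε ≤ c / 2 * r₀ ^ 2 := by
          have : (r + 1) * (2 * (|t| * r + ε)) ≤ (r + 1) * (c * r₀ ^ 2) := by linarith
          linarith [le_of_mul_le_mul_left this (by positivity)]
        have m9 : c / 2 * r₀ ^ 2 ≤ c / 2 * u ^ 2 := by gcongr
        linarith
      exact iff_of_false (k1 p hp) (k1 0 (by simpa using hε.le))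
  · have hur : |u| < r := hu2.trans_le (min_le_left _ _)
    have hur1 : |u| < r₁ / 2 := hu2.trans_le (min_le_right _ _)
    have hz : ∀ q, |q| ≤ ε → (u, q - t * u) ∈ Metric.ball (0 : ℝ × ℝ) r₁ := by
      intro q hq
      rw [mem_ball_zero_iff, Prod.norm_def]
      apply max_lt
      · rw [Real.norm_eq_abs]
        dsimp only
        linarith
      · rw [Real.norm_eq_abs]
        dsimp only
        have m5 := hoff q hq
        have m6 : |t| * |u| ≤ |t| * r := by gcongr
        nlinarith [abs_nonneg t]
    have hnorm : ∀ q, |q| ≤ ε → ‖((u, q - t * u) : ℝ × ℝ)‖ ≤ |u| + ε := by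
      intro q hq
      rw [Prod.norm_def]
      apply max_le
      · rw [Real.norm_eq_abs]
        dsimp only
        linarith
      · rw [Real.norm_eq_abs]
        dsimp only
        have m5 := hoff q hq
        nlinarith [abs_nonneg u]
    have hmem : ∀ q, (u, q - t * u) ∈ Ω ↔ g u + t * u < q := by
      intro q
      simp only [hΩ, graphRegion, mem_ofPred_eq, hur, true_and]
      exact lt_sub_iff_add_lt
    have h0ε : |(0 : ℝ)| ≤ ε := by simpa using hε.le
    obtain ⟨s1, s2⟩ := hball _ (hz p hp)
    obtain ⟨s3, s4⟩ := hball _ (hz 0 h0ε)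
    dsimp only at s1 s2 s3 s4
    have q1 : g u + t * u ≠ p := fun hh => hu.1 ⟨hur.le, hh⟩
    have q2 : g u + t * u ≠ 0 := fun hh => hu.2 ⟨hur.le, hh⟩
    have np := hnorm p hp
    have n0 := hnorm 0 h0ε
    have hL0 : (0 : ℝ) ≤ L := L.2
    have hopp : |g u + t * u| ≤ ε →
        L * ‖((u, p - t * u) : ℝ × ℝ)‖ + L * ‖((u, 0 - t * u) : ℝ × ℝ)‖ ≤
        L * ε + (Icc (-r) (-r + 2 * r)).indicator (fun _ => 4 * L * ε) u +
          Bd.indicator (fun _ => 6 * M) u + 8 * L * G u := by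
      intro hq
      rw [indicator_of_mem (show u ∈ Icc (-r) (-r + 2 * r) from by
        rw [abs_lt] at hur; constructor <;> linarith [hur.1, hur.2])]
      have m1 := mul_le_mul_of_nonneg_left np hL0
      have m2 := mul_le_mul_of_nonneg_left n0 hL0
      have m3 := mul_le_mul_of_nonneg_left (hGu u hur.le hq) hL0
      rw [mul_add] at m1 m2
      linarith [mul_nonneg hL0 (hG0 u), mul_nonneg hL0 hε.le]
    have hp' := abs_le.1 hp
    rcases lt_or_gt_of_ne q1 with k1 | k1 <;> rcases lt_or_gt_of_ne q2 with k2 | k2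
    · refine (hsame u ((s1 (by linarith)).trans (s3 (by linarith)).symm) ?_).trans (by linarith)
      rw [hmem, hmem]
      exact iff_of_true k1 k2
    · refine (hdiff _ _ (s1 (by linarith)) (s4 (by linarith)) ((hmem _).2 k1)
        (fun hh => absurd ((hmem _).1 hh) (by linarith))).trans (hopp ?_)
      rw [abs_le]
      constructor <;> linarith
    · rw [norm_sub_rev]
      refine (hdiff _ _ (s3 (by linarith)) (s2 (by linarith)) ((hmem _).2 k2)
        (fun hh => absurd ((hmem _).1 hh) (by linarith))).trans ?_
      rw [add_comm]
      refine hopp ?_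
      rw [abs_le]
      constructor <;> linarith
    · refine (hsame u ((s2 (by linarith)).trans (s4 (by linarith)).symm) ?_).trans (by linarith)
      rw [hmem, hmem]
      exact iff_of_false (by linarith) (by linarith)

/-! ### Lengths cut out by the region above the graph. -/

lemma sliceInt_graphRegion {g : ℝ → ℝ} (hg : Continuous g) (r t p : ℝ) :
    sliceInt ((graphRegion g r).indicator fun _ => 1) t p =
      volume.real {u | |u| < r ∧ g u + t * u < p} := by
  have hS : MeasurableSet {u : ℝ | |u| < r ∧ g u + t * u < p} := by
    have h1 : IsOpen {u : ℝ | |u| < r} := isOpen_lt (by fun_prop) continuous_const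
    have h2 : IsOpen {u : ℝ | g u + t * u < p} := isOpen_lt (by fun_prop) continuous_const
    exact (h1.inter h2).measurableSet
  rw [sliceInt, ← integral_indicator_one hS]
  congr 1
  ext u
  simp only [indicator_apply, graphRegion, mem_ofPred_eq, lt_sub_iff_add_lt, Pi.one_apply]

namespace IsCurvedOn

variable {g : ℝ → ℝ} {r c C : ℝ}

lemma abs_sub_tangent_le (h : IsCurvedOn g r c C) {u v : ℝ} (hu : |u| ≤ r) (hv : |v| ≤ r) :
    |g v - g u - deriv g u * (v - u)| ≤ C * (v - u) ^ 2 := by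
  have hmem : ∀ w, w ∈ uIcc u v → |w| ≤ r := by
    intro w hw
    rw [abs_le] at *
    rcases mem_uIcc.1 hw with k | k <;> constructor <;> linarith [k.1, k.2]
  have hC := h.lower_pos.trans_le h.lower_le_upper
  have hlip : ∀ x y, |x| ≤ r → |y| ≤ r → x ≤ y → |deriv g y - deriv g x| ≤ C * (y - x) := by
    intro x y hx hy hxy
    rw [abs_of_nonneg ((mul_nonneg h.lower_pos.le (sub_nonneg.2 hxy)).trans (h.lower x y hx hy hxy))]
    exact h.upper x y hx hy hxy
  have hcont : Continuous g := h.graph.smooth.continuous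
  rcases lt_trichotomy u v with huv | rfl | huv
  · obtain ⟨w, hw, hw'⟩ := exists_hasDerivAt_eq_slope g _ huv hcont.continuousOn
      fun w _ => h.graph.hasDerivAt w
    rw [eq_div_iff (by linarith)] at hw'
    rw [← hw', ← sub_mul, abs_mul, abs_of_pos (sub_pos.2 huv)]
    have := hlip u w hu (hmem w (Ioo_subset_Icc_self.trans Icc_subset_uIcc hw)) hw.1.le
    have h2 : C * (w - u) ≤ C * (v - u) := by gcongr; exact hw.2.le
    nlinarith
  · simp
  · obtain ⟨w, hw, hw'⟩ := exists_hasDerivAt_eq_slope g _ huv hcont.continuousOn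
      fun w _ => h.graph.hasDerivAt w
    rw [eq_div_iff (by linarith)] at hw'
    have e : g v - g u - deriv g u * (v - u) = (deriv g u - deriv g w) * (u - v) := by
      linarith
    rw [e, abs_mul, abs_of_pos (sub_pos.2 huv)]
    have := hlip w u (hmem w (Ioo_subset_Icc_self.trans Icc_subset_uIcc' hw)) hu hw.2.le
    have h2 : C * (u - w) ≤ C * (u - v) := by gcongr; exact hw.1.le
    nlinarith

/-- Perturbation of a simple root of `g u + t * u`. -/
lemma exists_root (h : IsCurvedOn g r c C) {s₀ t m p : ℝ} (hs₀ : g s₀ + t * s₀ = 0) (hm : 0 < m)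
    (hmd : m ≤ |deriv g s₀ + t|) (hp : 4 * C * |p| ≤ m ^ 2) (hr : |s₀| + 2 * |p| / m ≤ r) :
    ∃ s, |s - s₀| ≤ 2 * |p| / m ∧ g s + t * s = p ∧
      |s - s₀ - p / (deriv g s₀ + t)| ≤ 4 * C * p ^ 2 / m ^ 3 := by
  have hC := h.lower_pos.trans_le h.lower_le_upper
  set d := deriv g s₀ + t with hd
  -- At distance `l` from `s₀` the linear term has size at least `m * l = 2 * |p|`, while `hp`
  -- bounds the quadratic error by `|p|`; so the level `p` is bracketed.
  set l := 2 * |p| / m with hl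
  have hl0 : 0 ≤ l := by positivity
  have hml : m * l = 2 * |p| := by rw [hl]; field_simp
  have hs₀r : |s₀| ≤ r := by linarith
  have hbd : ∀ s, |s - s₀| ≤ l → |g s + t * s - d * (s - s₀)| ≤ C * (s - s₀) ^ 2 := by
    intro s hs
    have h1 : |s| ≤ r := by
      have := abs_add_le (s - s₀) s₀
      rw [sub_add_cancel] at this
      linarith
    have h2 := h.abs_sub_tangent_le hs₀r h1
    have e : g s + t * s - d * (s - s₀) = g s - g s₀ - deriv g s₀ * (s - s₀) := by
      rw [hd]; linear_combination hs₀
    rwa [e]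
  have hCl : C * l ^ 2 ≤ |p| := by
    have e : C * l ^ 2 = 4 * C * |p| * |p| / m ^ 2 := by rw [hl]; field_simp; ring
    rw [e, div_le_iff₀ (by positivity), mul_comm |p|]
    gcongr
  have hcont : Continuous fun s => g s + t * s :=
    h.graph.smooth.continuous.add (continuous_const.mul continuous_id)
  have e1 := abs_le.1 (hbd (s₀ + l) (by rw [add_sub_cancel_left, abs_of_nonneg hl0]))
  have e2 := abs_le.1 (hbd (s₀ - l) (by rw [sub_sub_cancel_left, abs_neg, abs_of_nonneg hl0]))
  rw [add_sub_cancel_left] at e1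
  rw [sub_sub_cancel_left, neg_sq] at e2
  have hpp := abs_le.1 (le_refl |p|)
  have hmem : p ∈ uIcc (g (s₀ - l) + t * (s₀ - l)) (g (s₀ + l) + t * (s₀ + l)) := by
    rw [mem_uIcc]
    rcases le_total 0 d with hd0 | hd0
    · rw [abs_of_nonneg hd0] at hmd
      have := mul_le_mul_of_nonneg_right hmd hl0
      left
      constructor <;> linarith
    · rw [abs_of_nonpos hd0] at hmd
      have := mul_le_mul_of_nonneg_right hmd hl0
      right
      constructor <;> linarith
  obtain ⟨s, hs, hsp⟩ := intermediate_value_uIcc hcont.continuousOn hmem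
  rw [uIcc_of_le (by linarith)] at hs
  have hsl : |s - s₀| ≤ l := by rw [abs_le]; constructor <;> linarith [hs.1, hs.2]
  refine ⟨s, hsl, hsp, ?_⟩
  have h3 := hbd s hsl
  simp only at hsp
  rw [hsp] at h3
  have hd0 : d ≠ 0 := fun h0 => by rw [h0, abs_zero] at hmd; linarith
  have e : s - s₀ - p / d = -((p - d * (s - s₀)) / d) := by field_simp; ring
  rw [e, abs_neg, abs_div, div_le_iff₀ (by positivity)]
  have h4 : (s - s₀) ^ 2 ≤ l ^ 2 := by rw [← sq_abs]; gcongr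
  calc |p - d * (s - s₀)| ≤ C * l ^ 2 := h3.trans (by gcongr)
    _ = 4 * C * p ^ 2 / m ^ 3 * m := by rw [hl, div_pow, mul_pow, sq_abs]; field_simp; ring
    _ ≤ 4 * C * p ^ 2 / m ^ 3 * |d| := by gcongr

/-- Between two roots `g u + t * u` is below, and elsewhere not below, the level. -/
lemma sublevel_eq (h : IsCurvedOn g r c C) {s s' t p : ℝ} (hs : |s| < r) (hs' : |s'| < r)
    (hss' : s < s') (hp : g s + t * s = p) (hp' : g s' + t * s' = p) :
    {u | |u| < r ∧ g u + t * u < p} = Ioo s s' := by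
  have hc := h.lower_pos
  -- Strict convexity of `g u + t * u`, as an inequality with its secants.
  have key : ∀ x y z, |x| ≤ r → |y| ≤ r → |z| ≤ r → x < y → y < z →
      (z - x) * (g y + t * y) < (z - y) * (g x + t * x) + (y - x) * (g z + t * z) := by
    intro x y z hx hy hz hxy hyz
    have k1 := mul_le_mul_of_nonneg_left (h.quadratic_lower hy hx) (sub_nonneg.2 hyz.le)
    have k2 := mul_le_mul_of_nonneg_left (h.quadratic_lower hy hz) (sub_nonneg.2 hxy.le)
    have k3 : 0 < (z - y) * (c / 2 * (x - y) ^ 2) :=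
      mul_pos (sub_pos.2 hyz) (mul_pos (half_pos hc) (sq_pos_of_neg (sub_neg.2 hxy)))
    have k4 : 0 ≤ (y - x) * (c / 2 * (z - y) ^ 2) :=
      mul_nonneg (sub_nonneg.2 hxy.le) (by positivity)
    linarith
  ext u
  constructor
  · rintro ⟨hur, hu⟩
    constructor
    · by_contra hus
      rcases (not_lt.1 hus).eq_or_lt with rfl | hlt
      · linarith
      · have := key u s s' hur.le hs.le hs'.le hlt hss'
        rw [hp, hp'] at this
        nlinarith
    · by_contra hus
      rcases (not_lt.1 hus).eq_or_lt with rfl | hlt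
      · linarith
      · have := key s s' u hs.le hs'.le hur.le hss' hlt
        rw [hp, hp'] at this
        nlinarith
  · rintro ⟨h1, h2⟩
    have hur : |u| < r := by
      rw [abs_lt] at *
      constructor <;> linarith [hs.1, hs'.2]
    refine ⟨hur, ?_⟩
    have := key s u s' hs.le hur.le hs'.le h1 h2
    rw [hp, hp'] at this
    nlinarith

lemma sliceInt_eq_abs_sub (h : IsCurvedOn g r c C) {s s' t p : ℝ} (hs : |s| < r) (hs' : |s'| < r)
    (hss' : s ≠ s') (hp : g s + t * s = p) (hp' : g s' + t * s' = p) :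
    sliceInt ((graphRegion g r).indicator fun _ => 1) t p = |s - s'| := by
  rw [sliceInt_graphRegion h.graph.smooth.continuous]
  rcases lt_or_gt_of_ne hss' with hlt | hlt
  · rw [h.sublevel_eq hs hs' hlt hp hp', Real.volume_real_Ioo_of_le hlt.le, abs_sub_comm,
      abs_of_pos (sub_pos.2 hlt)]
  · rw [h.sublevel_eq hs' hs hlt hp' hp, Real.volume_real_Ioo_of_le hlt.le,
      abs_of_pos (sub_pos.2 hlt)]

/-- The second root of `g u + t * u`. -/
lemma exists_second_root (h : IsCurvedOn g r c C) {t : ℝ} (ht : 2 * |t| / c ≤ r) :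
    ∃ w, g w + t * w = 0 ∧ |w| ≤ 2 * |t| / c ∧ |t| / (2 * C) ≤ |w| ∧ t * w ≤ 0 ∧
      c * |t| / (4 * C) ≤ |deriv g w + t| := by
  have hc := h.lower_pos
  have hC := h.lower_pos.trans_le h.lower_le_upper
  have hup : ∀ u, |u| ≤ r → g u ≤ C * u ^ 2 := by
    intro u hu
    have := (abs_le.1 (h.abs_sub_tangent_le (u := 0) (by simpa using h.radius_pos.le) hu)).2
    simpa [h.graph.map_zero, h.graph.deriv_zero] using this
  have ha : |-(2 * t / c)| = 2 * |t| / c := by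
    rw [abs_neg, abs_div, abs_mul, abs_of_pos hc, abs_two]
  have hb : |-(t / (2 * C))| = |t| / (2 * C) := by
    rw [abs_neg, abs_div, abs_of_pos (by positivity : 0 < 2 * C)]
  have hble : |t| / (2 * C) ≤ 2 * |t| / c := by
    rw [div_le_div_iff₀ (by positivity) hc]
    nlinarith [abs_nonneg t, h.lower_le_upper]
  -- The bracket comes from `c / 2 * u ^ 2 ≤ g u ≤ C * u ^ 2`: the parabolas with these coefficients
  -- give a nonnegative value at `-2t/c` and a nonpositive one at `-t/(2C)`.
  have h1 : 0 ≤ g (-(2 * t / c)) + t * -(2 * t / c) := by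
    have := h.lower_sq (u := -(2 * t / c)) (by rw [ha]; exact ht)
    have e : c / 2 * (-(2 * t / c)) ^ 2 = t * (2 * t / c) := by field_simp
    linarith
  have h2 : g (-(t / (2 * C))) + t * -(t / (2 * C)) ≤ 0 := by
    have := hup (-(t / (2 * C))) (by rw [hb]; exact hble.trans ht)
    have e : C * (-(t / (2 * C))) ^ 2 = t * (t / (2 * C)) / 2 := by field_simp
    have e2 : 0 ≤ t * (t / (2 * C)) := by
      rw [mul_div_assoc']
      exact div_nonneg (mul_self_nonneg t) (by positivity)
    linarith
  have hcont : Continuous fun s => g s + t * s :=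
    h.graph.smooth.continuous.add (continuous_const.mul continuous_id)
  obtain ⟨w, hw, hw0⟩ := intermediate_value_uIcc (a := -(t / (2 * C))) (b := -(2 * t / c))
    hcont.continuousOn (mem_uIcc.2 (Or.inl ⟨h2, h1⟩))
  simp only at hw0
  have hw1 : |w| ≤ 2 * |t| / c ∧ |t| / (2 * C) ≤ |w| ∧ t * w ≤ 0 := by
    rcases le_total 0 t with ht0 | ht0
    · have e1 : 0 ≤ t / (2 * C) := by positivity
      have e2 : 0 ≤ 2 * t / c := by positivity
      rw [abs_of_nonneg ht0] at *
      rw [uIcc_of_ge (by linarith)] at hw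
      have hw0' : w ≤ 0 := by linarith [hw.2]
      rw [abs_of_nonpos hw0']
      exact ⟨by linarith [hw.1], by linarith [hw.2], mul_nonpos_of_nonneg_of_nonpos ht0 hw0'⟩
    · have e1 : 0 ≤ -(t / (2 * C)) := by rw [← neg_div]; exact div_nonneg (by linarith) (by linarith)
      have e2 : 0 ≤ -(2 * t / c) := by rw [← neg_div]; exact div_nonneg (by linarith) (by linarith)
      rw [abs_of_nonpos ht0] at *
      rw [mul_neg, neg_div, neg_div] at *
      rw [uIcc_of_le (by linarith)] at hw
      have hw0' : 0 ≤ w := by linarith [hw.1]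
      rw [abs_of_nonneg hw0']
      exact ⟨by linarith [hw.2], by linarith [hw.1], mul_nonpos_of_nonpos_of_nonneg ht0 hw0'⟩
  refine ⟨w, hw0, hw1.1, hw1.2.1, hw1.2.2, ?_⟩
  -- The tangent at `w` evaluated at the other root `0` bounds the derivative at `w` from below.
  have k := h.quadratic_lower (hw1.1.trans ht) (v := 0) (by simpa using h.radius_pos.le)
  rw [h.graph.map_zero] at k
  have k2 : c / 2 * |w| ^ 2 ≤ |deriv g w + t| * |w| := by
    rw [← abs_mul, sq_abs]
    refine le_trans ?_ (le_abs_self _)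
    linarith
  rcases eq_or_ne t 0 with rfl | ht0
  · simp
  · have hwpos : 0 < |w| := lt_of_lt_of_le (by positivity) hw1.2.1
    have k3 : c / 2 * |w| ≤ |deriv g w + t| := by
      rw [pow_two, ← mul_assoc] at k2
      exact le_of_mul_le_mul_right k2 hwpos
    refine le_trans ?_ k3
    have := mul_le_mul_of_nonneg_left hw1.2.1 (half_pos hc).le
    refine le_trans (le_of_eq ?_) this
    field_simp
    ring

/-- On lines at a moderate angle to the tangent, the length cut out by the graph region is affine in
the offset up to an error of second order. -/
lemma exists_affine_approx (h : IsCurvedOn g r c C) :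
    ∃ δ > 0, ∃ A₀ > 0, ∃ K, 0 ≤ K ∧ ∀ t ε, |t| < δ → 0 < ε → A₀ * ε ≤ t ^ 2 →
      ∃ a, ∀ p, |p| ≤ ε →
        |sliceInt ((graphRegion g r).indicator fun _ => 1) t p -
          sliceInt ((graphRegion g r).indicator fun _ => 1) t 0 - a * p| ≤ K * ε ^ 2 / |t| ^ 3 := by
  have hc := h.lower_pos
  have hcC := h.lower_le_upper
  have hC := h.lower_pos.trans_le h.lower_le_upper
  have hr := h.radius_pos
  set k := c / (4 * C) with hk
  have hk0 : 0 < k := by positivity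
  have hk1 : k ≤ 1 / 4 := by rw [hk, div_le_div_iff₀ (by positivity) (by norm_num)]; linarith
  -- At both roots `0` and `w` of level zero the derivative is at least `k * |t|`. The first summand
  -- of `A₀` permits the perturbation of these roots; the second keeps their displacement below `|w|
  -- / 4`, so that they retain their order.
  refine ⟨min (r * c / 8) (r / 8), by positivity, 16 * C / k ^ 2 + 16 * C / k, by positivity,
    8 * C / k ^ 3, by positivity, fun t ε ht hε htε => ?_⟩
  rw [lt_min_iff] at ht
  have ht2 : 0 < t ^ 2 := lt_of_lt_of_le (by positivity) htε
  have ht0 : t ≠ 0 := fun h0 => by simp [h0] at ht2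
  have hta : 0 < |t| := abs_pos.2 ht0
  rw [← sq_abs t, add_mul] at htε
  have hε1 : 16 * C * ε ≤ k ^ 2 * |t| ^ 2 := by
    have : 16 * C / k ^ 2 * ε ≤ |t| ^ 2 := le_trans (le_add_of_nonneg_right (by positivity)) htε
    rw [div_mul_eq_mul_div, div_le_iff₀ (by positivity)] at this
    linarith
  have hε2 : 16 * C * ε ≤ k * |t| ^ 2 := by
    have : 16 * C / k * ε ≤ |t| ^ 2 := le_trans (le_add_of_nonneg_left (by positivity)) htε
    rw [div_mul_eq_mul_div, div_le_iff₀ (by positivity)] at this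
    linarith
  set m := k * |t| with hm
  have hm0 : 0 < m := by positivity
  obtain ⟨w, hw0, hw1, hw2, hw3, hw4⟩ := h.exists_second_root (t := t)
    (by rw [div_le_iff₀ hc]; linarith [ht.1])
  have hmw : m ≤ |deriv g w + t| := by
    refine le_trans (le_of_eq ?_) hw4
    rw [hm, hk]; ring
  have hm00 : m ≤ |deriv g 0 + t| := by
    rw [h.graph.deriv_zero, zero_add, hm]
    nlinarith
  have hwr : |w| < r / 2 := by
    refine hw1.trans_lt ?_
    rw [div_lt_iff₀ hc]
    linarith [ht.1]
  have hl : 2 * ε / m ≤ |t| / (8 * C) := by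
    rw [div_le_div_iff₀ hm0 (by positivity), hm]
    nlinarith
  have hl2 : 2 * ε / m ≤ |w| / 4 := by
    refine hl.trans ?_
    have e : |t| / (8 * C) = |t| / (2 * C) / 4 := by field_simp; norm_num
    rw [e]
    gcongr
  have hw0' : 0 < |w| := lt_of_lt_of_le (by positivity) hw2
  have h0r : |(0 : ℝ)| < r := by simpa using hr
  have h00 : g 0 + t * 0 = 0 := by simp [h.graph.map_zero]
  have hne : (0 : ℝ) ≠ w := fun h0 => by simp [← h0] at hw0'
  have hX0 := h.sliceInt_eq_abs_sub h0r (by linarith) hne h00 hw0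
  -- Each root moves at the rate of the reciprocal derivative. The sign of `t` decides which of the
  -- two is on the right.
  refine ⟨(if 0 < t then 1 else -1) * (1 / (deriv g 0 + t) - 1 / (deriv g w + t)), fun p hp => ?_⟩
  have hlp : 2 * |p| / m ≤ 2 * ε / m := by gcongr
  have hpm : 4 * C * |p| ≤ m ^ 2 := by
    have : 4 * C * |p| ≤ 4 * C * ε := by gcongr
    rw [hm, mul_pow]
    nlinarith
  obtain ⟨s, hs1, hs2, hs3⟩ := h.exists_root h00 hm0 hm00 hpm (by rw [abs_zero]; linarith)
  obtain ⟨s', hs1', hs2', hs3'⟩ := h.exists_root hw0 hm0 hmw hpm (by linarith)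
  rw [sub_zero] at hs1 hs3
  have hsw : |s| ≤ |w| / 4 := by linarith
  have hsw' : |s' - w| ≤ |w| / 4 := by linarith
  have hs'r : |s'| < r := by
    have := abs_add_le (s' - w) w
    rw [sub_add_cancel] at this
    linarith
  have hbnd : 4 * C * p ^ 2 / m ^ 3 + 4 * C * p ^ 2 / m ^ 3 ≤ 8 * C / k ^ 3 * ε ^ 2 / |t| ^ 3 := by
    have e : 4 * C * p ^ 2 / m ^ 3 + 4 * C * p ^ 2 / m ^ 3 = 8 * C / k ^ 3 * |p| ^ 2 / |t| ^ 3 := by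
      rw [hm, sq_abs]; field_simp; ring
    rw [e]
    gcongr
  have a1 := abs_le.1 hsw
  have a2 := abs_le.1 hsw'
  have hfin : |(s - p / (deriv g 0 + t)) - (s' - w - p / (deriv g w + t))| ≤
      8 * C / k ^ 3 * ε ^ 2 / |t| ^ 3 :=
    (abs_sub _ _).trans ((add_le_add hs3 hs3').trans hbnd)
  clear_value k m
  have hsr : |s| < r := by linarith only [hsw, hwr, hr, hw0']
  have hwr' : |w| < r := by linarith only [hwr, hr]
  rcases lt_or_gt_of_ne ht0 with htn | htp
  · have hwp : 0 < w := by
      rcases lt_or_gt_of_ne hne with h1 | h1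
      · exact h1
      · exact absurd hw3 (not_le.2 (mul_pos_of_neg_of_neg htn h1))
    rw [abs_of_pos hwp] at a1 a2
    have hlt : s < s' := by linarith only [a1.2, a2.1, hwp]
    rw [hX0, h.sliceInt_eq_abs_sub hsr hs'r hlt.ne hs2 hs2',
      abs_of_neg (sub_neg.2 hlt), abs_of_neg (sub_neg.2 hwp), if_neg htn.not_gt]
    refine le_trans (le_of_eq ?_) hfin
    rw [← abs_neg]
    congr 1
    ring
  · have hwn : w < 0 := by
      rcases lt_or_gt_of_ne hne with h1 | h1
      · exact absurd hw3 (not_le.2 (mul_pos htp h1))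
      · exact h1
    rw [abs_of_neg hwn] at a1 a2
    have hlt : s' < s := by linarith only [a1.1, a2.2, hwn]
    rw [hX0, h.sliceInt_eq_abs_sub hsr hs'r hlt.ne' hs2 hs2',
      abs_of_pos (sub_pos.2 hlt), abs_of_pos (sub_pos.2 hwn), if_pos htp]
    refine le_trans (le_of_eq ?_) hfin
    congr 1
    ring

end IsCurvedOn

/-- Subadditivity of the square root. The bound is only Hölder of order one half but uniform in `τ`,
even where the chord degenerates. -/
lemma abs_chord_sub_le {b : ℝ} (hb : 0 < b) (τ v v' : ℝ) :
    |chord b τ v - chord b τ v'| ≤ √(4 * b * |v - v'|) / b := by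
  have key : ∀ x y, chord b τ x - chord b τ y ≤ √(4 * b * |x - y|) / b := by
    intro x y
    rw [chord, chord, ← sub_div]
    gcongr
    rw [sub_le_iff_le_add', Real.sqrt_le_iff]
    refine ⟨by positivity, ?_⟩
    have k1 : τ ^ 2 + 4 * b * y ≤ √(τ ^ 2 + 4 * b * y) ^ 2 := by
      rw [Real.sq_sqrt']
      exact le_max_left _ _
    have k2 : 4 * b * |x - y| = √(4 * b * |x - y|) ^ 2 := (Real.sq_sqrt (by positivity)).symm
    have k3 := mul_nonneg (Real.sqrt_nonneg (τ ^ 2 + 4 * b * y)) (Real.sqrt_nonneg (4 * b * |x - y|))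
    have k4 := mul_le_mul_of_nonneg_left (le_abs_self (x - y)) (by positivity : 0 ≤ 4 * b)
    nlinarith
  rw [abs_le']
  refine ⟨key v v', ?_⟩
  rw [neg_sub, abs_sub_comm]
  exact key v' v

lemma IsCurvedGraph.exists_abs_sub_sq_le {g : ℝ → ℝ} (hg : IsCurvedGraph g) {η : ℝ} (hη : 0 < η) :
    ∃ ρ > 0, ∀ u, |u| < ρ → |g u - deriv (deriv g) 0 / 2 * u ^ 2| ≤ η * u ^ 2 := by
  have h1 : HasDerivAt (deriv g) (deriv (deriv g) 0) 0 :=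
    (hg.contDiff_deriv.differentiable (by simp) 0).hasDerivAt
  have h2 := h1.isLittleO.def hη
  obtain ⟨ρ, hρ, h3⟩ := Metric.eventually_nhds_iff.1 h2
  refine ⟨ρ, hρ, fun u hu => ?_⟩
  set f : ℝ → ℝ := fun u => g u - deriv (deriv g) 0 / 2 * u ^ 2 with hf
  have hd : ∀ w, HasDerivAt f (deriv g w - deriv (deriv g) 0 * w) w := by
    intro w
    have := (hg.hasDerivAt w).fun_sub (((hasDerivAt_id w).pow 2).const_mul (deriv (deriv g) 0 / 2))
    refine this.congr_deriv ?_
    simp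
    ring
  have h4 := Convex.norm_image_sub_le_of_norm_hasDerivWithin_le (f := f) (s := uIcc 0 u) (x := 0)
    (y := u) (C := η * |u|) (fun w _ => (hd w).hasDerivWithinAt) (fun w hw => ?_)
    (convex_uIcc 0 u) left_mem_uIcc right_mem_uIcc
  · have hf0 : f 0 = 0 := by simp [hf, hg.map_zero]
    rw [hf0, sub_zero, sub_zero, Real.norm_eq_abs, Real.norm_eq_abs, mul_assoc, abs_mul_abs_self,
      ← pow_two] at h4
    exact h4
  · have hwu : |w| ≤ |u| := by
      have := abs_sub_left_of_mem_uIcc hw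
      simpa using this
    have := h3 (y := w) (by rw [dist_zero_right]; exact hwu.trans_lt hu)
    rw [hg.deriv_zero, sub_zero, sub_zero, smul_eq_mul, mul_comm w, Real.norm_eq_abs w] at this
    exact this.trans (by gcongr)

/-- On lines almost parallel to the tangent, the length cut out by the graph region is close to the
chord of the osculating parabola. -/
lemma IsCurvedOn.exists_chord_approx {g : ℝ → ℝ} {r c C : ℝ} (h : IsCurvedOn g r c C) {A V η : ℝ}
    (hA : 0 ≤ A) (hV : 0 ≤ V) (hη : 0 < η) :
    ∃ e₀ > 0, ∀ e, 0 < e → e < e₀ → ∀ t p, |t| ≤ A * e → |p| ≤ V * e ^ 2 →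
      |sliceInt ((graphRegion g r).indicator fun _ => 1) t p -
        chord (deriv (deriv g) 0 / 2) t p| ≤ η * e := by
  set b := deriv (deriv g) 0 / 2 with hb
  have hb0 : 0 < b := half_pos h.graph.curvature_pos
  have hc := h.lower_pos
  -- With `k` the quadratic lower bound holds for both the graph and the parabola, so both sublevel
  -- sets lie in `|u| ≤ e * R`.
  set k := min (c / 2) b with hk
  have hk0 : 0 < k := by positivity
  set R := A / k + V / k + 1 with hR
  have hR0 : 0 < R := by positivity
  set σ := b * η ^ 2 / 4 / R ^ 2 with hσ
  have hσ0 : 0 < σ := by positivity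
  obtain ⟨ρ, hρ, hg⟩ := h.graph.exists_abs_sub_sq_le hσ0
  refine ⟨min ρ r / R, div_pos (lt_min hρ h.radius_pos) hR0, fun e he hee t p ht hp => ?_⟩
  rw [lt_div_iff₀ hR0, lt_min_iff] at hee
  have hkR : k * R = A + V + k := by rw [hR]; field_simp
  have hR1 : 1 ≤ R := by rw [hR]; linarith [div_nonneg hA hk0.le, div_nonneg hV hk0.le]
  have hsmall : ∀ u, k * u ^ 2 + t * u ≤ p → |u| ≤ e * R := by
    intro u hu
    by_contra hlt
    have hlt := not_le.1 hlt
    have hu0 : 0 < |u| := lt_trans (by positivity) hlt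
    have h1 : -(A * e * |u|) ≤ t * u := by
      have : |t * u| ≤ A * e * |u| := by rw [abs_mul]; gcongr
      exact (abs_le.1 this).1
    have h2 := (le_abs_self p).trans hp
    have h3 : k * (e * R) * |u| < k * |u| * |u| := by gcongr
    have h4 : k * |u| * |u| = k * u ^ 2 := by rw [mul_assoc, abs_mul_abs_self, pow_two]
    have h5 : e ≤ |u| := by nlinarith
    have h6 : V * e * e ≤ V * e * |u| := by gcongr
    have h7 : k * (e * R) * |u| = (A + V + k) * e * |u| := by rw [← hkR]; ring
    nlinarith [mul_pos (mul_pos hk0 he) hu0]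
  -- A change of level by `θ` changes the chord by at most `√(4 * b * θ) / b = η * e`. The sublevel
  -- set is then squeezed between those of the parabola at levels `p ± θ`.
  set θ := b * η ^ 2 / 4 * e ^ 2 with hθ
  have hquad : ∀ u, |u| ≤ e * R → |u| < r ∧ |g u - b * u ^ 2| ≤ θ := by
    intro u hu
    refine ⟨hu.trans_lt hee.2, (hg u (hu.trans_lt hee.1)).trans ?_⟩
    calc σ * u ^ 2 = σ * |u| ^ 2 := by rw [sq_abs]
      _ ≤ σ * (e * R) ^ 2 := by gcongr
      _ = θ := by rw [hσ, hθ]; field_simp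
  have hsub1 : {u | |u| < r ∧ g u + t * u < p} ⊆ {u | b * u ^ 2 + t * u < p + θ} := by
    rintro u ⟨hur, hu⟩
    have h1 := h.lower_sq hur.le
    have h2 : k * u ^ 2 ≤ c / 2 * u ^ 2 := by gcongr; exact min_le_left _ _
    have h3 := (abs_le.1 (hquad u (hsmall u (by linarith))).2).1
    simp only [mem_ofPred_eq]
    linarith
  have hθ0 : 0 ≤ θ := by positivity
  have hsub2 : {u | b * u ^ 2 + t * u < p - θ} ⊆ {u | |u| < r ∧ g u + t * u < p} := by
    intro u hu
    simp only [mem_ofPred_eq] at hu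
    have h2 : k * u ^ 2 ≤ b * u ^ 2 := by gcongr; exact min_le_right _ _
    have h3 := hquad u (hsmall u (by linarith))
    exact ⟨h3.1, by linarith [(abs_le.1 h3.2).2]⟩
  rw [sliceInt_graphRegion h.graph.smooth.continuous]
  have m1 := measureReal_mono (μ := volume) hsub1 (by
    rw [setOf_quadratic_lt hb0]; exact measure_Ioo_lt_top.ne)
  have m2 := measureReal_mono (μ := volume) hsub2 (measure_ne_top_of_subset
    (s := Icc (-r) r) (fun u hu => abs_le.1 hu.1.le) isCompact_Icc.measure_lt_top.ne)
  rw [volume_quadratic_lt hb0] at m1 m2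
  have hroot : √(4 * b * θ) / b = η * e := by
    have e1 : 4 * b * θ = (b * (η * e)) ^ 2 := by rw [hθ]; ring
    rw [e1, Real.sqrt_sq (by positivity)]
    field_simp
  have c1 := abs_le.1 (abs_chord_sub_le hb0 t (p + θ) p)
  have c2 := abs_le.1 (abs_chord_sub_le hb0 t (p - θ) p)
  rw [add_sub_cancel_left, abs_of_nonneg hθ0, hroot] at c1
  rw [sub_sub_cancel_left, abs_neg, abs_of_nonneg hθ0, hroot] at c2
  rw [abs_le]
  constructor <;> linarith [c1.2, c2.1]

/-! ### The discrete second derivative in the offset variable. -/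

/-- The second derivative of the kernel, sampled at the integers, applied to `G`. -/
noncomputable def stencil (φ : ℝ → ℝ) (u : ℝ) (G : ℝ → ℝ) : ℝ :=
  ∑' j : ℤ, deriv (deriv φ) (u - j) * G (j - u)

lemma stencil_const_mul (φ : ℝ → ℝ) (u c : ℝ) (G : ℝ → ℝ) :
    stencil φ u (fun s => c * G s) = c * stencil φ u G := by
  simp only [stencil, mul_left_comm _ c]
  exact tsum_mul_left

lemma stencil_periodic (φ G : ℝ → ℝ) : Function.Periodic (fun u => stencil φ u G) 1 := by
  intro u
  simp only [stencil]
  rw [← (Equiv.addRight (1 : ℤ)).tsum_eq]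
  refine tsum_congr fun j => ?_
  simp only [Equiv.coe_addRight]
  push_cast
  congr 2 <;> ring

section Stencil

variable {φ : ℝ → ℝ} (hφ : IsInterpolationKernel φ)

include hφ

lemma summable_stencil (u : ℝ) (G : ℝ → ℝ) :
    Summable fun j : ℤ => deriv (deriv φ) (u - j) * G (j - u) := by
  obtain ⟨R, -, -, -, h2⟩ := hφ.exists_radius
  refine summable_progression one_pos (τ₀ := -u) (B := R) fun k hk => ?_
  rw [h2, zero_mul]
  rwa [abs_sub_comm, show (k : ℝ) - u = -u + 1 * k by ring]

lemma stencil_sub (u : ℝ) (G G' : ℝ → ℝ) :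
    stencil φ u (fun s => G s - G' s) = stencil φ u G - stencil φ u G' := by
  simp only [stencil, mul_sub]
  exact (summable_stencil hφ u G).tsum_sub (summable_stencil hφ u G')

/-- Differentiate the reproduction identity for `t ^ m` twice; the second derivative vanishes for `m
≤ 1`. -/
lemma tsum_pow_mul_deriv_deriv {m : ℕ} (hm : m ≤ 1) (u : ℝ) :
    ∑' j : ℤ, deriv (deriv φ) (u - j) * (j : ℝ) ^ m = 0 := by
  obtain ⟨R, hR, h0, h1, h2⟩ := hφ.exists_radius
  -- The margin `1` makes one finite index set serve all arguments within distance one of `u`, so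
  -- the sum can be differentiated termwise.
  have hfin := finite_progression one_pos (-u) (R + 1)
  set s := hfin.toFinset with hs
  have hmem : ∀ j : ℤ, j ∉ s → R + 1 < |u - j| := by
    intro j hj
    rw [hs, Set.Finite.mem_toFinset, mem_ofPred_eq, not_le] at hj
    rwa [abs_sub_comm, show (j : ℝ) - u = -u + 1 * j by ring]
  have hev : ∀ᶠ t in 𝓝 u, ∑ j ∈ s, (j : ℝ) ^ m * φ (t - j) = t ^ m := by
    filter_upwards [Metric.ball_mem_nhds u one_pos] with t ht
    rw [← (hφ.exact_two m (by omega) t).tsum_eq]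
    refine (tsum_eq_sum fun j hj => ?_).symm
    rw [h0, mul_zero]
    have := hmem j hj
    rw [Metric.mem_ball, Real.dist_eq] at ht
    have h3 := abs_sub_abs_le_abs_sub (u - j) (u - t)
    rw [sub_sub_sub_cancel_left, abs_sub_comm u t] at h3
    linarith
  have hd1 : ∀ t, HasDerivAt (fun t => ∑ j ∈ s, (j : ℝ) ^ m * φ (t - j))
      (∑ j ∈ s, (j : ℝ) ^ m * deriv φ (t - j)) t := by
    intro t
    refine HasDerivAt.fun_sum fun j _ => HasDerivAt.const_mul _ ?_
    have := (hφ.differentiable (t - j)).hasDerivAt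
    exact this.comp_sub_const t j
  have hd2 : HasDerivAt (fun t => ∑ j ∈ s, (j : ℝ) ^ m * deriv φ (t - j))
      (∑ j ∈ s, (j : ℝ) ^ m * deriv (deriv φ) (u - j)) u := by
    refine HasDerivAt.fun_sum fun j _ => HasDerivAt.const_mul _ ?_
    have := (hφ.differentiable_deriv (u - j)).hasDerivAt
    exact this.comp_sub_const u j
  have e1 : (fun t => ∑ j ∈ s, (j : ℝ) ^ m * deriv φ (t - j)) =
      deriv fun t => ∑ j ∈ s, (j : ℝ) ^ m * φ (t - j) := funext fun t => (hd1 t).deriv.symm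
  have e2 : deriv (deriv fun t : ℝ => t ^ m) u = 0 := by
    interval_cases m
    · simp
    · simp
  have e3 : deriv (deriv fun t => ∑ j ∈ s, (j : ℝ) ^ m * φ (t - j)) u =
      deriv (deriv fun t : ℝ => t ^ m) u := EventuallyEq.deriv_eq (EventuallyEq.deriv hev)
  rw [tsum_eq_sum (s := s) fun j hj => ?_]
  · rw [← e2, ← e3, ← e1, hd2.deriv]
    exact Finset.sum_congr rfl fun j _ => mul_comm _ _
  · rw [h2, zero_mul]
    linarith [hmem j hj]

lemma stencil_affine (u a b : ℝ) : stencil φ u (fun s => a + b * s) = 0 := by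
  have h0 := tsum_pow_mul_deriv_deriv hφ zero_le_one u
  have h1 := tsum_pow_mul_deriv_deriv hφ le_rfl u
  have s0 := summable_stencil hφ u fun _ => 1
  have s1 := summable_stencil hφ u fun s => s + u
  simp only [pow_zero, pow_one, sub_add_cancel] at h0 h1 s0 s1
  have e : ∀ j : ℤ, deriv (deriv φ) (u - j) * (a + b * (j - u)) =
      (a - b * u) * (deriv (deriv φ) (u - j) * 1) + b * (deriv (deriv φ) (u - j) * j) :=
    fun j => by ring
  rw [stencil, tsum_congr e, (s0.mul_left _).tsum_add (s1.mul_left _), tsum_mul_left,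
    tsum_mul_left, h0, h1, mul_zero, mul_zero, add_zero]

/-- The stencil measures the deviation from affine functions. -/
lemma exists_abs_stencil_le : ∃ C R : ℝ, 0 < C ∧ 0 < R ∧ ∀ u G a b η, 0 ≤ η →
    (∀ s, |s| ≤ R → |G s - (a + b * s)| ≤ η) → |stencil φ u G| ≤ C * η := by
  obtain ⟨R, hR, -, -, h2⟩ := hφ.exists_radius
  obtain ⟨M, hM, -, -, hM2⟩ := hφ.exists_bound
  refine ⟨M * (2 * R / 1 + 1), R, by positivity, hR, fun u G a b η hη h => ?_⟩
  have e : stencil φ u G = stencil φ u fun s => G s - (a + b * s) := by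
    rw [stencil_sub hφ, stencil_affine hφ, sub_zero]
  rw [e, mul_right_comm]
  have e2 : ∀ j : ℤ, (j : ℝ) - u = -u + 1 * j := fun j => by ring
  refine abs_tsum_progression_le one_pos (τ₀ := -u) hR.le (by positivity) (fun k hk => ?_)
    fun k hk => ?_
  · rw [← e2] at hk
    rw [abs_mul]
    have := h _ hk
    have := hM2 (u - k)
    gcongr
  · rw [h2, zero_mul]
    rwa [abs_sub_comm, e2]

lemma continuous_stencil {G : ℝ → ℝ → ℝ} (hG : Continuous fun z : ℝ × ℝ => G z.1 z.2) :
    Continuous fun z : ℝ × ℝ => stencil φ z.2 (G z.1) := by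
  obtain ⟨R, hR, -, -, h2⟩ := hφ.exists_radius
  rw [continuous_iff_continuousAt]
  intro z
  have hfin := finite_progression one_pos (-z.2) (R + 1)
  have hc := hφ.continuous_deriv_deriv
  have hcont : Continuous fun w : ℝ × ℝ => ∑ j ∈ hfin.toFinset,
      deriv (deriv φ) (w.2 - j) * G w.1 (j - w.2) := by
    refine continuous_finsetSum _ fun j _ => ?_
    exact (hc.comp (by fun_prop)).mul
      (hG.comp (by fun_prop : Continuous fun w : ℝ × ℝ => (w.1, (j : ℝ) - w.2)))
  refine hcont.continuousAt.congr ?_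
  have hnear : ∀ᶠ w : ℝ × ℝ in 𝓝 z, |w.2 - z.2| < 1 :=
    continuous_snd.continuousAt (Metric.ball_mem_nhds z.2 one_pos)
  filter_upwards [hnear] with w hw
  refine (tsum_eq_sum fun j hj => ?_).symm
  rw [Set.Finite.mem_toFinset, mem_ofPred_eq, not_le] at hj
  rw [h2, zero_mul]
  have h3 := abs_sub_abs_le_abs_sub (-z.2 + 1 * j) (w.2 - z.2)
  rw [show -z.2 + 1 * (j : ℝ) - (w.2 - z.2) = j - w.2 by ring, abs_sub_comm (j : ℝ)] at h3
  linarith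

/-- Averaging the sum of integer translates over a period unfolds to the integral over the line. -/
lemma integral_stencil {G : ℝ → ℝ} (hG : Continuous G) :
    ∫ u in (0 : ℝ)..1, stencil φ u G = ∫ t, deriv (deriv φ) t * G (-t) := by
  obtain ⟨R, hR, -, -, h2⟩ := hφ.exists_radius
  have hc := hφ.continuous_deriv_deriv
  have hint : Integrable fun t => deriv (deriv φ) t * G (-t) := by
    refine (hc.mul (hG.comp continuous_neg)).integrable_of_hasCompactSupport ?_
    exact hφ.compactSupport.deriv.deriv.mul_right
  have hsum := hint.hasSum_intervalIntegral_comp_add_int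
  rw [← hsum.tsum_eq, ← (Equiv.neg ℤ).tsum_eq]
  have hfin := finite_progression one_pos 0 (R + 1)
  have hz : ∀ u ∈ Icc (0 : ℝ) 1, ∀ j : ℤ, j ∉ hfin.toFinset → deriv (deriv φ) (u - j) = 0 := by
    intro u hu j hj
    rw [Set.Finite.mem_toFinset, mem_ofPred_eq, not_le] at hj
    apply h2
    have h3 := abs_sub_abs_le_abs_sub (0 + 1 * (j : ℝ)) u
    rw [show 0 + 1 * (j : ℝ) - u = j - u by ring, abs_sub_comm (j : ℝ), abs_of_nonneg hu.1] at h3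
    linarith [hu.2]
  have e1 : ∫ u in (0 : ℝ)..1, stencil φ u G = ∫ u in (0 : ℝ)..1, ∑ j ∈ hfin.toFinset,
      deriv (deriv φ) (u - j) * G (j - u) := by
    refine intervalIntegral.integral_congr fun u hu => ?_
    rw [uIcc_of_le zero_le_one] at hu
    exact tsum_eq_sum fun j hj => by rw [hz u hu j hj, zero_mul]
  have hci : ∀ j : ℤ, Continuous fun u : ℝ => deriv (deriv φ) (u - j) * G (j - u) :=
    fun j => (hc.comp (continuous_sub_right _)).mul (hG.comp (continuous_sub_left _))
  rw [e1, intervalIntegral.integral_finsetSum fun j _ => (hci j).intervalIntegrable _ _]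
  rw [tsum_eq_sum (s := hfin.toFinset) fun j hj => ?_]
  · refine Finset.sum_congr rfl fun j _ => intervalIntegral.integral_congr fun u _ => ?_
    simp only [Equiv.neg_apply, Int.cast_neg, ← sub_eq_add_neg, neg_sub]
  · have e2 : EqOn (fun u => deriv (deriv φ) (u + ((Equiv.neg ℤ j : ℤ) : ℝ)) *
        G (-(u + ((Equiv.neg ℤ j : ℤ) : ℝ)))) (fun _ => 0) (uIcc 0 1) := by
      intro u hu
      rw [uIcc_of_le zero_le_one] at hu
      simp only [Equiv.neg_apply, Int.cast_neg, ← sub_eq_add_neg]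
      rw [hz u hu j hj, zero_mul]
    rw [intervalIntegral.integral_congr e2]
    simp

/-- The main contribution as a periodic family. -/
lemma isPeriodicFamily_stencil {A : ℝ} (hA : 0 ≤ A) (b h : ℝ) :
    IsPeriodicFamily (fun τ u => max 0 (min 1 (A + 1 - |τ|)) *
      stencil φ u fun s => chord b τ (h + s)) (A + 1) where
  continuous := by
    refine Continuous.mul (by fun_prop) (continuous_stencil hφ (G := fun τ s => chord b τ (h + s)) ?_)
    exact (continuous_chord b).comp (by fun_prop : Continuous fun z : ℝ × ℝ => (z.1, h + z.2))
  periodic τ := by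
    intro u
    simp only [stencil_periodic φ (fun s => chord b τ (h + s)) u]
  support τ u hτ := by
    rw [max_eq_left ((min_le_right _ _).trans (by linarith)), zero_mul]
  nonneg := by linarith

lemma integral_stencil_chord (b h τ : ℝ) :
    ∫ u in (0 : ℝ)..1, stencil φ u (fun s => chord b τ (h + s)) = angleProfile φ b h τ := by
  rw [integral_stencil hφ]
  · rfl
  · exact (continuous_chord b).comp (by fun_prop : Continuous fun s : ℝ => (τ, h + s))

end Stencil

/-! ### The abstract slice model: stencils at large, moderate and small angles. -/

/-- The behaviour of slice integrals `H` near the tangent line that determines the limit: up to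
terms that are negligible, `H` is `Δ` times the slice integral `X` of a convex region with
osculating parabola `b u ^ 2`. -/
structure IsSliceModel (H X : ℝ → ℝ → ℝ) (b Δ : ℝ) : Prop where
  curvature_pos : 0 < b
  slope : ∃ δ > 0, ∀ t, t ≠ 0 → |t| < δ → HasSlope H t
  remainder : ∃ δ > 0, ∃ K, 0 ≤ K ∧ ∀ t p ε, |t| < δ → 0 < ε → ε < δ → |p| ≤ ε →
    |(H t p - H t 0) - Δ * (X t p - X t 0)| ≤ K * ε
  affine : ∃ δ > 0, ∃ A₀ > 0, ∃ K, 0 ≤ K ∧ ∀ t ε, |t| < δ → 0 < ε → A₀ * ε ≤ t ^ 2 →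
    ∃ a, ∀ p, |p| ≤ ε → |X t p - X t 0 - a * p| ≤ K * ε ^ 2 / |t| ^ 3
  parabola : ∀ A V η, 0 ≤ A → 0 ≤ V → 0 < η → ∃ e₀ > 0, ∀ e, 0 < e → e < e₀ → ∀ t p,
    |t| ≤ A * e → |p| ≤ V * e ^ 2 → |X t p - chord b t p| ≤ η * e

/-- The Radon transform at angle `β` to the reference direction and at offset `ε * (s + h)`, in
terms of the slice integrals `H`. -/
noncomputable def sliceRadon (H : ℝ → ℝ → ℝ) (ε β h s : ℝ) : ℝ :=
  H (Real.tan β) (ε * (s + h) / Real.cos β) / Real.cos β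

lemma half_le_cos {β : ℝ} (hβ : |β| ≤ 1) : 1 / 2 ≤ Real.cos β := by
  have h1 := Real.one_sub_sq_div_two_le_cos (x := β)
  have h2 : β ^ 2 ≤ 1 := by rw [← sq_abs]; exact pow_le_one₀ (abs_nonneg _) hβ
  linarith

lemma abs_tan_le {β : ℝ} (hβ : |β| ≤ 1) : |Real.tan β| ≤ 2 * |β| := by
  have h1 := half_le_cos hβ
  have h0 : 0 < Real.cos β := by linarith
  rw [Real.tan_eq_sin_div_cos, abs_div, abs_of_pos h0, div_le_iff₀ h0]
  have h2 := Real.abs_sin_le_abs (x := β)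
  nlinarith [abs_nonneg β]

lemma abs_le_abs_tan {β : ℝ} (hβ : |β| ≤ 1) : |β| ≤ |Real.tan β| := by
  have hpi := Real.pi_gt_three
  have key : ∀ x, 0 ≤ x → x ≤ 1 → x ≤ Real.tan x := by
    intro x hx hx1
    rcases hx.eq_or_lt with rfl | hx0
    · simp
    · exact (Real.lt_tan hx0 (by linarith)).le
  rcases le_total 0 β with h | h
  · rw [abs_of_nonneg h] at hβ ⊢
    exact (key β h hβ).trans (le_abs_self _)
  · rw [abs_of_nonpos h] at hβ ⊢
    rw [← abs_neg, ← Real.tan_neg]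
    exact (key (-β) (neg_nonneg.2 h) hβ).trans (le_abs_self _)

lemma abs_offset_le {ε β h s R Y : ℝ} (hε : 0 < ε) (hβ : |β| ≤ 1) (hs : |s| ≤ R) (hh : |h| ≤ Y) :
    |ε * (s + h) / Real.cos β| ≤ 2 * (R + Y) * ε := by
  have h1 := half_le_cos hβ
  have h0 : 0 < Real.cos β := by linarith
  rw [abs_div, abs_mul, abs_of_pos hε, abs_of_pos h0, div_le_iff₀ h0]
  have h2 : |s + h| ≤ R + Y := (abs_add_le _ _).trans (add_le_add hs hh)
  have h3 : 0 ≤ R + Y := (abs_nonneg _).trans h2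
  calc ε * |s + h| ≤ ε * (R + Y) := by gcongr
    _ = 2 * (R + Y) * ε * (1 / 2) := by ring
    _ ≤ 2 * (R + Y) * ε * Real.cos β := by gcongr

/-- Constants with which the stencil of `sliceRadon` is controlled by the deviation of the slice
integrals from affine functions of the offset. -/
structure StencilBound (φ : ℝ → ℝ) (Y C P R : ℝ) : Prop where
  const_pos : 0 < C
  window_pos : 0 < P
  const_le : ∀ u G θ, 0 ≤ θ → (∀ s, |s| ≤ R → |G s| ≤ θ) → |stencil φ u G| ≤ C * θ
  offset_le : ∀ ε β h s, 0 < ε → |β| ≤ 1 → |s| ≤ R → |h| ≤ Y →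
    |ε * (s + h) / Real.cos β| ≤ P * ε
  slice_le : ∀ (H : ℝ → ℝ → ℝ) u ε β h c θ, 0 < ε → |β| ≤ 1 → |h| ≤ Y → 0 ≤ θ →
    (∀ p, |p| ≤ P * ε → |H (Real.tan β) p - H (Real.tan β) 0 - c * p| ≤ θ) →
    |stencil φ u (sliceRadon H ε β h)| ≤ C * θ

lemma exists_stencilBound {φ : ℝ → ℝ} (hφ : IsInterpolationKernel φ) {Y : ℝ} (hY : 0 ≤ Y) :
    ∃ C P R, StencilBound φ Y C P R := by
  obtain ⟨C, R, hC, hR, h⟩ := exists_abs_stencil_le hφ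
  refine ⟨2 * C, 2 * (R + Y), R, by positivity, by positivity, fun u G θ hθ hG => ?_,
    fun ε β h s hε hβ hs hh => abs_offset_le hε hβ hs hh,
    fun H u ε β h' c θ hε hβ hh hθ hb => ?_⟩
  · refine (h u G 0 0 θ hθ fun s hs => by simpa using hG s hs).trans ?_
    have := mul_nonneg hC.le hθ
    linarith
  · have h1 := half_le_cos hβ
    have h0 : 0 < Real.cos β := by linarith
    have h2 := h u (sliceRadon H ε β h')
      ((H (Real.tan β) 0 + c * ε * h' / Real.cos β) / Real.cos β)
      (c * ε / Real.cos β / Real.cos β) (2 * θ) (by positivity) fun s hs => ?_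
    · linarith
    · have e : sliceRadon H ε β h' s -
          ((H (Real.tan β) 0 + c * ε * h' / Real.cos β) / Real.cos β +
            c * ε / Real.cos β / Real.cos β * s) =
          (H (Real.tan β) (ε * (s + h') / Real.cos β) - H (Real.tan β) 0 -
            c * (ε * (s + h') / Real.cos β)) / Real.cos β := by
        rw [sliceRadon]; field_simp; ring
      rw [e, abs_div, abs_of_pos h0, div_le_iff₀ h0]
      have h3 := hb _ (abs_offset_le hε hβ hs hh)
      nlinarith

/-- The slope condition at `t₁` provides one radius and one slope for all nearby `t`, so compactness
gives a common radius. -/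
lemma exists_uniform_slope {H : ℝ → ℝ → ℝ} {K : Set ℝ} (hK : IsCompact K)
    (h : ∀ t ∈ K, HasSlope H t) {η : ℝ} (hη : 0 < η) :
    ∃ e > 0, ∀ t ∈ K, ∃ c, ∀ p, |p| < e → |H t p - H t 0 - c * p| ≤ η * |p| := by
  refine hK.induction_on (p := fun S => ∃ e > 0, ∀ t ∈ S, ∃ c, ∀ p, |p| < e →
    |H t p - H t 0 - c * p| ≤ η * |p|) ⟨1, one_pos, fun t ht => absurd ht (by simp)⟩ ?_ ?_ ?_
  · rintro S T hST ⟨e, he, h1⟩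
    exact ⟨e, he, fun t ht => h1 t (hST ht)⟩
  · rintro S T ⟨e, he, h1⟩ ⟨e', he', h2⟩
    refine ⟨min e e', lt_min he he', fun t ht => ?_⟩
    rcases ht with ht | ht
    · obtain ⟨c, hc⟩ := h1 t ht
      exact ⟨c, fun p hp => hc p (hp.trans_le (min_le_left _ _))⟩
    · obtain ⟨c, hc⟩ := h2 t ht
      exact ⟨c, fun p hp => hc p (hp.trans_le (min_le_right _ _))⟩
  · intro t ht
    obtain ⟨c, hc⟩ := h t ht
    obtain ⟨e, he, h1⟩ := hc η hη
    exact ⟨Metric.ball t e, nhdsWithin_le_nhds (Metric.ball_mem_nhds t he), e, he,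
      fun t' ht' => ⟨c, fun p hp => h1 t' p ht' hp⟩⟩

namespace IsSliceModel

variable {H X : ℝ → ℝ → ℝ} {b Δ : ℝ} {φ : ℝ → ℝ} {Y C P R : ℝ}

/-- On a compact set of nonzero slopes the deviation from affine functions of the offset is
uniformly `o(ε)` over a window of width `O(ε)`, and the stencil sees only this deviation. -/
lemma exists_far_bound (hH : IsSliceModel H X b Δ) :
    ∃ δ > 0, δ ≤ 1 ∧ ∀ φ Y C P R, StencilBound φ Y C P R → ∀ ρ > 0, ∀ ν > 0,
      ∀ᶠ ε in 𝓝[>] (0 : ℝ), ∀ u β h, ρ ≤ |β| → |β| ≤ δ → |h| ≤ Y →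
        |stencil φ u (sliceRadon H ε β h)| ≤ ν * ε := by
  obtain ⟨δ, hδ, hs⟩ := hH.slope
  refine ⟨min 1 (δ / 4), by positivity, min_le_left _ _, fun φ Y C P R hS ρ hρ ν hν => ?_⟩
  have hC := hS.const_pos
  have hP := hS.window_pos
  have hK : IsCompact {t : ℝ | ρ ≤ |t| ∧ |t| ≤ δ / 2} := by
    refine (isCompact_Icc (a := -(δ / 2)) (b := δ / 2)).of_isClosed_subset ?_
      fun t ht => abs_le.1 ht.2
    exact (isClosed_le continuous_const continuous_abs).inter
      (isClosed_le continuous_abs continuous_const)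
  obtain ⟨e, he, h1⟩ := exists_uniform_slope hK (H := H) (fun t ht => hs t
    (fun h0 => by have := ht.1; rw [h0, abs_zero] at this; linarith)
    (ht.2.trans_lt (by linarith))) (η := ν / (C * P)) (by positivity)
  filter_upwards [self_mem_nhdsWithin, nhdsWithin_le_nhds (gt_mem_nhds (div_pos he hP))]
    with ε hε hεe u β h hβ1 hβ2 hh
  have hε : 0 < ε := hε
  have hβ : |β| ≤ 1 := hβ2.trans (min_le_left _ _)
  obtain ⟨c, hc⟩ := h1 (Real.tan β) ⟨hβ1.trans (abs_le_abs_tan hβ),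
    (abs_tan_le hβ).trans (by linarith [hβ2.trans (min_le_right _ _)])⟩
  rw [lt_div_iff₀ hP, mul_comm] at hεe
  refine (hS.slice_le H u ε β h c (ν / (C * P) * (P * ε)) hε hβ hh (by positivity)
    fun p hp => ?_).trans (le_of_eq ?_)
  · refine (hc p (hp.trans_lt hεe)).trans ?_
    gcongr
  · field_simp

/-- The stencil annihilates the values at offset zero, so a bound for the increments of `H - Δ X`
suffices; the approximating slope is taken to be zero. -/
lemma exists_remainder_bound (hH : IsSliceModel H X b Δ) :
    ∃ δ > 0, δ ≤ 1 ∧ ∀ φ, IsInterpolationKernel φ → ∀ Y C P R, StencilBound φ Y C P R →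
      ∃ C', 0 ≤ C' ∧ ∀ᶠ ε in 𝓝[>] (0 : ℝ), ∀ u β h, |β| ≤ δ → |h| ≤ Y →
        |stencil φ u (sliceRadon H ε β h) - Δ * stencil φ u (sliceRadon X ε β h)| ≤ C' * ε := by
  obtain ⟨δ, hδ, K, hK, h1⟩ := hH.remainder
  refine ⟨min 1 (δ / 4), by positivity, min_le_left _ _, fun φ hφ Y C P R hS => ?_⟩
  have hC := hS.const_pos
  have hP := hS.window_pos
  refine ⟨C * (K * P), by positivity, ?_⟩
  filter_upwards [self_mem_nhdsWithin, nhdsWithin_le_nhds (gt_mem_nhds (div_pos hδ hP))]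
    with ε hε hεe u β h hβ2 hh
  have hε : 0 < ε := hε
  have hβ : |β| ≤ 1 := hβ2.trans (min_le_left _ _)
  rw [lt_div_iff₀ hP, mul_comm] at hεe
  have e : stencil φ u (sliceRadon H ε β h) - Δ * stencil φ u (sliceRadon X ε β h) =
      stencil φ u (sliceRadon (fun t p => H t p - Δ * X t p) ε β h) := by
    rw [← stencil_const_mul, ← stencil_sub hφ]
    congr 1
    ext s
    simp only [sliceRadon]
    ring
  rw [e]
  refine (hS.slice_le _ u ε β h 0 (K * (P * ε)) hε hβ hh (by positivity)
    fun p hp => ?_).trans (le_of_eq (by ring))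
  refine le_trans (le_of_eq ?_) (h1 (Real.tan β) p (P * ε)
    ((abs_tan_le hβ).trans_lt (by linarith [hβ2.trans (min_le_right _ _)])) (by positivity) hεe hp)
  congr 1
  ring

lemma exists_moderate_bound (hH : IsSliceModel H X b Δ) :
    ∃ δ > 0, δ ≤ 1 ∧ ∀ φ Y C P R, StencilBound φ Y C P R →
      ∃ C' A₁, 0 ≤ C' ∧ 0 < A₁ ∧ ∀ ε u β h, 0 < ε → A₁ * ε ≤ β ^ 2 → |β| ≤ δ → |h| ≤ Y →
        |stencil φ u (sliceRadon X ε β h)| ≤ C' * ε ^ 2 / |β| ^ 3 := by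
  obtain ⟨δ, hδ, A₀, hA₀, K, hK, h1⟩ := hH.affine
  refine ⟨min 1 (δ / 4), by positivity, min_le_left _ _, fun φ Y C P R hS => ?_⟩
  have hC := hS.const_pos
  have hP := hS.window_pos
  refine ⟨C * (K * P ^ 2), A₀ * P, by positivity, by positivity, fun ε u β h hε hβε hβ2 hh => ?_⟩
  have hβ : |β| ≤ 1 := hβ2.trans (min_le_left _ _)
  have hβ0 : 0 < |β| := by
    rw [abs_pos]
    rintro rfl
    have : 0 < A₀ * P * ε := by positivity
    simp at hβε
    linarith
  have htan := abs_le_abs_tan hβ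
  obtain ⟨a, ha⟩ := h1 (Real.tan β) (P * ε)
    ((abs_tan_le hβ).trans_lt (by linarith [hβ2.trans (min_le_right _ _)])) (by positivity) (by
      rw [← mul_assoc]
      refine hβε.trans ?_
      rw [← sq_abs, ← sq_abs (Real.tan β)]
      gcongr)
  refine (hS.slice_le X u ε β h a (K * (P * ε) ^ 2 / |β| ^ 3) hε hβ hh (by positivity)
    fun p hp => ?_).trans (le_of_eq (by ring))
  refine (ha p hp).trans ?_
  gcongr

end IsSliceModel

/-- Parabolic scaling: angles scale like `e`, offsets like `e ^ 2`. With `e = √ε` this singles out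
angles of order `√ε`. -/
lemma chord_mul {e : ℝ} (he : 0 ≤ e) (b τ v : ℝ) :
    chord b (e * τ) (e ^ 2 * v) = e * chord b τ v := by
  rw [chord, chord, show (e * τ) ^ 2 + 4 * b * (e ^ 2 * v) = e ^ 2 * (τ ^ 2 + 4 * b * v) by ring,
    Real.sqrt_mul (by positivity), Real.sqrt_sq he, mul_div_assoc]

lemma exists_chord_modulus (b A V : ℝ) {η : ℝ} (hη : 0 < η) :
    ∃ ρ > 0, ∀ τ v τ' v' m, |τ| ≤ A → |v| ≤ V → |τ' - τ| ≤ ρ → |v' - v| ≤ ρ → |m - 1| ≤ ρ →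
      |chord b τ' v' * m - chord b τ v| ≤ η := by
  have hc : Continuous fun z : ℝ × ℝ × ℝ => chord b z.1 z.2.1 * z.2.2 :=
    ((continuous_chord b).comp (by fun_prop : Continuous fun z : ℝ × ℝ × ℝ => (z.1, z.2.1))).mul
      (by fun_prop)
  have hK : IsCompact (Metric.closedBall (0 : ℝ × ℝ × ℝ) (|A| + |V| + 2)) :=
    isCompact_closedBall _ _
  have hu := hK.uniformContinuousOn_of_continuous hc.continuousOn
  rw [Metric.uniformContinuousOn_iff] at hu
  obtain ⟨ρ, hρ, h⟩ := hu η hη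
  have hmem : ∀ x y z : ℝ, |x| ≤ |A| + 1 → |y| ≤ |V| + 1 → |z| ≤ 2 →
      (x, y, z) ∈ Metric.closedBall (0 : ℝ × ℝ × ℝ) (|A| + |V| + 2) := by
    intro x y z hx hy hz
    have := abs_nonneg A
    have := abs_nonneg V
    rw [mem_closedBall_zero_iff, Prod.norm_def, Prod.norm_def]
    simp only [Real.norm_eq_abs]
    exact max_le (by linarith) (max_le (by linarith) (by linarith))
  refine ⟨min (ρ / 2) 1, by positivity, fun τ v τ' v' m hτ hv hτ' hv' hm => ?_⟩
  have hA := le_abs_self A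
  have hV := le_abs_self V
  have h1 := min_le_left (ρ / 2) 1
  have h2 := min_le_right (ρ / 2) 1
  have k1 := abs_sub_abs_le_abs_sub τ' τ
  have k2 := abs_sub_abs_le_abs_sub v' v
  have k3 := abs_sub_abs_le_abs_sub m 1
  rw [abs_one] at k3
  have := h (τ', v', m) (hmem _ _ _ (by linarith) (by linarith) (by linarith)) (τ, v, 1)
    (hmem _ _ _ (by linarith) (by linarith) (by norm_num)) (by
      rw [Prod.dist_eq, Prod.dist_eq]
      simp only [Real.dist_eq]
      exact max_lt (by linarith) (max_lt (by linarith) (by linarith)))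
  rw [Real.dist_eq, mul_one] at this
  exact this.le

lemma exists_tan_estimate {ν : ℝ} (hν : 0 < ν) :
    ∃ ρ > 0, ρ ≤ 1 ∧ ∀ β, |β| ≤ ρ → |Real.tan β - β| ≤ ν * |β| ∧ |(Real.cos β)⁻¹ - 1| ≤ ν := by
  have h1 := (Real.hasDerivAt_tan (x := 0) (by simp)).isLittleO.def hν
  have hc : ContinuousAt (fun β => (Real.cos β)⁻¹) 0 :=
    Real.continuous_cos.continuousAt.inv₀ (by simp)
  have h2 := hc (Metric.closedBall_mem_nhds _ hν)
  obtain ⟨ρ, hρ, h3⟩ := Metric.eventually_nhds_iff.1 (h1.and h2)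
  refine ⟨min (ρ / 2) 1, by positivity, min_le_right _ _, fun β hβ => ?_⟩
  have := h3 (y := β) (by
    rw [dist_zero_right, Real.norm_eq_abs]
    exact hβ.trans_lt ((min_le_left _ _).trans_lt (by linarith)))
  simpa [Real.dist_eq] using this

/-- Replace `X` by the chord, at a cost of `o(√ε)`, and rescale. The scaled arguments differ from `β
/ √ε` and `h + s` only through `tan β / β`, `cos β` and `h' - h`, all of which are controlled. -/
lemma IsSliceModel.chord_approx {H X : ℝ → ℝ → ℝ} {b Δ : ℝ} (hH : IsSliceModel H X b Δ)
    {φ : ℝ → ℝ} (hφ : IsInterpolationKernel φ) {Y C P R : ℝ} (hS : StencilBound φ Y C P R)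
    {A : ℝ} (hA : 0 ≤ A) (h : ℝ) {ν : ℝ} (hν : 0 < ν) :
    ∃ ρ > 0, ∀ᶠ ε in 𝓝[>] (0 : ℝ), ∀ u β h', |β| ≤ A * √ε → |h'| ≤ Y → |h' - h| ≤ ρ →
      |stencil φ u (sliceRadon X ε β h') -
        √ε * stencil φ u (fun s => chord b (β / √ε) (h + s))| ≤ ν * √ε := by
  have hC := hS.const_pos
  have hP := hS.window_pos
  obtain ⟨ρ, hρ, hmod⟩ := exists_chord_modulus b A (|R| + |h|) (η := ν / (2 * C)) (by positivity)
  obtain ⟨e₀, he₀, hX⟩ := hH.parabola (2 * A) P (ν / (4 * C)) (by positivity) hP.le (by positivity)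
  set D := 2 * (A + |R| + |Y| + 1) with hD
  have hD0 : 0 < D := by positivity
  obtain ⟨ρ', hρ', hρ1, htan⟩ := exists_tan_estimate (ν := ρ / D) (by positivity)
  have hsqrt : Tendsto (fun ε : ℝ => √ε) (𝓝[>] 0) (𝓝 0) := by
    have := (Real.continuous_sqrt.tendsto 0).mono_left (nhdsWithin_le_nhds (s := Ioi 0))
    rwa [Real.sqrt_zero] at this
  have hsqrtA : Tendsto (fun ε : ℝ => A * √ε) (𝓝[>] 0) (𝓝 0) := by
    simpa using hsqrt.const_mul A
  refine ⟨ρ / 2, half_pos hρ, ?_⟩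
  filter_upwards [self_mem_nhdsWithin, hsqrt.eventually (gt_mem_nhds he₀),
    hsqrtA.eventually (gt_mem_nhds hρ')] with ε hε hεe hεA u β h' hβ hh' hhh
  have hε : 0 < ε := hε
  set e := √ε with he
  have he0 : 0 < e := Real.sqrt_pos.2 hε
  have hee : ε = e ^ 2 := (Real.sq_sqrt hε.le).symm
  obtain ⟨ht1, ht2⟩ := htan β (hβ.trans hεA.le)
  have hβ1 : |β| ≤ 1 := (hβ.trans hεA.le).trans hρ1
  have hcos := half_le_cos hβ1
  have hcos0 : 0 < Real.cos β := by linarith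
  rw [← stencil_const_mul, ← stencil_sub hφ]
  refine (hS.const_le u _ (ν / C * e) (by positivity) fun s hs => ?_).trans
    (le_of_eq (by field_simp))
  have hoff := hS.offset_le ε β h' s hε hβ1 hs hh'
  have k1 := hX e he0 hεe (Real.tan β) (ε * (s + h') / Real.cos β)
    ((abs_tan_le hβ1).trans (by linarith)) (by rwa [← hee])
  have hbβ : |β / e| ≤ A := by rw [abs_div, abs_of_pos he0, div_le_iff₀ he0]; exact hβ
  have hRs := hs.trans (le_abs_self R)
  have hYh := hh'.trans (le_abs_self Y)
  have k2 := hmod (β / e) (h + s) (Real.tan β / e) ((s + h') / Real.cos β) (Real.cos β)⁻¹ hbβ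
    ((abs_add_le _ _).trans (by linarith)) (by
      rw [← sub_div, abs_div, abs_of_pos he0, div_le_iff₀ he0]
      refine ht1.trans ?_
      calc ρ / D * |β| ≤ ρ / D * (A * e) := by gcongr
        _ = A / D * (ρ * e) := by ring
        _ ≤ 1 * (ρ * e) := by
          gcongr
          rw [div_le_one hD0, hD]
          linarith [abs_nonneg R, abs_nonneg Y]
        _ = ρ * e := one_mul _) (by
      have e1 : (s + h') / Real.cos β - (h + s) =
          (s + h') * ((Real.cos β)⁻¹ - 1) + (h' - h) := by ring
      rw [e1]
      refine (abs_add_le _ _).trans ?_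
      rw [abs_mul]
      have k3 : |s + h'| ≤ |R| + |Y| := (abs_add_le _ _).trans (by linarith)
      have k4 : |s + h'| * |(Real.cos β)⁻¹ - 1| ≤ (|R| + |Y|) * (ρ / D) := by gcongr
      have k5 : (|R| + |Y|) * (ρ / D) ≤ ρ / 2 := by
        rw [mul_div_assoc', div_le_div_iff₀ hD0 two_pos, hD]
        nlinarith
      linarith) (ht2.trans (div_le_self hρ.le (by
        rw [hD]; linarith [abs_nonneg R, abs_nonneg Y])))
  have e2 : chord b (Real.tan β) (ε * (s + h') / Real.cos β) =
      e * chord b (Real.tan β / e) ((s + h') / Real.cos β) := by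
    rw [← chord_mul he0.le, mul_div_cancel₀ _ he0.ne', ← hee, mul_div_assoc]
  have e3 : sliceRadon X ε β h' s - e * chord b (β / e) (h + s) =
      (X (Real.tan β) (ε * (s + h') / Real.cos β) -
        chord b (Real.tan β) (ε * (s + h') / Real.cos β)) / Real.cos β +
      e * (chord b (Real.tan β / e) ((s + h') / Real.cos β) * (Real.cos β)⁻¹ -
        chord b (β / e) (h + s)) := by
    rw [sliceRadon, e2]
    ring
  rw [e3]
  refine (abs_add_le _ _).trans ?_
  have k6 : |(X (Real.tan β) (ε * (s + h') / Real.cos β) -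
      chord b (Real.tan β) (ε * (s + h') / Real.cos β)) / Real.cos β| ≤ ν / (2 * C) * e := by
    rw [abs_div, abs_of_pos hcos0, div_le_iff₀ hcos0]
    refine k1.trans ?_
    calc ν / (4 * C) * e = ν / (2 * C) * e * (1 / 2) := by ring
      _ ≤ ν / (2 * C) * e * Real.cos β := by gcongr
  rw [abs_mul, abs_of_pos he0]
  have k7 := mul_le_mul_of_nonneg_left k2 he0.le
  have e4 : ν / C * e = ν / (2 * C) * e + e * (ν / (2 * C)) := by field_simp; norm_num
  rw [e4]
  exact add_le_add k6 k7

/-! ### Summation over the angles. -/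

/-- The trapezoidal cut-off that is `1` for `|τ| ≤ A` and `0` for `A + 1 ≤ |τ|`. -/
noncomputable def trapezoid (A τ : ℝ) : ℝ := max 0 (min 1 (A + 1 - |τ|))

lemma trapezoid_nonneg (A τ : ℝ) : 0 ≤ trapezoid A τ := le_max_left _ _

lemma trapezoid_le_one (A τ : ℝ) : trapezoid A τ ≤ 1 := max_le zero_le_one (min_le_left _ _)

lemma trapezoid_eq_one {A τ : ℝ} (h : |τ| ≤ A) : trapezoid A τ = 1 := by
  rw [trapezoid, min_eq_left (by linarith), max_eq_right zero_le_one]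

lemma trapezoid_eq_zero {A τ : ℝ} (h : A + 1 < |τ|) : trapezoid A τ = 0 :=
  max_eq_left ((min_le_right _ _).trans (by linarith))

lemma tendsto_sqrt_nhdsGT : Tendsto (fun ε : ℝ => √ε) (𝓝[>] 0) (𝓝 0) := by
  have := (Real.continuous_sqrt.tendsto 0).mono_left (nhdsWithin_le_nhds (s := Ioi 0))
  rwa [Real.sqrt_zero] at this

lemma eventually_mul_sqrt_le (c : ℝ) {η : ℝ} (hη : 0 < η) : ∀ᶠ ε in 𝓝[>] (0 : ℝ), c * √ε ≤ η := by
  have h : Tendsto (fun ε : ℝ => c * √ε) (𝓝[>] 0) (𝓝 0) := by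
    simpa using tendsto_sqrt_nhdsGT.const_mul c
  exact h.eventually (ge_mem_nhds hη)

lemma eventually_mul_le (c : ℝ) {η : ℝ} (hη : 0 < η) : ∀ᶠ ε in 𝓝[>] (0 : ℝ), c * ε ≤ η := by
  have h : Tendsto (fun ε : ℝ => c * ε) (𝓝[>] 0) (𝓝 0) := by
    have : Tendsto (fun ε : ℝ => c * ε) (𝓝 0) (𝓝 (c * 0)) := tendsto_id.const_mul c
    rw [mul_zero] at this
    exact this.mono_left nhdsWithin_le_nhds
  exact h.eventually (ge_mem_nhds hη)

/-- The discrete sum, for one `ε`, is compared with the discretized main term. The hypotheses bound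
the stencils at angles that are large, moderate, and comparable to `e = √ε`. -/
lemma abs_sum_sub_main_le {d e A ρ δ Δ M c₁ c₂ c₃ c₄ c₅ τ₀ : ℝ} (hd : 0 < d) (he : 0 < e)
    (hA : 0 < A) (hde : d ≤ A * e) (hAρ : (A + 1) * e ≤ ρ) (hρδ : ρ ≤ δ)
    (hc₁ : 0 ≤ c₁) (hc₂ : 0 ≤ c₂) (hc₃ : 0 ≤ c₃) (hc₄ : 0 ≤ c₄) (hc₅ : 0 ≤ c₅) (hM : 0 ≤ M)
    {χ T TΩ m : ℤ → ℝ} (hχ0 : ∀ k : ℤ, δ ≤ |τ₀ + d * k| → χ k = 0) (hχM : ∀ k, |χ k| ≤ M)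
    (h1 : ∀ k : ℤ, ρ ≤ |τ₀ + d * k| → |τ₀ + d * k| ≤ δ → |χ k * T k| ≤ c₁)
    (h2 : ∀ k : ℤ, |τ₀ + d * k| ≤ ρ → |χ k * (T k - Δ * TΩ k)| ≤ c₂)
    (h3 : ∀ k : ℤ, |τ₀ + d * k| ≤ (A + 1) * e → |TΩ k - m k| ≤ c₃)
    (h4 : ∀ k : ℤ, |τ₀ + d * k| ≤ A * e → |(χ k - 1) * TΩ k| ≤ c₄)
    (h5 : ∀ k : ℤ, A * e ≤ |τ₀ + d * k| → |τ₀ + d * k| ≤ δ →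
      |TΩ k| ≤ c₅ / |τ₀ + d * k| ^ 3) :
    |(∑' k, χ k * T k) - Δ * ∑' k : ℤ, trapezoid A ((τ₀ + d * k) / e) * m k| ≤
      c₁ * (2 * δ / d + 1) + c₂ * (2 * ρ / d + 1) + |Δ| * (c₃ * (2 * ((A + 1) * e) / d + 1) +
        c₄ * (2 * (A * e) / d + 1) + 5 * Real.pi * ((M + 1) * c₅) / (d * (A * e) ^ 2)) := by
  have hAe : A * e < (A + 1) * e := by nlinarith
  have hρ0 : 0 < ρ := lt_of_lt_of_le (by positivity) hAρ
  set β : ℤ → ℝ := fun k => τ₀ + d * k with hβ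
  set θ : ℤ → ℝ := fun k => trapezoid A (β k / e) with hθ
  have hθ0 : ∀ k, ¬|β k| ≤ (A + 1) * e → θ k = 0 := by
    intro k hk
    refine trapezoid_eq_zero ?_
    rw [abs_div, abs_of_pos he, lt_div_iff₀ he]
    exact not_le.1 hk
  have hθ1 : ∀ k, |β k| ≤ A * e → θ k = 1 := by
    intro k hk
    refine trapezoid_eq_one ?_
    rwa [abs_div, abs_of_pos he, div_le_iff₀ he]
  have hθa : ∀ k, |θ k| ≤ 1 := by
    intro k
    rw [abs_of_nonneg (trapezoid_nonneg _ _)]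
    exact trapezoid_le_one _ _
  -- In order: large angles; the difference between `T` and `Δ * TΩ`; the difference between `TΩ`
  -- and the main term `m`, weighted by the trapezoid; the effect of `χ ≠ 1` at small angles; the
  -- remaining moderate angles.
  set a₁ : ℤ → ℝ := fun k => if |β k| ≤ ρ then 0 else χ k * T k with ha₁
  set a₂ : ℤ → ℝ := fun k => if |β k| ≤ ρ then χ k * (T k - Δ * TΩ k) else 0 with ha₂
  set a₃ : ℤ → ℝ := fun k => if |β k| ≤ (A + 1) * e then θ k * (TΩ k - m k) else 0 with ha₃
  set a₄ : ℤ → ℝ := fun k => if |β k| < A * e then (χ k - θ k) * TΩ k else 0 with ha₄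
  set a₅ : ℤ → ℝ := fun k => if A * e ≤ |β k| ∧ |β k| ≤ ρ then (χ k - θ k) * TΩ k else 0 with ha₅
  have z1 : ∀ k, δ < |β k| → a₁ k = 0 := by
    intro k hk
    rw [ha₁]
    simp only
    rw [if_neg (by linarith), hχ0 k hk.le, zero_mul]
  have z2 : ∀ k, ρ < |β k| → a₂ k = 0 := fun k hk => if_neg (not_le.2 hk)
  have z3 : ∀ k, (A + 1) * e < |β k| → a₃ k = 0 := fun k hk => if_neg (not_le.2 hk)
  have z4 : ∀ k, A * e < |β k| → a₄ k = 0 := fun k hk => if_neg (not_lt.2 hk.le)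
  have z5 : ∀ k, |β k| < A * e → a₅ k = 0 := fun k hk => if_neg fun h => absurd hk (not_lt.2 h.1)
  have z5' : ∀ k, ρ < |β k| → a₅ k = 0 := fun k hk => if_neg fun h => absurd hk (not_lt.2 h.2)
  have s1 : Summable a₁ := summable_progression hd z1
  have s2 : Summable a₂ := summable_progression hd z2
  have s3 : Summable a₃ := summable_progression hd z3
  have s4 : Summable a₄ := summable_progression hd z4
  have s5 : Summable a₅ := summable_progression hd z5'
  have s6 : Summable fun k => θ k * m k := summable_progression hd (B := (A + 1) * e) fun k hk => by
    rw [hθ0 k (not_le.2 hk), zero_mul]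
  have hid : ∀ k, χ k * T k = a₁ k + a₂ k + Δ * (a₃ k + a₄ k + a₅ k + θ k * m k) := by
    intro k
    simp only [ha₁, ha₂, ha₃, ha₄, ha₅]
    by_cases p1 : |β k| ≤ ρ
    · by_cases p2 : |β k| < A * e
      · rw [if_pos p1, if_pos p1, if_pos (by linarith), if_pos p2, if_neg (by
          rintro ⟨h, -⟩; linarith)]
        ring
      · have p4 : A * e ≤ |β k| ∧ |β k| ≤ ρ := ⟨not_lt.1 p2, p1⟩
        rw [if_pos p1, if_pos p1, if_neg p2, if_pos p4]
        by_cases p3 : |β k| ≤ (A + 1) * e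
        · rw [if_pos p3]
          ring
        · rw [if_neg p3, hθ0 k p3]
          ring
    · have p3 : ¬|β k| ≤ (A + 1) * e := fun h => p1 (h.trans hAρ)
      rw [if_neg p1, if_neg p1, if_neg p3, if_neg (by linarith), if_neg (fun h => p1 h.2), hθ0 k p3]
      ring
  have hsum := (s1.hasSum.add s2.hasSum).add
    ((((s3.hasSum.add s4.hasSum).add s5.hasSum).add s6.hasSum).mul_left Δ)
  rw [tsum_congr hid, hsum.tsum_eq]
  have b1 : |∑' k, a₁ k| ≤ c₁ * (2 * δ / d + 1) := by
    refine abs_tsum_progression_le hd (hρ0.le.trans hρδ) hc₁ (fun k hk => ?_) z1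
    simp only [ha₁]
    split_ifs with h
    · simpa using hc₁
    · exact h1 k (not_le.1 h).le hk
  have b2 : |∑' k, a₂ k| ≤ c₂ * (2 * ρ / d + 1) := by
    refine abs_tsum_progression_le hd hρ0.le hc₂ (fun k hk => ?_) z2
    simp only [ha₂]
    rw [if_pos hk]
    exact h2 k hk
  have b3 : |∑' k, a₃ k| ≤ c₃ * (2 * ((A + 1) * e) / d + 1) := by
    refine abs_tsum_progression_le hd (by positivity) hc₃ (fun k hk => ?_) z3
    simp only [ha₃]
    rw [if_pos hk, abs_mul]
    have := mul_le_mul (hθa k) (h3 k hk) (abs_nonneg _) zero_le_one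
    linarith
  have b4 : |∑' k, a₄ k| ≤ c₄ * (2 * (A * e) / d + 1) := by
    refine abs_tsum_progression_le hd (by positivity) hc₄ (fun k hk => ?_) z4
    simp only [ha₄]
    split_ifs with h
    · rw [hθ1 k hk]
      exact h4 k hk
    · simpa using hc₄
  have b5 : |∑' k, a₅ k| ≤ 5 * Real.pi * ((M + 1) * c₅) / (d * (A * e) ^ 2) := by
    refine abs_tsum_inv_cube_le hd hde (by positivity) (fun k hk => ?_) z5 z5'
    simp only [ha₅]
    split_ifs with h
    · rw [abs_mul, mul_div_assoc]
      have k1 : |χ k - θ k| ≤ M + 1 := (abs_sub _ _).trans (add_le_add (hχM k) (hθa k))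
      have k2 := h5 k hk (h.2.trans hρδ)
      gcongr
    · rw [abs_zero]
      positivity
  have e1 : (∑' k, a₁ k) + ∑' k, a₂ k + Δ * ((∑' k, a₃ k) + ∑' k, a₄ k + ∑' k, a₅ k +
      ∑' k, θ k * m k) - Δ * ∑' k, θ k * m k =
      (∑' k, a₁ k) + ∑' k, a₂ k + Δ * ((∑' k, a₃ k) + ∑' k, a₄ k + ∑' k, a₅ k) := by ring
  rw [e1]
  refine (abs_add_le _ _).trans (add_le_add ((abs_add_le _ _).trans (add_le_add b1 b2)) ?_)
  rw [abs_mul]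
  refine mul_le_mul_of_nonneg_left ?_ (abs_nonneg Δ)
  exact (abs_add_three _ _ _).trans (add_le_add (add_le_add b3 b4) b5)

/-- In the variable `τ = β / √ε` the progression has step `κ √ε`, which is also the factor in front:
the sum becomes a Riemann sum. -/
lemma main_sum_eq (φ : ℝ → ℝ) (A b h κ τ₀ : ℝ) {ε : ℝ} (hε : 0 < ε) (v : ℤ → ℝ) :
    κ * ∑' k : ℤ, trapezoid A ((τ₀ + κ * ε * k) / √ε) *
      (√ε * stencil φ (v k) fun s => chord b ((τ₀ + κ * ε * k) / √ε) (h + s)) =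
    κ * √ε * ∑' k : ℤ, max 0 (min 1 (A + 1 - |τ₀ / √ε + κ * √ε * k|)) *
      stencil φ (v k) fun s => chord b (τ₀ / √ε + κ * √ε * k) (h + s) := by
  have he : 0 < √ε := Real.sqrt_pos.2 hε
  have h1 : ∀ k : ℤ, (τ₀ + κ * ε * k) / √ε = τ₀ / √ε + κ * √ε * k := by
    intro k
    have : ε = √ε * √ε := (Real.mul_self_sqrt hε.le).symm
    rw [add_div]
    congr 1
    rw [div_eq_iff he.ne']
    linear_combination κ * k * this
  simp only [h1, trapezoid]
  rw [mul_assoc, ← tsum_mul_left (a := √ε)]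
  congr 1
  exact tsum_congr fun k => by ring

/-- For fixed `A`, every error tends to zero with `ε` except that of the moderate angles, which
leaves `C / A ^ 2`. The constant `C` must not depend on `A`, since `A` is sent to infinity
afterwards. -/
lemma IsSliceModel.eventually_approx {H X : ℝ → ℝ → ℝ} {b Δ : ℝ} (hH : IsSliceModel H X b Δ) :
    ∃ δ > 0, ∀ χ : ℝ → ℝ, Continuous χ → (∀ β, δ ≤ |β| → χ β = 0) → χ 0 = 1 →
      ∀ φ, IsInterpolationKernel φ → ∀ κ > 0, ∀ (ζ : ℝ → ℝ) (Y : ℝ), ContinuousAt ζ 0 →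
      (∀ β, |ζ β| ≤ Y) → ∀ (τ₀ : ℝ → ℝ) (v : ℝ → ℤ → ℝ) (θ : ℝ), Irrational θ →
      (∀ A ρ, 0 < ρ → ∀ᶠ ε in 𝓝[>] (0 : ℝ), ∀ k : ℤ, |τ₀ ε + κ * ε * k| ≤ A * √ε →
        |v ε (k + 1) - v ε k - θ| ≤ ρ) →
      ∃ C, 0 ≤ C ∧ ∃ A₁ > 0, ∀ A, A₁ ≤ A → ∀ ν > 0, ∀ᶠ ε in 𝓝[>] (0 : ℝ),
        |κ * (∑' k : ℤ, χ (τ₀ ε + κ * ε * k) * stencil φ (v ε k)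
            (sliceRadon H ε (τ₀ ε + κ * ε * k) (ζ (τ₀ ε + κ * ε * k)))) -
          Δ * ∫ τ, max 0 (min 1 (A + 1 - |τ|)) * angleProfile φ b (ζ 0) τ| ≤ C / A ^ 2 + ν := by
  obtain ⟨δ₁, hδ₁, hδ₁1, hfar⟩ := hH.exists_far_bound
  obtain ⟨δ₂, hδ₂, hδ₂1, hrem⟩ := hH.exists_remainder_bound
  obtain ⟨δ₃, hδ₃, hδ₃1, hmod⟩ := hH.exists_moderate_bound
  set δ := min δ₁ (min δ₂ δ₃) with hδ
  have hδ0 : 0 < δ := by positivity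
  refine ⟨δ, hδ0, fun χ hχc hχ0 hχ1 φ hφ κ hκ ζ Y hζ hζY τ₀ v θ hθ hv => ?_⟩
  have hY : 0 ≤ Y := (abs_nonneg _).trans (hζY 0)
  obtain ⟨C, P, R, hS⟩ := exists_stencilBound hφ hY
  obtain ⟨M, hM⟩ := (isCompact_Icc (a := -δ) (b := δ)).exists_bound_of_continuousOn hχc.continuousOn
  have hM0 : 0 ≤ M := (norm_nonneg _).trans (hM 0 ⟨by linarith, hδ0.le⟩)
  have hχM : ∀ β, |χ β| ≤ M := by
    intro β
    rcases le_total δ |β| with h | h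
    · rw [hχ0 β h, abs_zero]; exact hM0
    · exact hM β (abs_le.1 h)
  obtain ⟨C₂, hC₂, hrem⟩ := hrem φ hφ Y C P R hS
  obtain ⟨C₅, A₀, hC₅, hA₀, hmod⟩ := hmod φ Y C P R hS
  refine ⟨|Δ| * (5 * Real.pi * ((M + 1) * C₅)), by positivity, A₀ + 1, by positivity,
    fun A hA ν hν => ?_⟩
  have hA0 : 0 < A := by linarith
  have hAA : A₀ ≤ A ^ 2 := by nlinarith
  obtain ⟨MW, hMW, hW⟩ := (isPeriodicFamily_stencil hφ hA0.le b (ζ 0)).exists_bound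
  -- `ρ`, `ν₁`, `ν₃` and `ν₄` are tuned so that four of the errors, and likewise the
  -- equidistribution error, are at most `ν / 5` each (`n1` to `n5`).
  set ρ := min δ (ν / (15 * (M * C₂ + 1))) with hρ
  have hρ0 : 0 < ρ := by positivity
  set ν₁ := ν / (15 * (M + 1) * δ) with hν₁
  have hν₁0 : 0 < ν₁ := by positivity
  set ν₃ := ν / (5 * (|Δ| + 1) * (2 * A + 3)) with hν₃
  have hν₃0 : 0 < ν₃ := by positivity
  set ν₄ := ν / (5 * (|Δ| + 1) * ((ν₃ + MW) * (2 * A + 1) + 1)) with hν₄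
  have hν₄0 : 0 < ν₄ := by positivity
  obtain ⟨ρU, hρU, hU⟩ := hH.chord_approx hφ hS (A := A + 1) (by linarith) (ζ 0) hν₃0
  obtain ⟨ρE, hρE, hE⟩ := (isPeriodicFamily_stencil hφ hA0.le b (ζ 0)).equidistribution hθ
    (η := ν / (5 * (|Δ| + 1))) (by positivity)
  obtain ⟨σ, hσ, hnear⟩ := Metric.eventually_nhds_iff.1
    ((hζ.eventually (Metric.closedBall_mem_nhds _ hρU)).and
      ((hχc.tendsto 0).eventually (Metric.closedBall_mem_nhds _ hν₄0)))
  filter_upwards [self_mem_nhdsWithin, hfar φ Y C P R hS ρ hρ0 ν₁ hν₁0, hrem, hU,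
    hv (A + 2) ρE hρE, eventually_mul_sqrt_le κ (show 0 < min (ρE / 2) (min A 1) by positivity),
    eventually_mul_sqrt_le (A + 1) (show 0 < min ρ (σ / 2) by positivity),
    eventually_mul_le κ hρ0] with ε hε hfar hrem hU hv hκe hAe hκε
  have hε : 0 < ε := hε
  rw [le_min_iff, le_min_iff] at hκe
  rw [le_min_iff] at hAe
  set e := √ε with he
  have he0 : 0 < e := Real.sqrt_pos.2 hε
  have hee : ε = e ^ 2 := (Real.sq_sqrt hε.le).symm
  have hρδ : ρ ≤ δ := min_le_left _ _
  have hnear' : ∀ β, |β| ≤ (A + 1) * e → |ζ β - ζ 0| ≤ ρU ∧ |χ β - 1| ≤ ν₄ := by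
    intro β hβ
    have := hnear (y := β) (by rw [dist_zero_right, Real.norm_eq_abs]; linarith)
    simpa [Real.dist_eq, hχ1] using this
  -- The periodic family is supported in `|τ| ≤ A + 1`, and equidistribution asks for the phase
  -- increments one unit further; hence `A + 2` above.
  have hmain := hE (κ * e) (by positivity) (by linarith) (τ₀ ε / e) (v ε) fun k hk => by
    refine hv k ?_
    have e1 : τ₀ ε + κ * ε * k = e * (τ₀ ε / e + κ * e * k) := by
      rw [mul_add, mul_div_cancel₀ _ he0.ne']
      linear_combination κ * k * hee
    rw [e1, abs_mul, abs_of_pos he0, mul_comm]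
    gcongr
    linarith
  rw [← main_sum_eq φ A b (ζ 0) κ (τ₀ ε) hε (v ε)] at hmain
  have hint : ∀ τ, ∫ u in (0 : ℝ)..1, max 0 (min 1 (A + 1 - |τ|)) *
      stencil φ u (fun s => chord b τ (ζ 0 + s)) =
      max 0 (min 1 (A + 1 - |τ|)) * angleProfile φ b (ζ 0) τ := by
    intro τ
    rw [intervalIntegral.integral_const_mul, integral_stencil_chord hφ]
  simp only [hint] at hmain
  set β : ℤ → ℝ := fun k => τ₀ ε + κ * ε * k with hβ
  have hsum := abs_sum_sub_main_le (d := κ * ε) (e := e) (A := A) (ρ := ρ) (δ := δ) (Δ := Δ)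
    (M := M) (c₁ := M * (ν₁ * ε)) (c₂ := M * (C₂ * ε)) (c₃ := ν₃ * e)
    (c₄ := ν₄ * ((ν₃ + MW) * e)) (c₅ := C₅ * ε ^ 2) (τ₀ := τ₀ ε) (by positivity) he0 hA0
    (by rw [hee, pow_two, ← mul_assoc]; exact mul_le_mul_of_nonneg_right hκe.2.1 he0.le)
    hAe.1 hρδ (by positivity) (by positivity) (by positivity) (by positivity) (by positivity) hM0
    (χ := fun k => χ (β k)) (T := fun k => stencil φ (v ε k) (sliceRadon H ε (β k) (ζ (β k))))
    (TΩ := fun k => stencil φ (v ε k) (sliceRadon X ε (β k) (ζ (β k))))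
    (m := fun k => e * stencil φ (v ε k) fun s => chord b (β k / e) (ζ 0 + s))
    (fun k hk => hχ0 _ hk) (fun k => hχM _)
    (fun k hk1 hk2 => by
      rw [abs_mul]
      exact mul_le_mul (hχM _) (hfar _ _ _ hk1 (hk2.trans (min_le_left _ _)) (hζY _))
        (abs_nonneg _) hM0)
    (fun k hk => by
      rw [abs_mul]
      exact mul_le_mul (hχM _) (hrem _ _ _ ((hk.trans hρδ).trans
        ((min_le_right _ _).trans (min_le_left _ _))) (hζY _)) (abs_nonneg _) hM0)
    (fun k hk => hU _ _ _ hk (hζY _) (hnear' _ hk).1)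
    (fun k hk => by
      have hk' : |β k| ≤ (A + 1) * e := hk.trans (by nlinarith)
      rw [abs_mul]
      refine mul_le_mul (hnear' _ hk').2 ?_ (abs_nonneg _) hν₄0.le
      have k1 := hU (v ε k) _ _ hk' (hζY _) (hnear' _ hk').1
      have k2 := hW (β k / e) (v ε k)
      have k3 : |β k / e| ≤ A := by rwa [abs_div, abs_of_pos he0, div_le_iff₀ he0]
      rw [min_eq_left (by linarith), max_eq_right zero_le_one, one_mul] at k2
      have k4 := mul_le_mul_of_nonneg_left k2 he0.le
      rw [← abs_of_pos he0, ← abs_mul, abs_of_pos he0] at k4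
      have k5 := abs_sub_abs_le_abs_sub (stencil φ (v ε k) (sliceRadon X ε (β k) (ζ (β k))))
        (e * stencil φ (v ε k) fun s => chord b (β k / e) (ζ 0 + s))
      linarith)
    (fun k hk1 hk2 => hmod ε _ _ _ hε (by
      rw [← sq_abs (β k)]
      calc A₀ * ε ≤ A ^ 2 * ε := by gcongr
        _ = (A * e) ^ 2 := by rw [mul_pow, ← hee]
        _ ≤ |β k| ^ 2 := by gcongr)
      (hk2.trans ((min_le_right _ _).trans (min_le_right _ _))) (hζY _))
  have hmul := mul_le_mul_of_nonneg_left hsum hκ.le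
  rw [← abs_of_pos hκ, ← abs_mul, abs_of_pos hκ, mul_sub, mul_left_comm κ Δ] at hmul
  -- With `ε = e ^ 2` the powers balance: the moderate angles yield a bound in which neither `ε` nor
  -- `κ` remains.
  have hR : κ * (M * (ν₁ * ε) * (2 * δ / (κ * ε) + 1) + M * (C₂ * ε) * (2 * ρ / (κ * ε) + 1) +
      |Δ| * (ν₃ * e * (2 * ((A + 1) * e) / (κ * ε) + 1) +
        ν₄ * ((ν₃ + MW) * e) * (2 * (A * e) / (κ * ε) + 1) +
        5 * Real.pi * ((M + 1) * (C₅ * ε ^ 2)) / (κ * ε * (A * e) ^ 2))) =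
      M * (ν₁ * (2 * δ + κ * ε)) + M * C₂ * (2 * ρ + κ * ε) +
      |Δ| * (ν₃ * (2 * (A + 1) + κ * e)) + |Δ| * (ν₄ * ((ν₃ + MW) * (2 * A + κ * e))) +
      |Δ| * (5 * Real.pi * ((M + 1) * C₅)) / A ^ 2 := by
    rw [hee]
    field_simp
    ring
  rw [hR] at hmul
  have n1 : M * (ν₁ * (2 * δ + κ * ε)) ≤ ν / 5 := by
    calc M * (ν₁ * (2 * δ + κ * ε)) ≤ (M + 1) * (ν₁ * (2 * δ + δ)) := by
          gcongr
          · linarith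
          · exact hκε.trans hρδ
      _ = ν / 5 := by rw [hν₁]; field_simp; norm_num
  have n2 : M * C₂ * (2 * ρ + κ * ε) ≤ ν / 5 := by
    have hρν : ρ ≤ ν / (15 * (M * C₂ + 1)) := min_le_right _ _
    calc M * C₂ * (2 * ρ + κ * ε) ≤ (M * C₂ + 1) * (2 * (ν / (15 * (M * C₂ + 1))) +
          ν / (15 * (M * C₂ + 1))) := by
          gcongr
          · linarith
          · exact hκε.trans hρν
      _ = ν / 5 := by field_simp; norm_num
  have n3 : |Δ| * (ν₃ * (2 * (A + 1) + κ * e)) ≤ ν / 5 := by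
    calc |Δ| * (ν₃ * (2 * (A + 1) + κ * e)) ≤ (|Δ| + 1) * (ν₃ * (2 * (A + 1) + 1)) := by
          gcongr
          · linarith
          · exact hκe.2.2
      _ = ν / 5 := by rw [hν₃]; field_simp; ring
  have n4 : |Δ| * (ν₄ * ((ν₃ + MW) * (2 * A + κ * e))) ≤ ν / 5 := by
    calc |Δ| * (ν₄ * ((ν₃ + MW) * (2 * A + κ * e)))
        ≤ (|Δ| + 1) * (ν₄ * ((ν₃ + MW) * (2 * A + 1) + 1)) := by
          have k1 : (ν₃ + MW) * (2 * A + κ * e) ≤ (ν₃ + MW) * (2 * A + 1) + 1 := by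
            have : (ν₃ + MW) * (2 * A + κ * e) ≤ (ν₃ + MW) * (2 * A + 1) := by
              gcongr
              exact hκe.2.2
            linarith
          gcongr
          linarith
      _ = ν / 5 := by rw [hν₄]; field_simp
  have n5 : |Δ| * (ν / (5 * (|Δ| + 1))) ≤ ν / 5 := by
    calc |Δ| * (ν / (5 * (|Δ| + 1))) ≤ (|Δ| + 1) * (ν / (5 * (|Δ| + 1))) := by
          gcongr
          linarith
      _ = ν / 5 := by field_simp
  have hmain2 := mul_le_mul_of_nonneg_left hmain (abs_nonneg Δ)
  rw [← abs_mul, mul_sub] at hmain2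
  refine (abs_sub_le _ _ _).trans ((add_le_add hmul hmain2).trans ?_)
  linarith

/-- The limit of the discrete sums. -/
theorem IsSliceModel.tendsto_sum {H X : ℝ → ℝ → ℝ} {b Δ : ℝ} (hH : IsSliceModel H X b Δ) :
    ∃ δ > 0, ∀ χ : ℝ → ℝ, Continuous χ → (∀ β, δ ≤ |β| → χ β = 0) → χ 0 = 1 →
      ∀ φ, IsInterpolationKernel φ → ∀ κ > 0, ∀ (ζ : ℝ → ℝ) (Y : ℝ), ContinuousAt ζ 0 →
      (∀ β, |ζ β| ≤ Y) → ∀ (τ₀ : ℝ → ℝ) (v : ℝ → ℤ → ℝ) (θ : ℝ), Irrational θ →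
      (∀ A ρ, 0 < ρ → ∀ᶠ ε in 𝓝[>] (0 : ℝ), ∀ k : ℤ, |τ₀ ε + κ * ε * k| ≤ A * √ε →
        |v ε (k + 1) - v ε k - θ| ≤ ρ) →
      Tendsto (fun ε => κ * ∑' k : ℤ, χ (τ₀ ε + κ * ε * k) * stencil φ (v ε k)
          (sliceRadon H ε (τ₀ ε + κ * ε * k) (ζ (τ₀ ε + κ * ε * k)))) (𝓝[>] 0)
        (𝓝 (Δ * ∫ r, (φ (ζ 0 + r) - φ (ζ 0 - r)) / r)) := by
  obtain ⟨δ, hδ, h⟩ := hH.eventually_approx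
  refine ⟨δ, hδ, fun χ hχc hχ0 hχ1 φ hφ κ hκ ζ Y hζ hζY τ₀ v θ hθ hv => ?_⟩
  obtain ⟨C, hC, A₁, hA₁, h⟩ := h χ hχc hχ0 hχ1 φ hφ κ hκ ζ Y hζ hζY τ₀ v θ hθ hv
  rw [Metric.tendsto_nhds]
  intro η hη
  have t1 : Tendsto (fun A : ℝ => C / A ^ 2) atTop (𝓝 0) :=
    tendsto_const_nhds.div_atTop (tendsto_pow_atTop (by norm_num))
  have t2 := (tendsto_integral_cutoff_angleProfile hφ hH.curvature_pos (ζ 0)).const_mul Δ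
  obtain ⟨A, hA, k1, k2⟩ := ((eventually_ge_atTop A₁).and
    ((t1.eventually (gt_mem_nhds (show 0 < η / 3 by positivity))).and
      (Metric.tendsto_nhds.1 t2 (η / 3) (by positivity)))).exists
  filter_upwards [h A hA (η / 3) (by positivity)] with ε hε
  rw [Real.dist_eq] at k2 ⊢
  exact (abs_sub_le _ _ _).trans_lt (lt_of_lt_of_le (add_lt_add_of_le_of_lt hε k2) (by linarith))

/-! ### Normal coordinates in the plane and verification of the slice model. -/

lemma inner_plane (x y : Plane) : inner ℝ x y = x 0 * y 0 + x 1 * y 1 := by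
  rw [PiLp.inner_apply, Fin.sum_univ_two]
  simp [mul_comm]

lemma inner_dir (α : ℝ) (x : Plane) : inner ℝ (dir α) x = Real.cos α * x 0 + Real.sin α * x 1 := by
  rw [inner_plane]
  simp [dir]

lemma inner_dirPerp (α : ℝ) (x : Plane) :
    inner ℝ (dirPerp α) x = -Real.sin α * x 0 + Real.cos α * x 1 := by
  rw [inner_plane]
  simp [dirPerp]

lemma dir_zero (α : ℝ) : dir α 0 = Real.cos α := by simp [dir]

lemma dir_one (α : ℝ) : dir α 1 = Real.sin α := by simp [dir]

lemma dirPerp_zero (α : ℝ) : dirPerp α 0 = -Real.sin α := by simp [dirPerp]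

lemma dirPerp_one (α : ℝ) : dirPerp α 1 = Real.cos α := by simp [dirPerp]

/-- Cartesian coordinates with origin `x₀` and axes `dirPerp θ₀` and `dir θ₀`. -/
noncomputable def normalCoords (x₀ : Plane) (θ₀ : ℝ) : Plane ≃ₜ ℝ × ℝ where
  toFun x := (inner ℝ (dirPerp θ₀) (x - x₀), inner ℝ (dir θ₀) (x - x₀))
  invFun z := x₀ + z.1 • dirPerp θ₀ + z.2 • dir θ₀
  left_inv x := by
    have h := Real.sin_sq_add_cos_sq θ₀
    ext i
    fin_cases i
    · simp [inner_dir, inner_dirPerp, dir_zero, dirPerp_zero]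
      linear_combination (x 0 - x₀ 0) * h
    · simp [inner_dir, inner_dirPerp, dir_one, dirPerp_one]
      linear_combination (x 1 - x₀ 1) * h
  right_inv z := by
    have h := Real.sin_sq_add_cos_sq θ₀
    ext
    · simp [inner_dirPerp, dir_zero, dir_one, dirPerp_zero, dirPerp_one]
      linear_combination z.1 * h
    · simp [inner_dir, dir_zero, dir_one, dirPerp_zero, dirPerp_one]
      linear_combination z.2 * h
  continuous_toFun := by fun_prop
  continuous_invFun := by fun_prop

variable {x₀ : Plane} {θ₀ : ℝ}

lemma normalCoords_apply (x : Plane) : normalCoords x₀ θ₀ x =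
    (inner ℝ (dirPerp θ₀) (x - x₀), inner ℝ (dir θ₀) (x - x₀)) := rfl

lemma normalCoords_symm_apply (z : ℝ × ℝ) :
    (normalCoords x₀ θ₀).symm z = x₀ + z.1 • dirPerp θ₀ + z.2 • dir θ₀ := rfl

lemma normalCoords_self : normalCoords x₀ θ₀ x₀ = 0 := by simp [normalCoords_apply]

lemma normalCoords_symm_zero : (normalCoords x₀ θ₀).symm 0 = x₀ := by
  simp [normalCoords_symm_apply]

/-- Reparametrize the line by its abscissa in normal coordinates, `u = a + s cos β`; this produces
the Jacobian `1 / cos β`. -/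
lemma radon_eq_sliceInt (f : Plane → ℝ) (β p : ℝ) (hβ : 0 < Real.cos β) :
    radon f (θ₀ + β) p = sliceInt (f ∘ (normalCoords x₀ θ₀).symm) (Real.tan β)
      ((p - inner ℝ (dir (θ₀ + β)) x₀) / Real.cos β) / Real.cos β := by
  set G : ℝ → ℝ := fun u => f ((normalCoords x₀ θ₀).symm
    (u, (p - inner ℝ (dir (θ₀ + β)) x₀) / Real.cos β - Real.tan β * u)) with hG
  set a := p * Real.sin β - inner ℝ (dirPerp θ₀) x₀ with ha
  have e1 : ∀ s, f (p • dir (θ₀ + β) + s • dirPerp (θ₀ + β)) = G (a + Real.cos β * s) := by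
    intro s
    have h := Real.sin_sq_add_cos_sq β
    have h' := Real.sin_sq_add_cos_sq θ₀
    have hY : (p - inner ℝ (dir (θ₀ + β)) x₀) / Real.cos β -
        Real.tan β * (a + Real.cos β * s) =
        p * Real.cos β - s * Real.sin β - inner ℝ (dir θ₀) x₀ := by
      rw [ha, inner_dir, inner_dir, inner_dirPerp, Real.cos_add, Real.sin_add,
        Real.tan_eq_sin_div_cos]
      field_simp
      linear_combination -p * h
    simp only [hG]
    rw [hY, normalCoords_symm_apply, ha, inner_dir, inner_dirPerp]
    congr 1
    ext i
    fin_cases i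
    · simp [dir_zero, dirPerp_zero, Real.cos_add, Real.sin_add]
      linear_combination x₀ 0 * h'
    · simp [dir_one, dirPerp_one, Real.cos_add, Real.sin_add]
      linear_combination x₀ 1 * h'
  rw [radon, sliceInt]
  simp only [e1, Function.comp_apply]
  rw [Measure.integral_comp_mul_left (fun w => G (a + w)), integral_add_left_eq_self,
    abs_of_pos (inv_pos.2 hβ), smul_eq_mul, inv_mul_eq_div]

lemma contDiff_normalCoords {n : WithTop ℕ∞} : ContDiff ℝ n (normalCoords x₀ θ₀) := by
  refine ContDiff.prodMk ?_ ?_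
  · exact contDiff_const.inner ℝ (contDiff_id.sub contDiff_const)
  · exact contDiff_const.inner ℝ (contDiff_id.sub contDiff_const)

lemma contDiff_normalCoords_symm {n : WithTop ℕ∞} : ContDiff ℝ n (normalCoords x₀ θ₀).symm := by
  have : ((normalCoords x₀ θ₀).symm : ℝ × ℝ → Plane) =
    fun z => x₀ + z.1 • dirPerp θ₀ + z.2 • dir θ₀ := rfl
  rw [this]
  fun_prop

/-- A function that is smooth near the closure of a bounded set agrees on the set with a smooth
function of compact support. -/
lemma exists_contDiff_extension {D V : Set Plane} {F : Plane → ℝ} (hD : Bornology.IsBounded D)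
    (hV : IsOpen V) (hDV : closure D ⊆ V) (hF : ContDiffOn ℝ ∞ F V) :
    ∃ G : Plane → ℝ, ContDiff ℝ 1 G ∧ HasCompactSupport G ∧ ∀ x ∈ D, F x = G x := by
  obtain ⟨K, hK, hDK, hKV⟩ := exists_compact_between hD.isCompact_closure hV hDV
  obtain ⟨η, hη0, hη1, -⟩ := exists_contMDiffMap_zero_one_of_isClosed (n := ⊤)
    (modelWithCornersSelf ℝ Plane) (s := (interior K)ᶜ) (t := closure D)
    isOpen_interior.isClosed_compl isClosed_closure (disjoint_compl_left_iff_subset.2 hDK)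
  have hηc : ContDiff ℝ ∞ η := η.contMDiff.contDiff
  have hz : ∀ x, x ∉ K → η x = 0 := fun x hx => hη0 fun h => hx (interior_subset h)
  refine ⟨fun x => η x * F x, ?_, HasCompactSupport.intro hK fun x hx => ?_, fun x hx => ?_⟩
  · rw [contDiff_iff_contDiffAt]
    intro x
    by_cases hx : x ∈ V
    · exact ((hηc.contDiffAt).mul (hF.contDiffAt (hV.mem_nhds hx))).of_le
        (by exact_mod_cast le_top)
    · have : (fun x => η x * F x) =ᶠ[𝓝 x] fun _ => 0 := by
        filter_upwards [hK.isClosed.isOpen_compl.mem_nhds fun h => hx (hKV h)] with w hw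
        rw [hz w hw, zero_mul]
      exact contDiffAt_const.congr_of_eventuallyEq this
  · rw [hz x hx, zero_mul]
  · have := hη1 (subset_closure hx)
    simp [this]

/-- The tangent cone of `[0, 1]` is all of `ℝ` at each of its points, end points included, and the
derivative of the arc maps it into the tangent cone of `S`. Thus arcs ending at a corner count as
tangent there. -/
lemma mem_tangentConeAt_of_arc {γ : ℝ → Plane} (hγ : ContDiff ℝ ∞ γ) {s : ℝ}
    (hs : s ∈ Icc (0 : ℝ) 1) {S : Set Plane} (hS : γ '' Icc 0 1 ⊆ S) (c : ℝ) :
    c • deriv γ s ∈ tangentConeAt ℝ S (γ s) := by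
  have h1 : HasFDerivWithinAt γ (ContinuousLinearMap.toSpanSingleton ℝ (deriv γ s)) (Icc 0 1) s :=
    ((hγ.differentiable (by simp) s).hasDerivAt).hasFDerivAt.hasFDerivWithinAt
  have h2 := h1.mapsTo_tangent_cone
  have h3 : tangentConeAt ℝ (Icc (0 : ℝ) 1) s = univ := by
    exact tangentConeAt_eq_univ
      (uniqueDiffWithinAt_iff_accPt.1 (uniqueDiffOn_Icc_zero_one s hs))
  have h4 := h2 (h3 ▸ mem_univ c)
  exact tangentConeAt_mono hS (by simpa using h4)

lemma eq_smul_dirPerp {w : Plane} (hw : inner ℝ (dir θ₀) w = 0) :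
    w = (inner ℝ (dirPerp θ₀) w : ℝ) • dirPerp θ₀ := by
  have h := normalCoords_symm_apply (x₀ := (0 : Plane)) (θ₀ := θ₀) (normalCoords 0 θ₀ w)
  rw [Homeomorph.symm_apply_apply, normalCoords_apply, sub_zero, hw, zero_smul, add_zero,
    zero_add] at h
  exact h

lemma hasDerivAt_normalCoords {γ : ℝ → Plane} {s : ℝ} {γ' : Plane} (h : HasDerivAt γ γ' s) :
    HasDerivAt (normalCoords x₀ θ₀ ∘ γ) (inner ℝ (dirPerp θ₀) γ', inner ℝ (dir θ₀) γ') s := by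
  have h1 := h.sub_const x₀
  exact ((innerSL ℝ (dirPerp θ₀)).hasFDerivAt.comp_hasDerivAt s h1).prodMk
    ((innerSL ℝ (dir θ₀)).hasFDerivAt.comp_hasDerivAt s h1)

lemma IsCurvedNear.isCurvedGraph {S : Set Plane} {g : ℝ → ℝ} (h : IsCurvedNear S x₀ θ₀ g) :
    IsCurvedGraph g :=
  ⟨h.smooth, h.map_zero, h.deriv_zero, h.curvature_pos⟩

/-- A smooth piece, extended by a global function and written in normal coordinates. -/
lemma IsSmoothPiece.exists_isNormalPiece {D S : Set Plane} {F : Plane → ℝ} {g : ℝ → ℝ}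
    (h : IsSmoothPiece D F) (hDS : frontier D ⊆ S) (hcurv : IsCurvedNear S x₀ θ₀ g)
    (htan : ∀ z, LineTangentAt S x₀ θ₀ z → z = x₀) :
    ∃ G : Plane → ℝ, (∀ x ∈ D, F x = G x) ∧ Continuous G ∧
      IsNormalPiece g ((normalCoords x₀ θ₀).symm ⁻¹' D) (G ∘ (normalCoords x₀ θ₀).symm) := by
  obtain ⟨V, hV, hDV, hF⟩ := h.smooth
  obtain ⟨G, hG, hGc, hFG⟩ := exists_contDiff_extension h.isBounded hV hDV hF
  set N := normalCoords x₀ θ₀ with hN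
  have hNc : Continuous fun x => (N x).1 := continuous_fst.comp N.continuous
  obtain ⟨B, hB⟩ := h.isBounded.isCompact_closure.exists_bound_of_continuousOn hNc.continuousOn
  have hfr : frontier (N.symm ⁻¹' D) = N.symm ⁻¹' frontier D := (N.symm.preimage_frontier D).symm
  obtain ⟨m, γ, hγ, hγ', hinj, hend, hγfr⟩ := h.boundary
  refine ⟨G, hFG, hG.continuous, h.isOpen.preimage N.symm.continuous, ⟨B, fun x hx => ?_⟩,
    hG.comp contDiff_normalCoords_symm, hGc.comp_homeomorph N.symm, ?_,
    m, fun i => N ∘ γ i, fun i => ?_, fun i s hs t ht hst => ?_,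
    fun i j hij s hs t ht hst => ?_, ?_, fun i s hs h2 h0 hd => ?_⟩
  · have := hB (N.symm x) (subset_closure hx)
    rwa [N.apply_symm_apply] at this
  · have hc : Tendsto N.symm (𝓝 0) (𝓝 x₀) := by
      have := N.symm.continuous.tendsto 0
      rwa [hN, normalCoords_symm_zero] at this
    filter_upwards [hc.eventually hcurv.eq_graph] with x hx hxf
    rw [hfr] at hxf
    have h1 := hx.1 (hDS hxf)
    have h2 : N (N.symm x) = x := N.apply_symm_apply x
    rw [hN, normalCoords_apply] at h2
    rw [← h2]
    exact h1
  · exact (contDiff_normalCoords.comp ((hγ i).of_le (by exact_mod_cast le_top)))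
  · exact hinj i hs ht (N.injective hst)
  · exact hend i j hij s hs t ht (N.injective hst)
  · rw [hfr, hγfr, ← N.image_eq_preimage_symm, image_iUnion]
    simp only [image_comp]
  -- A horizontal tangent at a point of the axis would make the line tangent to `S` there. By
  -- hypothesis the point is then `x₀`, that is, the origin of the coordinates.
  · have hder := hasDerivAt_normalCoords (x₀ := x₀) (θ₀ := θ₀)
      ((hγ i).differentiable (by simp) s).hasDerivAt
    rw [hder.deriv] at hd
    simp only at hd
    have hsub : γ i '' Icc 0 1 ⊆ S :=
      (hγfr ▸ subset_iUnion (fun i => γ i '' Icc (0 : ℝ) 1) i).trans hDS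
    have e := eq_smul_dirPerp hd
    set c : ℝ := inner ℝ (dirPerp θ₀) (deriv (γ i) s) with hc
    have hc0 : c ≠ 0 := by
      intro h0
      rw [h0, zero_smul] at e
      exact hγ' i s hs e
    have htc := mem_tangentConeAt_of_arc (hγ i) hs hsub c⁻¹
    rw [e, smul_smul, inv_mul_cancel₀ hc0, one_smul] at htc
    have hz := htan (γ i s) ⟨hsub ⟨s, hs, rfl⟩, h2, htc⟩
    refine h0 ?_
    simp only [Function.comp_apply]
    rw [hz, hN, normalCoords_self]

open Classical in
/-- The data of a piecewise smooth function near a curved point of its jump set: the one-sided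
limits, and the model for its slice integrals. -/
lemma exists_limits_and_isSliceModel {n : ℕ} {D : Fin n → Set Plane} {F : Fin n → Plane → ℝ}
    (hDF : ∀ i, IsSmoothPiece (D i) (F i)) {g : ℝ → ℝ}
    (hcurv : IsCurvedNear (jumpSet D) x₀ θ₀ g)
    (htan : ∀ z, LineTangentAt (jumpSet D) x₀ θ₀ z → z = x₀) :
    ∃ fPos fNeg : ℝ,
      Tendsto (piecewiseSum D F) (𝓝[positiveSide x₀ θ₀ g] x₀) (𝓝 fPos) ∧
      Tendsto (piecewiseSum D F) (𝓝[negativeSide x₀ θ₀ g] x₀) (𝓝 fNeg) ∧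
      ∃ (X : ℝ → ℝ → ℝ) (b : ℝ), IsSliceModel
        (sliceInt (piecewiseSum D F ∘ (normalCoords x₀ θ₀).symm)) X b (fPos - fNeg) := by
  set N := normalCoords x₀ θ₀ with hN
  have hg := hcurv.isCurvedGraph
  obtain ⟨r, hr⟩ := hg.exists_isCurvedOn
  choose G hFG hGc hnp using fun i => (hDF i).exists_isNormalPiece
    (subset_iUnion (fun i => frontier (D i)) i) hcurv htan
  choose cp cm hside using fun i => (hnp i).exists_sides hg
  set f := piecewiseSum D F with hf
  have hNt : Tendsto N (𝓝 x₀) (𝓝 0) := by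
    have := N.continuous.tendsto x₀
    rwa [hN, normalCoords_self] at this
  have hfx : ∀ x, f x = ∑ i, (D i).indicator (G i) x := by
    intro x
    refine Finset.sum_congr rfl fun i _ => ?_
    rw [indicator_apply, indicator_apply]
    split_ifs with hx
    · exact hFG i x hx
    · rfl
  have hmem : ∀ i x, N x ∈ N.symm ⁻¹' D i ↔ x ∈ D i := by
    intro i x
    rw [mem_preimage, N.symm_apply_apply]
  -- On one side of the graph membership in every `D i` is constant near `x₀`, so there the function
  -- is a fixed sum of continuous functions.
  have hlim : ∀ (s : Set Plane) (c : Fin n → Prop),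
      (∀ i, ∀ᶠ x in 𝓝 x₀, x ∈ s → (x ∈ D i ↔ c i)) →
      Tendsto f (𝓝[s] x₀) (𝓝 (∑ i, if c i then G i x₀ else 0)) := by
    intro s c hc
    have h1 : Tendsto (fun x => ∑ i, if c i then G i x else 0) (𝓝[s] x₀)
        (𝓝 (∑ i, if c i then G i x₀ else 0)) := by
      refine tendsto_finsetSum _ fun i _ => ?_
      split_ifs
      · exact ((hGc i).tendsto x₀).mono_left nhdsWithin_le_nhds
      · exact tendsto_const_nhds
    refine h1.congr' ?_
    filter_upwards [nhdsWithin_le_nhds (eventually_all.2 hc), self_mem_nhdsWithin] with x hx hxs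
    rw [hfx]
    refine Finset.sum_congr rfl fun i _ => ?_
    simp only [indicator_apply, hx i hxs]
  refine ⟨∑ i, if cp i then G i x₀ else 0, ∑ i, if cm i then G i x₀ else 0,
    hlim _ _ fun i => ?_, hlim _ _ fun i => ?_, ?_⟩
  · filter_upwards [hNt.eventually (hside i)] with x hx hxs
    rw [← hmem]
    exact hx.1 (sub_pos.2 hxs)
  · filter_upwards [hNt.eventually (hside i)] with x hx hxs
    rw [← hmem]
    exact hx.2 (sub_neg.2 hxs)
  set E : Fin n → Set (ℝ × ℝ) := fun i => N.symm ⁻¹' D i with hE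
  set Φ : Fin n → ℝ × ℝ → ℝ := fun i => G i ∘ N.symm with hΦ
  have hΦ0 : ∀ i, Φ i 0 = G i x₀ := by
    intro i
    rw [hΦ]
    simp only [Function.comp_apply]
    rw [hN, normalCoords_symm_zero]
  have hH : sliceInt (f ∘ N.symm) = fun t p => ∑ i, sliceInt ((E i).indicator (Φ i)) t p := by
    ext t p
    simp only [sliceInt, Function.comp_apply, hfx]
    rw [← integral_finsetSum]
    · rfl
    · intro i _
      obtain ⟨B, hB⟩ := (hnp i).bounded
      obtain ⟨M, hM⟩ := (hnp i).contDiff.continuous.bounded_above_of_compact_support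
        (hnp i).compactSupport
      exact integrable_indicator_slice (hnp i).isOpen.measurableSet hB
        (hnp i).contDiff.continuous.measurable hM t p
  refine ⟨sliceInt ((graphRegion g r).indicator fun _ => 1), deriv (deriv g) 0 / 2,
    half_pos hg.curvature_pos, ?_, ?_, hr.exists_affine_approx,
    fun A V η hA hV hη => hr.exists_chord_approx hA hV hη⟩
  · obtain ⟨δ, hδ, h⟩ := exists_pos_forall_of_finite
      (P := fun i δ => ∀ t, t ≠ 0 → |t| < δ → HasSlope (sliceInt ((E i).indicator (Φ i))) t)
      (fun i δ δ' _ hle h t ht htδ => h t ht (htδ.trans_le hle))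
      fun i => (hnp i).exists_hasSlope hg
    refine ⟨δ, hδ, fun t ht htδ => ?_⟩
    rw [hH]
    exact HasSlope.sum _ fun i _ => h i t ht htδ
  · choose δ hδ K hK h using fun i => (hnp i).exists_remainder_bound hr (hside i)
    obtain ⟨δ₀, hδ₀, hle⟩ := exists_pos_forall_of_finite (P := fun i x => x ≤ δ i)
      (fun i x x' _ hx hx' => hx.trans hx') fun i => ⟨δ i, hδ i, le_rfl⟩
    refine ⟨δ₀, hδ₀, ∑ i, K i, Finset.sum_nonneg fun i _ => hK i, fun t p ε ht hε hεδ hp => ?_⟩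
    rw [hH, Finset.sum_mul, ← Finset.sum_sub_distrib, ← Finset.sum_sub_distrib, Finset.sum_mul,
      ← Finset.sum_sub_distrib]
    refine (Finset.abs_sum_le_sum_abs _ _).trans (Finset.sum_le_sum fun i _ => ?_)
    have := h i t p ε (ht.trans_le (hle i)) hε (hεδ.trans_le (hle i)) hp
    rwa [show (G i ∘ N.symm) 0 = G i x₀ from hΦ0 i] at this

/-! ### The reconstruction as a sum of stencils, and its phases. -/

/-- With the phase `u = Θ(α_k) · (x₀ + ε y) / ε`, the kernel is evaluated at `u - j`, and the offset
relative to `x₀` is `ε j - Θ(α_k) · x₀ = ε (j - u + Θ(α_k) · y)`, which is the form of a stencil.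
The powers of `ε` cancel, leaving the factor `κ`. -/
lemma mul_lambdaRecon_eq (f : Plane → ℝ) (φ : ℝ → ℝ) {χ : ℝ → ℝ} {δ : ℝ} (hδ : δ ≤ 1)
    (hχ : ∀ β, δ ≤ |β| → χ (θ₀ + β) = 0) (κ q : ℝ) {ε : ℝ} (hε : 0 < ε) (y : Plane) :
    ε * lambdaRecon f φ χ κ q ε (x₀ + ε • y) = -(1 / (2 * Real.pi)) *
      (κ * ∑' k : ℤ, χ (θ₀ + ((κ * ε * q - θ₀) + κ * ε * k)) *
        stencil φ (inner ℝ (dir (angle κ q ε k)) (x₀ + ε • y) / ε)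
          (sliceRadon (sliceInt (f ∘ (normalCoords x₀ θ₀).symm)) ε
            ((κ * ε * q - θ₀) + κ * ε * k)
            (inner ℝ (dir (θ₀ + ((κ * ε * q - θ₀) + κ * ε * k))) y))) := by
  have hang : ∀ k : ℤ, angle κ q ε k = θ₀ + ((κ * ε * q - θ₀) + κ * ε * k) := by
    intro k
    rw [angle]
    ring
  have hterm : ∀ k : ℤ, (∑' j : ℤ,
      deriv (deriv φ) ((inner ℝ (dir (angle κ q ε k)) (x₀ + ε • y) - ε * j) / ε) *
        radon f (angle κ q ε k) (ε * j) * χ (angle κ q ε k) * (κ * ε)) =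
      κ * ε * (χ (θ₀ + ((κ * ε * q - θ₀) + κ * ε * k)) *
        stencil φ (inner ℝ (dir (angle κ q ε k)) (x₀ + ε • y) / ε)
          (sliceRadon (sliceInt (f ∘ (normalCoords x₀ θ₀).symm)) ε
            ((κ * ε * q - θ₀) + κ * ε * k)
            (inner ℝ (dir (θ₀ + ((κ * ε * q - θ₀) + κ * ε * k))) y))) := by
    intro k
    rw [hang]
    set β := (κ * ε * q - θ₀) + κ * ε * k with hβ
    rcases le_or_gt δ |β| with h | h
    · rw [hχ β h]
      simp
    · have hcos : 0 < Real.cos β := by linarith [half_le_cos (h.le.trans hδ)]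
      rw [stencil, ← tsum_mul_left, ← tsum_mul_left]
      refine tsum_congr fun j => ?_
      rw [radon_eq_sliceInt (x₀ := x₀) f β _ hcos, sliceRadon]
      have e1 : (inner ℝ (dir (θ₀ + β)) (x₀ + ε • y) - ε * j) / ε =
          inner ℝ (dir (θ₀ + β)) (x₀ + ε • y) / ε - j := by
        field_simp
      have e2 : ε * ((j : ℝ) - inner ℝ (dir (θ₀ + β)) (x₀ + ε • y) / ε +
          inner ℝ (dir (θ₀ + β)) y) = ε * j - inner ℝ (dir (θ₀ + β)) x₀ := by
        rw [inner_add_right, inner_smul_right]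
        field_simp
        ring
      rw [e1, e2]
      ring
  rw [lambdaRecon, tsum_congr hterm, tsum_mul_left]
  field_simp

lemma hasDerivAt_inner_dir (z : Plane) (α : ℝ) :
    HasDerivAt (fun α => (inner ℝ (dir α) z : ℝ)) (inner ℝ (dirPerp α) z) α := by
  simp only [inner_dir, inner_dirPerp]
  exact ((Real.hasDerivAt_cos α).mul_const _).fun_add ((Real.hasDerivAt_sin α).mul_const _)

lemma continuous_inner_dir (z : Plane) : Continuous fun α => (inner ℝ (dir α) z : ℝ) :=
  continuous_iff_continuousAt.2 fun α => (hasDerivAt_inner_dir z α).continuousAt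

lemma norm_dir (α : ℝ) : ‖dir α‖ = 1 := by
  rw [EuclideanSpace.norm_eq, Fin.sum_univ_two, dir_zero, dir_one]
  simp

/-- The sampling phases of consecutive angles differ asymptotically by a constant. -/
lemma eventually_phase_increment (x₀ y : Plane) (θ₀ q : ℝ) {κ : ℝ} (hκ : 0 < κ) (A : ℝ) {ρ : ℝ}
    (hρ : 0 < ρ) :
    ∀ᶠ ε in 𝓝[>] (0 : ℝ), ∀ k : ℤ, |(κ * ε * q - θ₀) + κ * ε * k| ≤ A * √ε →
      |inner ℝ (dir (angle κ q ε (k + 1))) (x₀ + ε • y) / ε -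
        inner ℝ (dir (angle κ q ε k)) (x₀ + ε • y) / ε - inner ℝ (dirPerp θ₀) x₀ * κ| ≤ ρ := by
  have hc : Continuous fun z : ℝ × ℝ => (inner ℝ (dirPerp z.1) (x₀ + z.2 • y) * κ : ℝ) := by
    simp only [inner_dirPerp]
    fun_prop
  obtain ⟨σ, hσ, h⟩ := Metric.eventually_nhds_iff.1
    ((hc.tendsto (θ₀, 0)).eventually (Metric.closedBall_mem_nhds _ hρ))
  filter_upwards [self_mem_nhdsWithin, eventually_mul_sqrt_le A (show 0 < σ / 4 by positivity),
    eventually_mul_le κ (show 0 < σ / 4 by positivity),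
    eventually_mul_le 1 (show 0 < σ / 2 by positivity)] with ε hε hA hκε hεσ k hk
  have hε : 0 < ε := hε
  have hd : 0 < κ * ε := by positivity
  have hlt : angle κ q ε k < angle κ q ε (k + 1) := by
    rw [angle, angle]
    push_cast
    nlinarith
  -- By the mean value theorem the increment is `κ` times the derivative at an intermediate angle,
  -- which lies within `A * √ε + κ * ε` of `θ₀`.
  obtain ⟨c, hc1, hc2⟩ := exists_hasDerivAt_eq_slope
    (fun α => (inner ℝ (dir α) (x₀ + ε • y) : ℝ)) _ hlt
    (continuous_inner_dir _).continuousOn fun α _ => hasDerivAt_inner_dir (x₀ + ε • y) α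
  have hstep : angle κ q ε (k + 1) - angle κ q ε k = κ * ε := by
    rw [angle, angle]
    push_cast
    ring
  have hk' : |angle κ q ε k - θ₀| ≤ A * √ε := by
    refine le_trans (le_of_eq ?_) hk
    congr 1
    rw [angle]
    ring
  rw [hstep, eq_div_iff hd.ne'] at hc2
  have e : (inner ℝ (dir (angle κ q ε (k + 1))) (x₀ + ε • y) / ε -
      inner ℝ (dir (angle κ q ε k)) (x₀ + ε • y) / ε : ℝ) =
      inner ℝ (dirPerp c) (x₀ + ε • y) * κ := by
    rw [← sub_div, ← hc2]
    field_simp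
  rw [e]
  have hcθ : |c - θ₀| < σ := by
    rw [abs_le] at hk'
    rw [abs_lt]
    constructor <;> linarith [hc1.1, hc1.2]
  have := h (y := (c, ε)) (by
    rw [Prod.dist_eq, Real.dist_eq, Real.dist_eq, sub_zero, abs_of_pos hε]
    exact max_lt hcθ (by linarith))
  simpa [Real.dist_eq] using this

end LambdaTomography

/-! ### The theorem. -/

theorem mainTheorem4 (n : ℕ)
    (D : Fin n → Set LambdaTomography.Plane) (F : Fin n → LambdaTomography.Plane → ℝ)
    (hDF : ∀ i, LambdaTomography.IsSmoothPiece (D i) (F i))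
    (x₀ : LambdaTomography.Plane) (θ₀ : ℝ) (g : ℝ → ℝ)
    (hcurv : LambdaTomography.IsCurvedNear (LambdaTomography.jumpSet D) x₀ θ₀ g)
    (htan : ∀ z, LambdaTomography.LineTangentAt (LambdaTomography.jumpSet D) x₀ θ₀ z → z = x₀) :
    ∃ fPos fNeg : ℝ,
      Tendsto (LambdaTomography.piecewiseSum D F)
        (𝓝[LambdaTomography.positiveSide x₀ θ₀ g] x₀) (𝓝 fPos) ∧
      Tendsto (LambdaTomography.piecewiseSum D F)
        (𝓝[LambdaTomography.negativeSide x₀ θ₀ g] x₀) (𝓝 fNeg) ∧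
      ∃ δ : ℝ, 0 < δ ∧
        ∀ χ : ℝ → ℝ, ContDiff ℝ ∞ χ → tsupport χ ⊆ Ioo (θ₀ - δ) (θ₀ + δ) → χ θ₀ = 1 →
        ∀ φ : ℝ → ℝ, LambdaTomography.IsInterpolationKernel φ →
        ∀ κ q : ℝ, 0 < κ → Irrational (inner ℝ (LambdaTomography.dirPerp θ₀) x₀ * κ) →
        ∀ y : LambdaTomography.Plane, ∃ L : ℝ,
          LambdaTomography.IsPVTransform φ (inner ℝ (LambdaTomography.dir θ₀) y) L ∧
          Tendsto
            (fun ε : ℝ => ε * LambdaTomography.lambdaRecon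
              (LambdaTomography.piecewiseSum D F) φ χ κ q ε (x₀ + ε • y))
            (𝓝[>] 0) (𝓝 ((fPos - fNeg) * L)) := by
  obtain ⟨fPos, fNeg, hPos, hNeg, X, b, hmodel⟩ :=
    LambdaTomography.exists_limits_and_isSliceModel hDF hcurv htan
  obtain ⟨δ, hδ, hsum⟩ := hmodel.tendsto_sum
  -- The bound `1` keeps `cos β` positive on the support of the cut-off, as the passage to slice
  -- integrals requires.
  refine ⟨fPos, fNeg, hPos, hNeg, min δ 1, by positivity,
    fun χ hχ hsupp hχ1 φ hφ κ q hκ hirr y => ?_⟩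
  have hχ0 : ∀ β, min δ 1 ≤ |β| → χ (θ₀ + β) = 0 := by
    intro β hβ
    by_contra hne
    have := hsupp (subset_tsupport _ hne)
    have hlt : |β| < min δ 1 := by
      rw [abs_lt]
      constructor <;> linarith [this.1, this.2]
    exact absurd hβ (not_le.2 hlt)
  refine ⟨_, LambdaTomography.isPVTransform_integral hφ _, ?_⟩
  have hlim := hsum (fun β => χ (θ₀ + β)) (hχ.continuous.comp (continuous_const_add θ₀))
    (fun β hβ => hχ0 β ((min_le_left _ _).trans hβ)) (by simpa using hχ1) φ hφ κ hκ
    (fun β => inner ℝ (LambdaTomography.dir (θ₀ + β)) y) ‖y‖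
    ((LambdaTomography.continuous_inner_dir y).comp (continuous_const_add θ₀)).continuousAt
    (fun β => by
      have := abs_real_inner_le_norm (LambdaTomography.dir (θ₀ + β)) y
      rwa [LambdaTomography.norm_dir, one_mul] at this)
    (fun ε => κ * ε * q - θ₀)
    (fun ε k => inner ℝ (LambdaTomography.dir (LambdaTomography.angle κ q ε k)) (x₀ + ε • y) / ε)
    _ hirr fun A ρ hρ => LambdaTomography.eventually_phase_increment x₀ y θ₀ q hκ A hρ
  have h2 := hlim.const_mul (-(1 / (2 * Real.pi)))
  simp only [add_zero] at h2
  have e : ∀ I : ℝ, (fPos - fNeg) * (-(1 / (2 * Real.pi)) * I) =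
      -(1 / (2 * Real.pi)) * ((fPos - fNeg) * I) := fun I => by ring
  rw [e]
  refine h2.congr' ?_
  filter_upwards [self_mem_nhdsWithin] with ε hε
  exact (LambdaTomography.mul_lambdaRecon_eq _ φ (min_le_right _ _) hχ0 κ q hε y).symm
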